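/- Let $\mathcal W$ be a holomorphic $d$-web on a complex surface $M$, i.e. an open covering $(U_i)$ of $M$ with holomorphic $d$-symmetric $1$-forms $\omega_i\in\mathrm{Sym}^d\Omega^1_M(U_i)$ with isolated zeros, which differ by units on the overlaps and which, at a generic point, are products of $d$ pairwise linearly independent $1$-forms. Let $\Delta(\mathcal W)$ be its discriminant, whose support is the set of points where $\omega_i(m)$ is not such a product, and let $D$ be an irreducible component of $\Delta(\mathcal W)$. The characteristic surface $S_{\mathcal W}\subset\mathbb P T^*M$ is the closure of the set of $(m,[\eta])$ with $m\notin\Delta(\mathcal W)$ such that $\ker\eta$ is tangent to a leaf of $\mathcal W$ through $m$; assume that $\mathcal W$ is smooth along $D$, i.e. that for every generic $m\in D$ the surface $S_{\mathcal W}$ is smooth at every point over $m$. Fix local coordinates $(x,y)$ on an open subset of $M$, in which $D=\{y=0\}$ (non-empty and connected), and let $F(x,y,p)=\sum_{i=0}^d a_i(x,y)p^{d-i}=0$, $p=\frac{dy}{dx}$, be an implicit differential equation defining $\mathcal W$ there, i.e. the $a_i$ are holomorphic and $\sum_i a_i\,(dx)^i(dy)^{d-i}$ differs from the forms $\omega_j$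 by units. Assume that $$F(x,0,p)=a_0(x)\,(p-\varphi_0(x))^{\nu}\prod_{\alpha=1}^{d-\nu}(p-\varphi_\alpha(x)),\qquad a_0(x):=a_0(x,0),$$ where $2\le\nu\le d$, the $\varphi_0,\dots,\varphi_{d-\nu}$ are meromorphic functions of $x$, $\varphi_\alpha\not\equiv\varphi_0$ for all $\alpha\ge1$, and $\varphi_\alpha\not\equiv\varphi_\beta$ for $\alpha\ne\beta$. Put $$\psi(x)=(\nu-2)\left(d-\varphi_0(x)\,\frac{\partial_p\partial_yF(x,0,\varphi_0(x))}{\partial_yF(x,0,\varphi_0(x))}\right)-2(\nu+1)\sum_{\alpha=1}^{d-\nu}\frac{\varphi_\alpha(x)}{\varphi_0(x)-\varphi_\alpha(x)} .$$ The curvature of $\mathcal W$ is the $2$-form $K(\mathcal W)=d\eta(\mathcal W)$, holomorphic off $\Delta(\mathcal W)$, where locally off $\Delta(\mathcal W)$, if $\mathcal W$ is the superposition of the foliations given by $1$-forms $\omega_1,\dots,\omega_d$, then $\eta(\mathcal W)=\sum_{r<s<t}\eta_{rst}$ with $\eta_{rst}$ the unique $1$-form such that, with $\omega_i\wedge\omega_j=\delta_{ij}\,dx\wedge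 dy$, $$d(\delta_{st}\omega_r)=\eta_{rst}\wedge\delta_{st}\omega_r,\quad d(\delta_{tr}\omega_s)=\eta_{rst}\wedge\delta_{tr}\omega_s,\quad d(\delta_{rs}\omega_t)=\eta_{rst}\wedge\delta_{rs}\omega_t .$$ Then $K(\mathcal W)$ is holomorphic on $D$, i.e. extends holomorphically across every generic point of $D$, if and only if $\varphi_0\equiv0$ or $\psi\equiv0$. -/

import Mathlib

open scoped Manifold ContDiff Topology

noncomputable section

namespace PlanarWeb

/-! ### Calculus of differential forms in two complex coordinates `(x, y)`

A `1`-form `A dx + B dy` is the map `z ↦ (A z, B z)`; a `2`-form `k dx ∧ dy` is the function `k`. -/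

/-- Value of the covector `A dx + B dy` at the vector `v = (dx, dy)`. -/
def evalForm (α v : ℂ × ℂ) : ℂ := α.1 * v.1 + α.2 * v.2

/-- `(A dx + B dy) ∧ (C dx + D dy) = (A D - B C) dx ∧ dy`. -/
def wedge (α β : ℂ × ℂ) : ℂ := α.1 * β.2 - α.2 * β.1

/-- Partial derivatives of a function of `(x, y)`. -/
def partialX (f : ℂ × ℂ → ℂ) (z : ℂ × ℂ) : ℂ := fderiv ℂ f z (1, 0)

def partialY (f : ℂ × ℂ → ℂ) (z : ℂ × ℂ) : ℂ := fderiv ℂ f z (0, 1)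

/-- Exterior derivative `d (A dx + B dy) = (∂ₓB - ∂_yA) dx ∧ dy`. -/
def extD (α : ℂ × ℂ → ℂ × ℂ) (z : ℂ × ℂ) : ℂ :=
  partialX (fun w => (α w).2) z - partialY (fun w => (α w).1) z

/-- The symmetric form `∑ₖ aₖ(x,y) (dx)ᵏ (dy)^(d-k)`, evaluated at `z = (x, y)` and `v = (dx, dy)`. -/
def symForm {d : ℕ} (a : Fin (d + 1) → ℂ × ℂ → ℂ) (z v : ℂ × ℂ) : ℂ :=
  ∑ k : Fin (d + 1), a k z * v.1 ^ (k : ℕ) * v.2 ^ (d - (k : ℕ))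

/-- The polynomial `F(x,y,p) = ∑ₖ aₖ(x,y) p^(d-k)`. -/
def slopePoly {d : ℕ} (a : Fin (d + 1) → ℂ × ℂ → ℂ) (z : ℂ × ℂ) (p : ℂ) : ℂ :=
  ∑ k : Fin (d + 1), a k z * p ^ (d - (k : ℕ))

/-! ### Webs on a complex surface -/

/-- The model of complex surfaces. -/
abbrev I₂ : ModelWithCorners ℂ (ℂ × ℂ) (ℂ × ℂ) := 𝓘(ℂ, ℂ × ℂ)

/-- Local holomorphic coordinate systems `(x, y)` on `M`. -/
abbrev Coord (M : Type*) [TopologicalSpace M] [ChartedSpace (ℂ × ℂ) M] :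
    Set (OpenPartialHomeomorph M (ℂ × ℂ)) :=
  IsManifold.maximalAtlas I₂ ω M

section

variable {M : Type*} [TopologicalSpace M] [ChartedSpace (ℂ × ℂ) M]

/-- The expression of `s` (a function on the tangent spaces of `M`) in the coordinate system `e`:
its value at the point with coordinates `z` on the tangent vector with coordinates `v`. -/
def inCoord (e : OpenPartialHomeomorph M (ℂ × ℂ)) (s : (m : M) → TangentSpace I₂ m → ℂ)
    (z v : ℂ × ℂ) : ℂ :=
  s (e.symm z) (mfderiv I₂ I₂ e.symm z v)

/-- `s` is a holomorphic `d`-symmetric `1`-form on `U`, i.e. an element of `Sym^d Ω¹(U)`, seen as a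
field of homogeneous polynomials of degree `d` on the tangent spaces. -/
def IsSymForm (d : ℕ) (U : Set M) (s : (m : M) → TangentSpace I₂ m → ℂ) : Prop :=
  ∀ e ∈ Coord M, ∃ a : Fin (d + 1) → ℂ × ℂ → ℂ,
    (∀ k, AnalyticOnNhd ℂ (a k) (e.target ∩ e.symm ⁻¹' U)) ∧
    ∀ z ∈ e.target ∩ e.symm ⁻¹' U, ∀ v, inCoord e s z v = symForm a z v

/-- A polynomial function on a vector space is the product of `d` pairwise linearly independent
linear forms. -/
def SplitsDistinct (d : ℕ) {T : Type*} [AddCommGroup T] [Module ℂ T] (f : T → ℂ) : Prop :=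
  ∃ l : Fin d → T →ₗ[ℂ] ℂ,
    (∀ i j, i ≠ j → LinearIndependent ℂ ![l i, l j]) ∧ ∀ v, f v = ∏ i, l i v

end

/-- A (global, holomorphic) `d`-web on the complex surface `M`. -/
structure Web (d : ℕ) (M : Type*) [TopologicalSpace M] [ChartedSpace (ℂ × ℂ) M] where
  /-- index set of the covering -/
  ι : Type*
  /-- the open covering -/
  U : ι → Set M
  isOpen_U : ∀ i, IsOpen (U i)
  cover : ⋃ i, U i = Set.univ
  /-- the local `d`-symmetric `1`-forms; only the values of `form i` on `U i` matter -/
  form : ι → (m : M) → TangentSpace I₂ m → ℂ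
  isSymForm : ∀ i, IsSymForm d (U i) (form i)
  /-- the zeros are isolated -/
  isolated_zeros : ∀ i, ∀ m ∈ U i, ∀ᶠ m' in 𝓝[≠] m, ∃ v, form i m' v ≠ 0
  /-- two of the local forms differ by a unit -/
  compat : ∀ i j, ∃ g : M → ℂ, ContMDiffOn I₂ 𝓘(ℂ) ω g (U i ∩ U j) ∧
    ∀ m ∈ U i ∩ U j, g m ≠ 0 ∧ ∀ v, form i m v = g m * form j m v
  /-- generically the forms split into pairwise independent linear factors -/
  generic_splits : ∀ i, U i ⊆ closure {m ∈ U i | SplitsDistinct d (form i m)}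

section

variable {d : ℕ} {M : Type*} [TopologicalSpace M] [ChartedSpace (ℂ × ℂ) M]

/-- The support of the discriminant `Δ(W)`: the points where the form defining the web is not a
product of `d` pairwise linearly independent linear forms. -/
def discriminant (W : Web d M) : Set M :=
  {m | ∃ i, m ∈ W.U i ∧ ¬ SplitsDistinct d (W.form i m)}

/-- The regular locus of a curve `A ⊆ M`: the points near which `A` is `{y = 0}` in suitable
coordinates. -/
def regularLocus (A : Set M) : Set M :=
  {m | m ∈ A ∧ ∃ e ∈ Coord M, m ∈ e.source ∧ A ∩ e.source = {m' ∈ e.source | (e m').2 = 0}}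

/-- The irreducible components of a curve `A ⊆ M` are the closures of the connected components of
its regular locus. -/
def IsIrreducibleComponent (A D : Set M) : Prop :=
  ∃ m ∈ regularLocus A, D = closure (connectedComponentIn (regularLocus A) m)

/-- `P m` holds for every generic point `m` of `D`: it holds on a relatively open dense subset
of `D`. -/
def ForGeneric (D : Set M) (P : M → Prop) : Prop :=
  ∃ O : Set M, IsOpen O ∧ D ⊆ closure (D ∩ O) ∧ ∀ m ∈ D ∩ O, P m

/-- In the coordinates `e`, the implicit differential equation `F(x,y,p) = 0`, `p = dy/dx`, with
`F = ∑ₖ aₖ(x,y) p^(d-k)`, defines `W`: the coefficients are holomorphic and the symmetric form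
`∑ₖ aₖ (dx)ᵏ (dy)^(d-k)` differs from the local forms of `W` by units. -/
def IsImplicitEquation (W : Web d M) (e : OpenPartialHomeomorph M (ℂ × ℂ))
    (a : Fin (d + 1) → ℂ × ℂ → ℂ) : Prop :=
  (∀ k, AnalyticOnNhd ℂ (a k) e.target) ∧
  ∀ i, ∃ g : ℂ × ℂ → ℂ, AnalyticOnNhd ℂ g (e.target ∩ e.symm ⁻¹' W.U i) ∧
    ∀ z ∈ e.target ∩ e.symm ⁻¹' W.U i, g z ≠ 0 ∧
      ∀ v, inCoord e (W.form i) z v = g z * symForm a z v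

/-! ### The characteristic surface and smoothness along a component of the discriminant -/

/-- The tangent locus `T_m W`: the union of the kernels of the linear factors at `m` of the form
defining `W`, i.e. its zero set. -/
def tangentLocus (W : Web d M) (m : M) : Set (TangentSpace I₂ m) :=
  {v | ∃ i, m ∈ W.U i ∧ W.form i m v = 0}

/-- The characteristic surface of `W` in the affine chart `(x, y, p)` of `ℙT*M` attached to the
coordinates `e = (x, y)`, in which `(x, y, p)` is the class of the covector `dy - p dx` at the point
with coordinates `(x, y)`. It is the closure, in that chart, of the set of the `(m, [η])` with `m`
off the discriminant and `ker η ⊆ T_m W`. -/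
def charSurface (W : Web d M) (e : OpenPartialHomeomorph M (ℂ × ℂ)) : Set ((ℂ × ℂ) × ℂ) :=
  closure {s | s.1 ∈ e.target ∧ e.symm s.1 ∉ discriminant W ∧
      ∀ v : ℂ × ℂ, evalForm (-s.2, 1) v = 0 →
        mfderiv I₂ I₂ e.symm s.1 v ∈ tangentLocus W (e.symm s.1)}
    ∩ {s | s.1 ∈ e.target}

/-- Smoothness at `s` of a surface `S` in a three-dimensional space: near `s`, `S` is the zero set of
a holomorphic function whose differential at `s` is nonzero. -/
def IsSmoothSurfaceAt (S : Set ((ℂ × ℂ) × ℂ)) (s : (ℂ × ℂ) × ℂ) : Prop :=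
  ∃ g : (ℂ × ℂ) × ℂ → ℂ, AnalyticAt ℂ g s ∧ fderiv ℂ g s ≠ 0 ∧ ∀ᶠ u in 𝓝 s, u ∈ S ↔ g u = 0

/-- `W` is smooth along `D`: over a generic point `m` of `D`, the characteristic surface is smooth
at every point of its fibre. The affine charts attached to all the coordinate systems at `m`
(for instance to `(x, y)` and `(y, x)`) cover the fibre of `ℙT*M` over `m`. -/
def SmoothAlong (W : Web d M) (D : Set M) : Prop :=
  ForGeneric D fun m => ∀ e ∈ Coord M, m ∈ e.source → ∀ p : ℂ,
    (e m, p) ∈ charSurface W e → IsSmoothSurfaceAt (charSurface W e) (e m, p)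

/-! ### Fundamental form and curvature -/

/-- On `V`, `η` is the fundamental form of the `3`-web given by the `1`-forms `α, β, γ`. -/
def IsFundamentalForm₃ (V : Set (ℂ × ℂ)) (α β γ η : ℂ × ℂ → ℂ × ℂ) : Prop :=
  AnalyticOnNhd ℂ η V ∧ ∀ z ∈ V,
    extD (fun w => wedge (β w) (γ w) • α w) z = wedge (η z) (wedge (β z) (γ z) • α z) ∧
    extD (fun w => wedge (γ w) (α w) • β w) z = wedge (η z) (wedge (γ z) (α z) • β z) ∧
    extD (fun w => wedge (α w) (β w) • γ w) z = wedge (η z) (wedge (α z) (β z) • γ z)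

/-- On `V`, `η` is the fundamental form `∑_{r<s<t} η_{rst}` of the `d`-web given by the `1`-forms
`θ 0, …, θ (d-1)`. -/
def IsFundamentalForm (V : Set (ℂ × ℂ)) (θ : Fin d → ℂ × ℂ → ℂ × ℂ) (η : ℂ × ℂ → ℂ × ℂ) :
    Prop :=
  ∃ η₃ : Fin d → Fin d → Fin d → ℂ × ℂ → ℂ × ℂ,
    (∀ r s t, r < s → s < t → IsFundamentalForm₃ V (θ r) (θ s) (θ t) (η₃ r s t)) ∧
    ∀ z, η z = ∑ r, ∑ s, ∑ t, if r < s ∧ s < t then η₃ r s t z else 0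

/-- On the open subset `V` of the coordinate domain of `e`, the web `W` is the superposition of the
pairwise transverse regular foliations defined by the holomorphic `1`-forms `θ 0, …, θ (d-1)`. -/
def IsDecomposition (W : Web d M) (e : OpenPartialHomeomorph M (ℂ × ℂ)) (V : Set (ℂ × ℂ))
    (θ : Fin d → ℂ × ℂ → ℂ × ℂ) : Prop :=
  IsOpen V ∧ V ⊆ e.target ∧ (∀ j, AnalyticOnNhd ℂ (θ j) V) ∧
  (∀ z ∈ V, ∀ j k, j ≠ k → wedge (θ j z) (θ k z) ≠ 0) ∧
  ∀ i, ∀ z ∈ V, e.symm z ∈ W.U i →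
    ∃ c : ℂ, c ≠ 0 ∧ ∀ v, inCoord e (W.form i) z v = c * ∏ j, evalForm (θ j z) v

/-- `k dx ∧ dy` is the value at `z` of `dη`, where `η` is the fundamental form of some decomposition
of `W` near `z`. -/
def IsCurvatureAt (W : Web d M) (e : OpenPartialHomeomorph M (ℂ × ℂ)) (z : ℂ × ℂ) (k : ℂ) : Prop :=
  ∃ (V : Set (ℂ × ℂ)) (θ : Fin d → ℂ × ℂ → ℂ × ℂ) (η : ℂ × ℂ → ℂ × ℂ),
    z ∈ V ∧ IsDecomposition W e V θ ∧ IsFundamentalForm V θ η ∧ k = extD η z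

open Classical in
/-- The curvature of `W` in the coordinates `e = (x, y)`: `K(W) = (curvature W e) dx ∧ dy` off the
discriminant. (The value `0` on the discriminant is meaningless.) -/
def curvature (W : Web d M) (e : OpenPartialHomeomorph M (ℂ × ℂ)) (z : ℂ × ℂ) : ℂ :=
  if h : ∃ k, IsCurvatureAt W e z k then h.choose else 0

/-- The meromorphic `2`-form `K(W)` is holomorphic on the component `D` of the discriminant, i.e. it
has no pole along `D`: near a generic point of `D`, it coincides off the discriminant with a
holomorphic `2`-form. -/
def CurvatureHolomorphicOn (W : Web d M) (D : Set M) : Prop :=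
  ForGeneric D fun m => ∀ e ∈ Coord M, m ∈ e.source →
    ∃ h : ℂ × ℂ → ℂ, AnalyticAt ℂ h (e m) ∧
      ∀ᶠ z in 𝓝 (e m), e.symm z ∉ discriminant W → curvature W e z = h z

end

/-! ### The function `ψ` -/

/-- The domain of the coordinate `x` on `{y = 0}`. -/
def axis {M : Type*} [TopologicalSpace M] (e : OpenPartialHomeomorph M (ℂ × ℂ)) : Set ℂ := {x | ((x, 0) : ℂ × ℂ) ∈ e.target}

/-- `ψ(x) = (ν-2) (d - φ₀ ∂ₚ∂_yF(x,0,φ₀) / ∂_yF(x,0,φ₀)) - 2 (ν+1) ∑_α φ_α / (φ₀ - φ_α)`. -/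
def psi {d n : ℕ} (ν : ℕ) (a : Fin (d + 1) → ℂ × ℂ → ℂ) (φ₀ : ℂ → ℂ) (φ : Fin n → ℂ → ℂ)
    (x : ℂ) : ℂ :=
  ((ν : ℂ) - 2) *
      ((d : ℂ) - φ₀ x *
        (deriv (fun p => partialY (fun w => slopePoly a w p) (x, 0)) (φ₀ x) /
          partialY (fun w => slopePoly a w (φ₀ x)) (x, 0)))
    - 2 * ((ν : ℂ) + 1) * ∑ α, φ α x / (φ₀ x - φ α x)

end PlanarWeb

end

/-! Where `a 0 ≠ 0` and off the discriminant, the leaves of the web have as slopes the `d` simple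
roots `p_r` of `F`. Writing the foliations as multiples of `dy - p_r dx`, each `η_{rst}` is a
logarithmic differential plus an expression in the derivatives `∂ₓp + p ∂_yp` and `∂_yp` of the
slopes and the differences of slopes. Logarithmic differentials are closed, so they do not affect
the curvature. In the rest, the sums over triples are sums of `((p_r - p_s)(p_r - p_t))⁻¹` and `(p_r
- p_s)⁻¹`, which are quotients of `p`-derivatives of `F` at `p_r`. The curvature is thus the
exterior derivative of `rootForm a`, a sum over the roots of a rational expression in the
derivatives of `F`, independent of labelling and of the chosen decomposition
(`IsRootSystem.extD_fundamentalForm`, `IsLocalEquation.curvature_eq`).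

At a generic point of `D`, smoothness of the characteristic surface makes `F` a submersion on its
zero set (`fderiv_slopePoly_ne_zero`). At `(x, 0, φ₀)` the derivatives in `x` and `p` vanish because
`ν ≥ 2`, so `∂_yF ≠ 0`. With `y = t ^ ν`, the `ν` colliding roots are then `φ₀ + ζ^j t v(x, ζ^j t)`,
all obtained from one holomorphic `v`, and the others are holomorphic in `y`
(`IsFactored.exists_isUnfolding`). A colliding root contributes to `y * rootForm` a term `m(ζ^j t) /
(ζ^j t)`. The terms `m(0) / (ζ^j t)` cancel because `∑ ζ^(-j) = 0`, so `y * rootForm` has a finite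
limit on `{y = 0}` (`IsFactored.tendsto_rootForm`): the form is `(A dx + B dy) / y` with `A`, `B`
holomorphic.

Hence `y² K = y (∂ₓB - ∂_yA) + A`, and `K` extends exactly when `A(x, 0)` and `∂ₓB(x, 0)` vanish.
Computing the limits gives `A(x, 0) = -((ν - 1) / (6 ν)) φ₀ ψ` (`IsFactored.resA_eq`). Moreover `A +
φ₀ B` is a constant multiple of `φ₀` on the axis, so `A(x, 0) ≡ 0` already makes `B(x, 0)` constant
(`IsFactored.resB_eventually_const`). Local holomorphy thus amounts to `φ₀ ψ ≡ 0`, and on a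
connected axis a product of meromorphic functions vanishes only if a factor does.

Passing from one generic point to the component rests on `exists_analytic_extension`: a function
holomorphic off `{y = 0}` in a polydisc extends as soon as it is bounded on slices accumulating
somewhere. Extension of `K` is therefore open and closed along the regular part of a component
(`curvatureHolomorphicOn_of_extendsAt`). -/

noncomputable section

namespace PlanarWeb

open Filter Metric Set

/-! ### Analytic extension across an axis -/

/-- The function `(θ, θ') ↦ circleMap c r (π (θ, θ'))`, as a bounded continuous function. -/
def circleFun (c : ℂ) (r : ℝ) (π : C(ℝ × ℝ, ℝ)) : BoundedContinuousFunction (ℝ × ℝ) ℂ :=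
  BoundedContinuousFunction.ofNormedAddCommGroup (fun θ => circleMap c r (π θ))
    ((continuous_circleMap c r).comp π.continuous) (‖c‖ + |r|) fun θ => by
      refine (norm_add_le _ _).trans ?_
      simp

/-- The points of the circle stay at distance at least `r - dist x c` from `x`, so the difference is
a unit of the Banach algebra of bounded continuous functions, where inversion is analytic. This
makes the Cauchy kernel an analytic function-valued map, and Cauchy integrals become analytic after
applying a continuous linear functional. -/
lemma analyticAt_inverse_circleFun {c : ℂ} {r : ℝ} (π : C(ℝ × ℝ, ℝ)) {x : ℂ}
    (hx : x ∈ ball c r) :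
    AnalyticAt ℂ (fun x : ℂ => Ring.inverse
      (circleFun c r π - x • (1 : BoundedContinuousFunction (ℝ × ℝ) ℂ))) x ∧
    ∀ θ, Ring.inverse (circleFun c r π - x • (1 : BoundedContinuousFunction (ℝ × ℝ) ℂ)) θ =
      (circleMap c r (π θ) - x)⁻¹ := by
  have hr : 0 < r := dist_nonneg.trans_lt (mem_ball.1 hx)
  have hlow : ∀ θ : ℝ × ℝ, r - dist x c ≤ ‖circleMap c r (π θ) - x‖ := fun θ => by
    have h1 : ‖circleMap c r (π θ) - c‖ = r := by simp [abs_of_pos hr]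
    have h2 := norm_sub_le_norm_sub_add_norm_sub (circleMap c r (π θ)) x c
    rw [h1] at h2
    rw [dist_eq_norm]
    linarith
  have hpos : 0 < r - dist x c := sub_pos.2 (mem_ball.1 hx)
  have hne : ∀ θ : ℝ × ℝ, circleMap c r (π θ) - x ≠ 0 := fun θ =>
    norm_pos_iff.1 (hpos.trans_le (hlow θ))
  set v : BoundedContinuousFunction (ℝ × ℝ) ℂ :=
    BoundedContinuousFunction.ofNormedAddCommGroup (fun θ => (circleMap c r (π θ) - x)⁻¹)
      ((((continuous_circleMap c r).comp π.continuous).sub continuous_const).inv₀ hne)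
      (r - dist x c)⁻¹ (fun θ => by
        rw [norm_inv]; exact inv_anti₀ hpos (hlow θ)) with hv
  set u : BoundedContinuousFunction (ℝ × ℝ) ℂ := circleFun c r π - x • 1 with hu
  have huθ : ∀ θ, u θ = circleMap c r (π θ) - x := fun θ => by simp [hu, circleFun]; rfl
  have huv : u * v = 1 := by
    ext θ
    simp only [BoundedContinuousFunction.mul_apply, huθ, hv, BoundedContinuousFunction.coe_one, Pi.one_apply,
      BoundedContinuousFunction.coe_ofNormedAddCommGroup]
    exact mul_inv_cancel₀ (hne θ)
  let w : (BoundedContinuousFunction (ℝ × ℝ) ℂ)ˣ := ⟨u, v, huv, by rw [mul_comm, huv]⟩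
  constructor
  · have h1 : AnalyticAt ℂ Ring.inverse (circleFun c r π - x • 1) := analyticAt_inverse (𝕜 := ℂ) w
    have h2 : AnalyticAt ℂ (fun x : ℂ => circleFun c r π -
      x • (1 : BoundedContinuousFunction (ℝ × ℝ) ℂ)) x := by fun_prop
    exact AnalyticAt.fun_comp (f := fun x : ℂ => circleFun c r π -
      x • (1 : BoundedContinuousFunction (ℝ × ℝ) ℂ)) h1 h2
  · intro θ
    have : Ring.inverse u = v := Ring.inverse_unit w
    rw [this]; simp [hv]

/-- Integration of a bounded function of two angles against a continuous weight. -/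
lemma exists_clm_integral (k : ℝ × ℝ → ℂ) (hk : Continuous k) :
    ∃ L : BoundedContinuousFunction (ℝ × ℝ) ℂ →L[ℂ] ℂ, ∀ g,
      L g = ∫ t in (0 : ℝ)..2 * Real.pi, ∫ s in (0 : ℝ)..2 * Real.pi, g (s, t) * k (s, t) := by
  have hc : ∀ g : BoundedContinuousFunction (ℝ × ℝ) ℂ, Continuous fun p : ℝ × ℝ =>
      g (p.2, p.1) * k (p.2, p.1) := fun g => by
    have := g.continuous
    fun_prop
  have hi : ∀ (g : BoundedContinuousFunction (ℝ × ℝ) ℂ) (t : ℝ),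
      IntervalIntegrable (fun s => g (s, t) * k (s, t)) MeasureTheory.volume 0 (2 * Real.pi) :=
    fun g t => by
      have := g.continuous
      exact Continuous.intervalIntegrable (by fun_prop) _ _
  have hii : ∀ g : BoundedContinuousFunction (ℝ × ℝ) ℂ,
      Continuous fun t => ∫ s in (0 : ℝ)..2 * Real.pi, g (s, t) * k (s, t) := fun g =>
    intervalIntegral.continuous_parametric_intervalIntegral_of_continuous' (hc g) _ _
  obtain ⟨C, hC⟩ := ((isCompact_Icc (a := (0 : ℝ)) (b := 2 * Real.pi)).prod
    (isCompact_Icc (a := (0 : ℝ)) (b := 2 * Real.pi))).exists_bound_of_continuousOn hk.continuousOn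
  have hpi : (0 : ℝ) ≤ 2 * Real.pi := by positivity
  refine ⟨LinearMap.mkContinuous
    { toFun := fun g => ∫ t in (0 : ℝ)..2 * Real.pi, ∫ s in (0 : ℝ)..2 * Real.pi, g (s, t) * k (s, t)
      map_add' := ?_
      map_smul' := ?_ } (C * (2 * Real.pi) * (2 * Real.pi)) ?_, fun g => rfl⟩
  · intro f g
    rw [← intervalIntegral.integral_add ((hii f).intervalIntegrable _ _)
      ((hii g).intervalIntegrable _ _)]
    congr 1; ext t
    rw [← intervalIntegral.integral_add (hi f t) (hi g t)]
    simp [add_mul]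
  · intro c g
    simp [mul_assoc]
  · intro g
    simp only [LinearMap.coe_mk, AddHom.coe_mk]
    have h1 : ∀ t ∈ Set.uIoc (0 : ℝ) (2 * Real.pi),
        ‖∫ s in (0 : ℝ)..2 * Real.pi, g (s, t) * k (s, t)‖ ≤ ‖g‖ * C * |2 * Real.pi - 0| := by
      intro t ht
      refine intervalIntegral.norm_integral_le_of_norm_le_const fun s hs => ?_
      rw [uIoc_of_le hpi] at ht hs
      rw [norm_mul]
      gcongr
      · exact g.norm_coe_le_norm _
      · exact hC _ ⟨Ioc_subset_Icc_self hs, Ioc_subset_Icc_self ht⟩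
    refine (intervalIntegral.norm_integral_le_of_norm_le_const h1).trans (le_of_eq ?_)
    rw [sub_zero, abs_of_nonneg hpi]; ring

/-- The iterated Cauchy integral over the two circles involves only values of `K` off the axis and
is analytic in the whole polydisc. It equals `K` on slices where the singularity is removable, and
the identity theorem in `x` then gives equality for every `y ≠ 0`. -/
lemma exists_analytic_extension {K : ℂ × ℂ → ℂ} {x₀ : ℂ} {r : ℝ} (hr : 0 < r)
    (hK : ∀ z : ℂ × ℂ, z.1 ∈ closedBall x₀ r → z.2 ∈ closedBall (0 : ℂ) r → z.2 ≠ 0 →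
      AnalyticAt ℂ K z)
    {x₁ : ℂ} (hx₁ : x₁ ∈ ball x₀ r)
    (hb : ∃ᶠ x in 𝓝[≠] x₁, ∃ B : ℝ, ∀ᶠ y in 𝓝[≠] (0 : ℂ), ‖K (x, y)‖ ≤ B) :
    ∃ f : ℂ × ℂ → ℂ, AnalyticOnNhd ℂ f (ball x₀ r ×ˢ ball 0 r) ∧
      ∀ z ∈ ball x₀ r ×ˢ ball (0 : ℂ) r, z.2 ≠ 0 → f z = K z := by
  have hcm : ∀ t : ℝ, circleMap 0 r t ≠ 0 := fun t => circleMap_ne_center hr.ne'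
  have hmem : ∀ (c : ℂ) (t : ℝ), circleMap c r t ∈ closedBall c r := fun c t =>
    circleMap_mem_closedBall _ hr.le t
  have hkc : Continuous fun p : ℝ × ℝ => deriv (circleMap x₀ r) p.1 * deriv (circleMap 0 r) p.2 *
      K (circleMap x₀ r p.1, circleMap 0 r p.2) := by
    simp only [deriv_circleMap]
    have h0 := continuous_circleMap 0 r
    have hx := continuous_circleMap x₀ r
    refine Continuous.mul (by fun_prop) ?_
    rw [continuous_iff_continuousAt]
    intro p
    exact ContinuousAt.comp
      (g := K) (f := fun p : ℝ × ℝ => (circleMap x₀ r p.1, circleMap 0 r p.2))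
      (hK _ (hmem _ _) (hmem _ _) (hcm _)).continuousAt (by fun_prop)
  obtain ⟨L, hL⟩ := exists_clm_integral _ hkc
  let R₁ : ℂ → BoundedContinuousFunction (ℝ × ℝ) ℂ := fun x =>
    Ring.inverse (circleFun x₀ r ⟨Prod.fst, continuous_fst⟩ - x • 1)
  let R₂ : ℂ → BoundedContinuousFunction (ℝ × ℝ) ℂ := fun y =>
    Ring.inverse (circleFun 0 r ⟨Prod.snd, continuous_snd⟩ - y • 1)
  let f : ℂ × ℂ → ℂ := fun z => (2 * Real.pi * Complex.I : ℂ)⁻¹ *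
    ((2 * Real.pi * Complex.I : ℂ)⁻¹ * L (R₁ z.1 * R₂ z.2))
  have hfa : AnalyticOnNhd ℂ f (ball x₀ r ×ˢ ball 0 r) := by
    intro z hz
    have h1 : AnalyticAt ℂ (fun z : ℂ × ℂ => R₁ z.1) z :=
      AnalyticAt.fun_comp (f := fun z : ℂ × ℂ => z.1) (analyticAt_inverse_circleFun _ hz.1).1
        analyticAt_fst
    have h2 : AnalyticAt ℂ (fun z : ℂ × ℂ => R₂ z.2) z :=
      AnalyticAt.fun_comp (f := fun z : ℂ × ℂ => z.2) (analyticAt_inverse_circleFun _ hz.2).1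
        analyticAt_snd
    exact analyticAt_const.mul (analyticAt_const.mul ((L.analyticAt _).fun_comp (h1.mul h2)))
  have hff : ∀ z ∈ ball x₀ r ×ˢ ball (0 : ℂ) r, f z = (2 * Real.pi * Complex.I : ℂ)⁻¹ *
      ∮ w in C(0, r), (w - z.2)⁻¹ * K (z.1, w) := by
    intro z hz
    simp only [f, hL]
    rw [← intervalIntegral.integral_const_mul]
    congr 1
    rw [circleIntegral]
    congr 1; ext t
    -- On the circle in the second variable that coordinate is never `0`, so Cauchy's formula in the
    -- first variable needs no boundedness.
    have hcau : (∮ ξ in C(x₀, r), (ξ - z.1)⁻¹ • K (ξ, circleMap 0 r t)) =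
        (2 * Real.pi * Complex.I : ℂ) • K (z.1, circleMap 0 r t) := by
      refine Complex.circleIntegral_sub_inv_smul_of_differentiable_on_off_countable
        Set.countable_empty hz.1 ?_ ?_
      · intro ξ hξ
        exact (ContinuousAt.comp (g := K) (f := fun ξ : ℂ => (ξ, circleMap 0 r t))
          (hK _ hξ (hmem _ _) (hcm _)).continuousAt (by fun_prop)).continuousWithinAt
      · intro ξ hξ
        exact DifferentiableAt.comp (g := K) (f := fun ξ : ℂ => (ξ, circleMap 0 r t)) ξ
          (hK _ (ball_subset_closedBall hξ.1) (hmem _ _) (hcm _)).differentiableAt (by fun_prop)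
    have hpi : (2 * Real.pi * Complex.I : ℂ) ≠ 0 := Complex.two_pi_I_ne_zero
    have : K (z.1, circleMap 0 r t) = (2 * Real.pi * Complex.I : ℂ)⁻¹ *
        ∮ ξ in C(x₀, r), (ξ - z.1)⁻¹ • K (ξ, circleMap 0 r t) := by
      rw [hcau, smul_eq_mul, inv_mul_cancel_left₀ hpi]
    rw [this, circleIntegral]
    simp only [smul_eq_mul]
    rw [mul_left_comm, mul_left_comm (deriv _ _), ← intervalIntegral.integral_const_mul,
      ← intervalIntegral.integral_const_mul]
    rw [intervalIntegral.integral_const_mul, mul_left_comm (circleMap 0 r t - z.2)⁻¹,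
      ← intervalIntegral.integral_const_mul (circleMap 0 r t - z.2)⁻¹]
    congr 2; ext s
    have e1 := (analyticAt_inverse_circleFun (c := x₀) (r := r) ⟨Prod.fst, continuous_fst⟩ hz.1).2 (s, t)
    have e2 := (analyticAt_inverse_circleFun (c := 0) (r := r) ⟨Prod.snd, continuous_snd⟩ hz.2).2 (s, t)
    simp only [BoundedContinuousFunction.mul_apply, R₁, R₂]
    rw [e1, e2]
    simp only [ContinuousMap.coe_mk]
    ring
  refine ⟨f, hfa, fun z hz hz2 => ?_⟩
  -- On a bounded slice Riemann's theorem removes the singularity at `y = 0`, after which Cauchy's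
  -- formula in `y` applies.
  have hgood : ∀ x ∈ ball x₀ r, (∃ B : ℝ, ∀ᶠ y in 𝓝[≠] (0 : ℂ), ‖K (x, y)‖ ≤ B) →
      f (x, z.2) = K (x, z.2) := by
    rintro x hx ⟨B, hB⟩
    have hd : ∀ y ∈ closedBall (0 : ℂ) r, y ≠ 0 → DifferentiableAt ℂ (fun y => K (x, y)) y :=
      fun y hy hy0 => DifferentiableAt.comp (g := K) (f := fun y : ℂ => (x, y)) y
        (hK _ (ball_subset_closedBall hx) hy hy0).differentiableAt (by fun_prop)
    have hdiff : DifferentiableOn ℂ (Function.update (fun y => K (x, y)) 0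
        (limUnder (𝓝[≠] (0 : ℂ)) fun y => K (x, y))) (ball 0 r) := by
      refine Complex.differentiableOn_update_limUnder_of_isLittleO
        (ball_mem_nhds _ hr) (fun y hy => (hd y (ball_subset_closedBall hy.1) hy.2).differentiableWithinAt) ?_
      have hB' : (fun y : ℂ => K (x, y) - K (x, 0)) =O[𝓝[≠] (0 : ℂ)] (fun _ => (1 : ℂ)) := by
        refine Asymptotics.IsBigO.of_bound (B + ‖K (x, 0)‖) ?_
        filter_upwards [hB] with y hy
        simp only [norm_one, mul_one]
        exact (norm_sub_le _ _).trans (by gcongr)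
      refine hB'.trans_isLittleO ?_
      rw [Asymptotics.isLittleO_const_left]
      right
      have : Tendsto (fun y : ℂ => (y - 0)⁻¹) (𝓝[≠] 0) (Bornology.cobounded ℂ) := by
        simpa using tendsto_inv₀_nhdsNE_zero (α := ℂ)
      exact tendsto_norm_atTop_iff_cobounded.2 this
    set g := Function.update (fun y => K (x, y)) 0 (limUnder (𝓝[≠] (0 : ℂ)) fun y => K (x, y)) with hg
    have hgd : ∀ y ∈ closedBall (0 : ℂ) r, DifferentiableAt ℂ g y := by
      intro y hy
      rcases eq_or_ne y 0 with rfl | hy0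
      · exact (hdiff 0 (mem_ball_self hr)).differentiableAt (ball_mem_nhds _ hr)
      · refine (hd y hy hy0).congr_of_eventuallyEq ?_
        filter_upwards [isOpen_ne.mem_nhds hy0] with w hw
        simp [hg, Function.update_of_ne hw]
    have hcau := Complex.circleIntegral_sub_inv_smul_of_differentiable_on_off_countable
      (s := ∅) (f := g) (c := 0) (R := r) Set.countable_empty hz.2
      (fun y hy => (hgd y hy).continuousAt.continuousWithinAt)
      (fun y hy => hgd y (ball_subset_closedBall hy.1))
    rw [hff (x, z.2) ⟨hx, hz.2⟩]
    have : (∮ w in C(0, r), (w - z.2)⁻¹ • g w) = ∮ w in C(0, r), (w - z.2)⁻¹ * K (x, w) := by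
      refine circleIntegral.integral_congr hr.le fun w hw => ?_
      have hw0 : w ≠ 0 := by
        rintro rfl
        simp at hw; exact hr.ne hw
      simp [hg, Function.update_of_ne hw0]
    simp only
    rw [← this, hcau, smul_eq_mul, inv_mul_cancel_left₀ Complex.two_pi_I_ne_zero, hg,
      Function.update_of_ne hz2]
  have hA : AnalyticOnNhd ℂ (fun x => f (x, z.2)) (ball x₀ r) := fun x hx =>
    AnalyticAt.fun_comp (f := fun x : ℂ => (x, z.2)) (hfa (x, z.2) ⟨hx, hz.2⟩) (by fun_prop)
  have hB : AnalyticOnNhd ℂ (fun x => K (x, z.2)) (ball x₀ r) := fun x hx =>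
    AnalyticAt.fun_comp (f := fun x : ℂ => (x, z.2))
      (hK (x, z.2) (ball_subset_closedBall hx) (ball_subset_closedBall hz.2) hz2) (by fun_prop)
  -- For fixed `y ≠ 0` both sides are analytic in `x` on a disc, and the good slices accumulate at
  -- `x₁`.
  have := hA.eqOn_of_preconnected_of_frequently_eq hB (convex_ball x₀ r).isPreconnected hx₁
    ((hb.and_eventually (nhdsWithin_le_nhds (isOpen_ball.mem_nhds hx₁))).mono
      fun x hx => hgood x hx.2 hx.1)
  exact this hz.1

/-! ### Implicit functions and meromorphic functions -/

lemma exists_analytic_root {E : Type*} [NormedAddCommGroup E] [NormedSpace ℂ E] [CompleteSpace E]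
    {G : E × ℂ → ℂ} {z : E} {p : ℂ} (hG : AnalyticAt ℂ G (z, p)) (h0 : G (z, p) = 0)
    (h1 : fderiv ℂ G (z, p) (0, 1) ≠ 0) :
    ∃ q : E → ℂ, AnalyticAt ℂ q z ∧ q z = p ∧ ∀ᶠ w in 𝓝 z, G (w, q w) = 0 := by
  have hc : ContDiffAt ℂ ω G (z, p) := hG.contDiffAt
  have hinv : (fderiv ℂ G (z, p) ∘L .inr ℂ E ℂ).IsInvertible := by
    refine ⟨ContinuousLinearEquiv.unitsEquivAut ℂ (Units.mk0 _ h1), ?_⟩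
    ext
    simp
  refine ⟨hc.implicitFunction (by simp) hinv, ?_, hc.implicitFunction_apply_self _ _, ?_⟩
  · exact (hc.contDiffAt_implicitFunction (by simp) hinv).analyticAt
  · have := hc.eventually_apply_implicitFunction (by simp) hinv
    simpa [h0] using this

/-- On a preconnected set the meromorphic order is infinite everywhere or nowhere. This is the form
of the identity theorem used for `φ₀`, `ψ`, `∂_yF` and the differences of slopes. -/
lemma eventually_codiscreteWithin_eq_or_ne {U : Set ℂ} (hU : IsPreconnected U)
    {f : ℂ → ℂ} (hf : MeromorphicOn f U) :
    (∀ᶠ x in codiscreteWithin U, f x = 0) ∨ (∀ᶠ x in codiscreteWithin U, f x ≠ 0) := by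
  have key : ∀ {P : ℂ → Prop}, (∀ x ∈ U, ∀ᶠ y in 𝓝[≠] x, P y) → ∀ᶠ x in codiscreteWithin U, P x := by
    intro P h
    rw [Filter.Eventually, mem_codiscreteWithin_iff_forall_mem_nhdsNE]
    intro x hx
    filter_upwards [h x hx] with y hy using Or.inl hy
  by_cases h : ∃ x ∈ U, meromorphicOrderAt f x ≠ ⊤
  · right
    obtain ⟨x, hx, hx'⟩ := h
    refine key fun y hy => ?_
    have := hf.meromorphicOrderAt_ne_top_of_isPreconnected hU hx hy hx'
    exact (meromorphicOrderAt_ne_top_iff_eventually_ne_zero (hf y hy)).1 this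
  · left
    push Not at h
    exact key fun y hy => meromorphicOrderAt_eq_top_iff.1 (h y hy)

lemma eventually_nhdsNE_of_codiscreteWithin {U : Set ℂ} (hU : IsOpen U) {P : ℂ → Prop}
    (h : ∀ᶠ x in codiscreteWithin U, P x) {x : ℂ} (hx : x ∈ U) : ∀ᶠ y in 𝓝[≠] x, P y := by
  rw [Filter.Eventually, mem_codiscreteWithin_iff_forall_mem_nhdsNE] at h
  filter_upwards [h x hx, nhdsWithin_le_nhds (hU.mem_nhds hx)] with y hy hyU
  exact hy.resolve_right fun h' => h' hyU

end PlanarWeb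

end

noncomputable section

namespace PlanarWeb

open Filter Metric Set

/-! ### Calculus of planar forms -/

section calculus

variable {f g : ℂ × ℂ → ℂ} {α β : ℂ × ℂ → ℂ × ℂ} {z : ℂ × ℂ}

lemma analyticAt_partialX (hf : AnalyticAt ℂ f z) : AnalyticAt ℂ (partialX f) z :=
  ((ContinuousLinearMap.apply ℂ ℂ ((1, 0) : ℂ × ℂ)).analyticAt _).fun_comp hf.fderiv

lemma analyticAt_partialY (hf : AnalyticAt ℂ f z) : AnalyticAt ℂ (partialY f) z :=
  ((ContinuousLinearMap.apply ℂ ℂ ((0, 1) : ℂ × ℂ)).analyticAt _).fun_comp hf.fderiv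

lemma partialX_congr (h : f =ᶠ[𝓝 z] g) : partialX f z = partialX g z := by
  rw [partialX, h.fderiv_eq, partialX]

lemma partialY_congr (h : f =ᶠ[𝓝 z] g) : partialY f z = partialY g z := by
  rw [partialY, h.fderiv_eq, partialY]

lemma extD_congr (h : α =ᶠ[𝓝 z] β) : extD α z = extD β z := by
  have h1 : (fun w => (α w).2) =ᶠ[𝓝 z] fun w => (β w).2 := h.fun_comp Prod.snd
  have h2 : (fun w => (α w).1) =ᶠ[𝓝 z] fun w => (β w).1 := h.fun_comp Prod.fst
  rw [extD, extD, partialX_congr h1, partialY_congr h2]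

lemma partialX_add (hf : DifferentiableAt ℂ f z) (hg : DifferentiableAt ℂ g z) :
    partialX (fun w => f w + g w) z = partialX f z + partialX g z := by
  simp [partialX, fderiv_fun_add hf hg]

lemma partialY_add (hf : DifferentiableAt ℂ f z) (hg : DifferentiableAt ℂ g z) :
    partialY (fun w => f w + g w) z = partialY f z + partialY g z := by
  simp [partialY, fderiv_fun_add hf hg]

lemma partialX_sub (hf : DifferentiableAt ℂ f z) (hg : DifferentiableAt ℂ g z) :
    partialX (fun w => f w - g w) z = partialX f z - partialX g z := by
  simp [partialX, fderiv_fun_sub hf hg]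

lemma partialY_sub (hf : DifferentiableAt ℂ f z) (hg : DifferentiableAt ℂ g z) :
    partialY (fun w => f w - g w) z = partialY f z - partialY g z := by
  simp [partialY, fderiv_fun_sub hf hg]

lemma partialY_neg : partialY (fun w => -f w) z = -partialY f z := by
  simp [partialY, fderiv_fun_neg]

lemma partialX_mul (hf : DifferentiableAt ℂ f z) (hg : DifferentiableAt ℂ g z) :
    partialX (fun w => f w * g w) z = partialX f z * g z + f z * partialX g z := by
  simp [partialX, fderiv_fun_mul hf hg]; ring

lemma partialY_mul (hf : DifferentiableAt ℂ f z) (hg : DifferentiableAt ℂ g z) :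
    partialY (fun w => f w * g w) z = partialY f z * g z + f z * partialY g z := by
  simp [partialY, fderiv_fun_mul hf hg]; ring

lemma partialX_inv (hf : DifferentiableAt ℂ f z) (h0 : f z ≠ 0) :
    partialX (fun w => (f w)⁻¹) z = -partialX f z / f z ^ 2 := by
  have : HasFDerivAt (fun w => (f w)⁻¹) (-(f z ^ 2)⁻¹ • fderiv ℂ f z) z :=
    (hasDerivAt_inv h0).comp_hasFDerivAt z hf.hasFDerivAt
  simp [partialX, this.fderiv]; ring

lemma partialY_inv (hf : DifferentiableAt ℂ f z) (h0 : f z ≠ 0) :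
    partialY (fun w => (f w)⁻¹) z = -partialY f z / f z ^ 2 := by
  have : HasFDerivAt (fun w => (f w)⁻¹) (-(f z ^ 2)⁻¹ • fderiv ℂ f z) z :=
    (hasDerivAt_inv h0).comp_hasFDerivAt z hf.hasFDerivAt
  simp [partialY, this.fderiv]; ring

lemma partialX_partialY (hf : AnalyticAt ℂ f z) :
    partialX (partialY f) z = partialY (partialX f) z := by
  have hs : IsSymmSndFDerivAt ℂ f z :=
    (hf.contDiffAt (n := ω)).isSymmSndFDerivAt (by simp)
  have hd : DifferentiableAt ℂ (fderiv ℂ f) z := hf.fderiv.differentiableAt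
  have e : ∀ u v : ℂ × ℂ, fderiv ℂ (fun w => fderiv ℂ f w u) z v = fderiv ℂ (fderiv ℂ f) z v u := by
    intro u v
    rw [fderiv_clm_apply hd (by fun_prop)]
    simp
  change fderiv ℂ (fun w => fderiv ℂ f w (0, 1)) z (1, 0) =
    fderiv ℂ (fun w => fderiv ℂ f w (1, 0)) z (0, 1)
  rw [e, e, hs.eq]

/-- The differential of a function. -/
def grad (f : ℂ × ℂ → ℂ) (z : ℂ × ℂ) : ℂ × ℂ := (partialX f z, partialY f z)

lemma analyticAt_grad (hf : AnalyticAt ℂ f z) : AnalyticAt ℂ (grad f) z :=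
  (analyticAt_partialX hf).prod (analyticAt_partialY hf)

lemma extD_add (hα : DifferentiableAt ℂ α z) (hβ : DifferentiableAt ℂ β z) :
    extD (fun w => α w + β w) z = extD α z + extD β z := by
  simp only [extD, Prod.fst_add, Prod.snd_add]
  rw [partialX_add hα.snd hβ.snd, partialY_add hα.fst hβ.fst]
  ring

lemma extD_sum {ι : Type*} (s : Finset ι) {α : ι → ℂ × ℂ → ℂ × ℂ}
    (hα : ∀ i ∈ s, DifferentiableAt ℂ (α i) z) :
    extD (fun w => ∑ i ∈ s, α i w) z = ∑ i ∈ s, extD (α i) z := by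
  classical
  induction s using Finset.induction_on with
  | empty => simp [extD, partialX, partialY]
  | insert i s hi ih =>
    simp only [Finset.sum_insert hi]
    rw [extD_add (hα i (by simp)) (DifferentiableAt.fun_sum fun j hj => hα j (by simp [hj])),
      ih fun j hj => hα j (by simp [hj])]

lemma extD_smul (hg : DifferentiableAt ℂ g z) (hα : DifferentiableAt ℂ α z) :
    extD (fun w => g w • α w) z = wedge (grad g z) (α z) + g z * extD α z := by
  simp only [extD, Prod.smul_fst, Prod.smul_snd, smul_eq_mul, wedge, grad]
  rw [partialX_mul hg hα.snd, partialY_mul hg hα.fst]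
  ring

lemma extD_grad (hf : AnalyticAt ℂ f z) : extD (grad f) z = 0 := by
  simp only [extD, grad]
  rw [sub_eq_zero]
  exact partialX_partialY hf

/-- The logarithmic differential of a function. -/
def dlog (f : ℂ × ℂ → ℂ) (z : ℂ × ℂ) : ℂ × ℂ := (f z)⁻¹ • grad f z

lemma analyticAt_dlog (hf : AnalyticAt ℂ f z) (h0 : f z ≠ 0) : AnalyticAt ℂ (dlog f) z :=
  (hf.inv h0).smul (analyticAt_grad hf)

lemma extD_dlog (hf : AnalyticAt ℂ f z) (h0 : f z ≠ 0) : extD (dlog f) z = 0 := by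
  change extD (fun w => (f w)⁻¹ • grad f w) z = 0
  rw [extD_smul (g := fun w => (f w)⁻¹) (hf.inv h0).differentiableAt (analyticAt_grad hf).differentiableAt, extD_grad hf]
  have h1 := partialX_inv hf.differentiableAt h0
  have h2 := partialY_inv hf.differentiableAt h0
  simp only [wedge, grad, h1, h2]
  ring

/-! ### Pullbacks -/

/-- The Jacobian determinant of a map of the plane. -/
def jac (Φ : ℂ × ℂ → ℂ × ℂ) (z : ℂ × ℂ) : ℂ :=
  wedge (grad (fun w => (Φ w).1) z) (grad (fun w => (Φ w).2) z)

/-- The pullback of a `1`-form. -/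
def pull (Φ : ℂ × ℂ → ℂ × ℂ) (α : ℂ × ℂ → ℂ × ℂ) (z : ℂ × ℂ) : ℂ × ℂ :=
  (α (Φ z)).1 • grad (fun w => (Φ w).1) z + (α (Φ z)).2 • grad (fun w => (Φ w).2) z

variable {Φ : ℂ × ℂ → ℂ × ℂ}

lemma wedge_pull : wedge (pull Φ α z) (pull Φ β z) = jac Φ z * wedge (α (Φ z)) (β (Φ z)) := by
  simp [wedge, pull, jac]; ring

lemma fderiv_apply_eq (f : ℂ × ℂ → ℂ) (z v : ℂ × ℂ) :
    fderiv ℂ f z v = partialX f z * v.1 + partialY f z * v.2 := by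
  have : v = v.1 • ((1, 0) : ℂ × ℂ) + v.2 • ((0, 1) : ℂ × ℂ) := by ext <;> simp
  conv_lhs => rw [this]
  rw [map_add, map_smul, map_smul, partialX, partialY]
  simp only [smul_eq_mul]; ring

lemma fderiv_fst_apply (hΦ : DifferentiableAt ℂ Φ z) (v : ℂ × ℂ) :
    (fderiv ℂ Φ z v).1 = partialX (fun w => (Φ w).1) z * v.1 + partialY (fun w => (Φ w).1) z * v.2 := by
  rw [← fderiv_apply_eq (fun w => (Φ w).1), fderiv.fst hΦ]; rfl

lemma fderiv_snd_apply (hΦ : DifferentiableAt ℂ Φ z) (v : ℂ × ℂ) :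
    (fderiv ℂ Φ z v).2 = partialX (fun w => (Φ w).2) z * v.1 + partialY (fun w => (Φ w).2) z * v.2 := by
  rw [← fderiv_apply_eq (fun w => (Φ w).2), fderiv.snd hΦ]; rfl

lemma evalForm_pull (hΦ : DifferentiableAt ℂ Φ z) (v : ℂ × ℂ) :
    evalForm (pull Φ α z) v = evalForm (α (Φ z)) (fderiv ℂ Φ z v) := by
  rw [evalForm, evalForm, fderiv_fst_apply hΦ, fderiv_snd_apply hΦ]
  simp [pull, grad]; ring

lemma analyticAt_pull (hΦ : AnalyticAt ℂ Φ z) (hα : AnalyticAt ℂ α (Φ z)) :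
    AnalyticAt ℂ (pull Φ α) z := by
  have h := hα.fun_comp hΦ
  have h1 : AnalyticAt ℂ (fun w => (Φ w).1) z := analyticAt_fst.fun_comp hΦ
  have h2 : AnalyticAt ℂ (fun w => (Φ w).2) z := analyticAt_snd.fun_comp hΦ
  exact ((analyticAt_fst.fun_comp h).smul (analyticAt_grad h1)).add
    ((analyticAt_snd.fun_comp h).smul (analyticAt_grad h2))

lemma analyticAt_jac (hΦ : AnalyticAt ℂ Φ z) : AnalyticAt ℂ (jac Φ) z := by
  have h1 : AnalyticAt ℂ (fun w => (Φ w).1) z := analyticAt_fst.fun_comp hΦ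
  have h2 : AnalyticAt ℂ (fun w => (Φ w).2) z := analyticAt_snd.fun_comp hΦ
  exact ((analyticAt_partialX h1).mul (analyticAt_partialY h2)).sub
    ((analyticAt_partialY h1).mul (analyticAt_partialX h2))

lemma grad_comp (hf : DifferentiableAt ℂ f (Φ z)) (hΦ : DifferentiableAt ℂ Φ z) :
    grad (fun w => f (Φ w)) z = pull Φ (grad f) z := by
  have h : ∀ v, fderiv ℂ (fun w => f (Φ w)) z v = fderiv ℂ f (Φ z) (fderiv ℂ Φ z v) := fun v => by
    rw [show (fun w => f (Φ w)) = f ∘ Φ from rfl, fderiv_comp z hf hΦ]; rfl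
  ext
  · simp only [grad, pull, partialX, h, Prod.fst_add, Prod.smul_fst, smul_eq_mul]
    rw [fderiv_apply_eq f, fderiv_fst_apply hΦ, fderiv_snd_apply hΦ]
    simp [partialX, partialY]
  · simp only [grad, pull, partialY, h, Prod.snd_add, Prod.smul_snd, smul_eq_mul]
    rw [fderiv_apply_eq f, fderiv_fst_apply hΦ, fderiv_snd_apply hΦ]
    simp [partialX, partialY]

lemma extD_pull (hΦ : AnalyticAt ℂ Φ z) (hα : AnalyticAt ℂ α (Φ z)) :
    extD (pull Φ α) z = jac Φ z * extD α (Φ z) := by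
  have h1 : AnalyticAt ℂ (fun w => (Φ w).1) z := analyticAt_fst.fun_comp hΦ
  have h2 : AnalyticAt ℂ (fun w => (Φ w).2) z := analyticAt_snd.fun_comp hΦ
  have ha : AnalyticAt ℂ (fun w => (α (Φ w)).1) z := analyticAt_fst.fun_comp (hα.fun_comp hΦ)
  have hb : AnalyticAt ℂ (fun w => (α (Φ w)).2) z := analyticAt_snd.fun_comp (hα.fun_comp hΦ)
  have ha' : AnalyticAt ℂ (fun w => (α w).1) (Φ z) := analyticAt_fst.fun_comp hα
  have hb' : AnalyticAt ℂ (fun w => (α w).2) (Φ z) := analyticAt_snd.fun_comp hα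
  change extD (fun w => (α (Φ w)).1 • grad (fun w => (Φ w).1) w +
    (α (Φ w)).2 • grad (fun w => (Φ w).2) w) z = _
  rw [extD_add (α := fun w => (α (Φ w)).1 • grad (fun w => (Φ w).1) w)
    (β := fun w => (α (Φ w)).2 • grad (fun w => (Φ w).2) w)
    (ha.differentiableAt.smul (analyticAt_grad h1).differentiableAt)
    (hb.differentiableAt.smul (analyticAt_grad h2).differentiableAt),
    extD_smul (g := fun w => (α (Φ w)).1) ha.differentiableAt
      (analyticAt_grad h1).differentiableAt,
    extD_smul (g := fun w => (α (Φ w)).2) hb.differentiableAt (analyticAt_grad h2).differentiableAt,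
    extD_grad h1, extD_grad h2,
    grad_comp (f := fun w => (α w).1) ha'.differentiableAt hΦ.differentiableAt,
    grad_comp (f := fun w => (α w).2) hb'.differentiableAt hΦ.differentiableAt]
  simp [wedge, pull, grad, jac, extD]
  ring

end calculus

/-! ### Fundamental forms of `3`-webs -/

section fundamental

variable {V : Set (ℂ × ℂ)} {α β γ η : ℂ × ℂ → ℂ × ℂ}

lemma analyticAt_wedge {z : ℂ × ℂ} (hα : AnalyticAt ℂ α z) (hβ : AnalyticAt ℂ β z) :
    AnalyticAt ℂ (fun w => wedge (α w) (β w)) z :=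
  ((analyticAt_fst.fun_comp hα).mul (analyticAt_snd.fun_comp hβ)).sub
    ((analyticAt_snd.fun_comp hα).mul (analyticAt_fst.fun_comp hβ))

lemma analyticAt_extD {z : ℂ × ℂ} (hα : AnalyticAt ℂ α z) : AnalyticAt ℂ (extD α) z :=
  (analyticAt_partialX (analyticAt_snd.fun_comp hα)).sub
    (analyticAt_partialY (analyticAt_fst.fun_comp hα))

/-- The three normalised forms `δ_{st} ω_r` sum to zero, so the third equation follows from the
first two. These are solved by Cramer's rule, since the wedge of two normalised forms is the product
of the three pairwise wedges. -/
lemma exists_isFundamentalForm₃ (hα : AnalyticOnNhd ℂ α V) (hβ : AnalyticOnNhd ℂ β V)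
    (hγ : AnalyticOnNhd ℂ γ V) (h₁ : ∀ z ∈ V, wedge (α z) (β z) ≠ 0)
    (h₂ : ∀ z ∈ V, wedge (β z) (γ z) ≠ 0) (h₃ : ∀ z ∈ V, wedge (γ z) (α z) ≠ 0) :
    ∃ η, IsFundamentalForm₃ V α β γ η := by
  set α' : ℂ × ℂ → ℂ × ℂ := fun w => wedge (β w) (γ w) • α w with hα'
  set β' : ℂ × ℂ → ℂ × ℂ := fun w => wedge (γ w) (α w) • β w with hβ'
  set γ' : ℂ × ℂ → ℂ × ℂ := fun w => wedge (α w) (β w) • γ w with hγ'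
  have hsum : γ' = fun w => (-1 : ℂ) • (α' w + β' w) := by
    ext w <;> simp [hα', hβ', hγ', wedge] <;> ring
  have ha : ∀ z ∈ V, AnalyticAt ℂ α' z := fun z hz =>
    (analyticAt_wedge (hβ z hz) (hγ z hz)).smul (hα z hz)
  have hb : ∀ z ∈ V, AnalyticAt ℂ β' z := fun z hz =>
    (analyticAt_wedge (hγ z hz) (hα z hz)).smul (hβ z hz)
  have hw : ∀ z ∈ V, wedge (α' z) (β' z) ≠ 0 := fun z hz => by
    have : wedge (α' z) (β' z) = wedge (β z) (γ z) * wedge (γ z) (α z) * wedge (α z) (β z) := by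
      simp [hα', hβ', wedge]; ring
    rw [this]
    exact mul_ne_zero (mul_ne_zero (h₂ z hz) (h₃ z hz)) (h₁ z hz)
  refine ⟨fun z => (wedge (α' z) (β' z))⁻¹ • (extD β' z • α' z - extD α' z • β' z), ?_, ?_⟩
  · intro z hz
    have h1 := analyticAt_extD (hb z hz)
    have h2 := analyticAt_extD (ha z hz)
    exact ((analyticAt_wedge (ha z hz) (hb z hz)).inv (hw z hz)).smul
      ((h1.smul (ha z hz)).sub (h2.smul (hb z hz)))
  · intro z hz
    have e1 : extD α' z = wedge ((wedge (α' z) (β' z))⁻¹ •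
        (extD β' z • α' z - extD α' z • β' z)) (α' z) := by
      have := hw z hz
      have e : wedge ((wedge (α' z) (β' z))⁻¹ • (extD β' z • α' z - extD α' z • β' z)) (α' z) =
          (wedge (α' z) (β' z))⁻¹ * (extD α' z * wedge (α' z) (β' z)) := by
        simp [wedge]; ring
      rw [e]; field_simp
    have e2 : extD β' z = wedge ((wedge (α' z) (β' z))⁻¹ •
        (extD β' z • α' z - extD α' z • β' z)) (β' z) := by
      have := hw z hz
      have e : wedge ((wedge (α' z) (β' z))⁻¹ • (extD β' z • α' z - extD α' z • β' z)) (β' z) =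
          (wedge (α' z) (β' z))⁻¹ * (extD β' z * wedge (α' z) (β' z)) := by
        simp [wedge]; ring
      rw [e]; field_simp
    refine ⟨e1, e2, ?_⟩
    change extD γ' z = wedge _ (γ' z)
    have hd : extD γ' z = -(extD α' z + extD β' z) := by
      rw [hsum, extD_smul (g := fun _ => (-1 : ℂ)) (α := fun w => α' w + β' w) (by fun_prop)
        ((ha z hz).differentiableAt.add (hb z hz).differentiableAt),
        extD_add (ha z hz).differentiableAt (hb z hz).differentiableAt]
      simp [wedge, grad, partialX, partialY]
    have hl : ∀ ζ : ℂ × ℂ, wedge ζ (γ' z) = -(wedge ζ (α' z) + wedge ζ (β' z)) := fun ζ => by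
      rw [hsum]; simp [wedge]; ring
    rw [hd, hl, ← e1, ← e2]

/-- Pulling back multiplies each wedge by the Jacobian, hence each normalised form is the pullback
multiplied by `jac Φ`. The fundamental form therefore acquires the closed term `dlog (jac Φ)`. -/
lemma IsFundamentalForm₃.pull {V' : Set (ℂ × ℂ)} {Φ : ℂ × ℂ → ℂ × ℂ}
    (h : IsFundamentalForm₃ V α β γ η) (hα : AnalyticOnNhd ℂ α V) (hβ : AnalyticOnNhd ℂ β V)
    (hγ : AnalyticOnNhd ℂ γ V) (hΦ : AnalyticOnNhd ℂ Φ V') (hV : ∀ z ∈ V', Φ z ∈ V)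
    (hJ : ∀ z ∈ V', jac Φ z ≠ 0) :
    IsFundamentalForm₃ V' (pull Φ α) (pull Φ β) (pull Φ γ)
      (fun z => PlanarWeb.pull Φ η z + dlog (jac Φ) z) := by
  have key : ∀ z ∈ V', ∀ α β γ : ℂ × ℂ → ℂ × ℂ, AnalyticOnNhd ℂ α V → AnalyticOnNhd ℂ β V →
      AnalyticOnNhd ℂ γ V →
      extD (fun w => wedge (β w) (γ w) • α w) (Φ z) =
        wedge (η (Φ z)) (wedge (β (Φ z)) (γ (Φ z)) • α (Φ z)) →
      extD (fun w => wedge (PlanarWeb.pull Φ β w) (PlanarWeb.pull Φ γ w) • PlanarWeb.pull Φ α w) z =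
        wedge (PlanarWeb.pull Φ η z + dlog (jac Φ) z)
        (wedge (PlanarWeb.pull Φ β z) (PlanarWeb.pull Φ γ z) • PlanarWeb.pull Φ α z) := by
    intro z hz α β γ hα hβ hγ h
    have e1 : ∀ w, wedge (PlanarWeb.pull Φ β w) (PlanarWeb.pull Φ γ w) • PlanarWeb.pull Φ α w =
        jac Φ w • PlanarWeb.pull Φ (fun w => wedge (β w) (γ w) • α w) w := fun w => by
      rw [wedge_pull]
      ext <;> simp [PlanarWeb.pull] <;> ring
    have hΦz := hΦ z hz
    have ha : AnalyticAt ℂ (fun w => wedge (β w) (γ w) • α w) (Φ z) :=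
      (analyticAt_wedge (hβ _ (hV z hz)) (hγ _ (hV z hz))).smul (hα _ (hV z hz))
    have e4 := extD_smul (g := jac Φ) (α := PlanarWeb.pull Φ fun w => wedge (β w) (γ w) • α w)
      (analyticAt_jac hΦz).differentiableAt (analyticAt_pull hΦz ha).differentiableAt
    rw [extD_pull hΦz ha, h] at e4
    rw [e1 z, funext e1, e4]
    have e2 := wedge_pull (Φ := Φ) (z := z) (α := η) (β := fun w => wedge (β w) (γ w) • α w)
    have hJz := hJ z hz
    have e3 : grad (jac Φ) z = jac Φ z • dlog (jac Φ) z := by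
      rw [dlog, smul_inv_smul₀ hJz]
    rw [← e2, e3]
    simp only [wedge, Prod.fst_add, Prod.snd_add, Prod.smul_fst, Prod.smul_snd, smul_eq_mul]
    ring
  refine ⟨fun z hz => (analyticAt_pull (hΦ z hz) (h.1 _ (hV z hz))).add
    (analyticAt_dlog (analyticAt_jac (hΦ z hz)) (hJ z hz)), fun z hz => ?_⟩
  obtain ⟨h1, h2, h3⟩ := h.2 _ (hV z hz)
  exact ⟨key z hz α β γ hα hβ hγ h1, key z hz β γ α hβ hγ hα h2, key z hz γ α β hγ hα hβ h3⟩

/-- The derivative `∂ₓp + p ∂_yp` of the slope `p` along the foliation of slope `p`. -/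
def accel (p : ℂ × ℂ → ℂ) (z : ℂ × ℂ) : ℂ := partialX p z + p z * partialY p z

/-- The first two structure equations give the values of `η₁ dx + η₂ dy` on the tangent vectors `(1,
p)` and `(1, q)`, which determine both coefficients. The answer is arranged as the logarithmic
derivative of `D (p - q)(q - r)(r - p)` plus terms attached to each of the three slopes. -/
lemma fundamental_coeffs {η₁ η₂ D Dx Dy p q r px py qx qy rx ry : ℂ} (hD : D ≠ 0)
    (hpq : p ≠ q) (hqr : q ≠ r) (hrp : r ≠ p)
    (e₁ : (η₁ + η₂ * p) * (D * (r - q)) = Dx * (r - q) + D * (rx - qx) +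
      ((Dy * (r - q) + D * (ry - qy)) * p + D * (r - q) * py))
    (e₂ : (η₁ + η₂ * q) * (D * (p - r)) = Dx * (p - r) + D * (px - rx) +
      ((Dy * (p - r) + D * (py - ry)) * q + D * (p - r) * qy)) :
    η₂ = Dy / D + (py - qy) / (p - q) + (qy - ry) / (q - r) + (ry - py) / (r - p) -
        ((px + p * py) / ((p - q) * (p - r)) + (qx + q * qy) / ((q - r) * (q - p)) +
          (rx + r * ry) / ((r - p) * (r - q))) ∧
    η₁ = Dx / D + (px - qx) / (p - q) + (qx - rx) / (q - r) + (rx - px) / (r - p) -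
        ((px + p * py) * (p - q - r) / ((p - q) * (p - r)) +
          (qx + q * qy) * (q - r - p) / ((q - r) * (q - p)) +
          (rx + r * ry) * (r - p - q) / ((r - p) * (r - q))) + (py + qy + ry) := by
  have hpq' : p - q ≠ 0 := sub_ne_zero.2 hpq
  have hqp' : q - p ≠ 0 := sub_ne_zero.2 hpq.symm
  have hqr' : q - r ≠ 0 := sub_ne_zero.2 hqr
  have hrq' : r - q ≠ 0 := sub_ne_zero.2 hqr.symm
  have hrp' : r - p ≠ 0 := sub_ne_zero.2 hrp
  have hpr' : p - r ≠ 0 := sub_ne_zero.2 hrp.symm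
  have s₁ : η₁ + η₂ * p = (Dx * (r - q) + D * (rx - qx) +
      ((Dy * (r - q) + D * (ry - qy)) * p + D * (r - q) * py)) / (D * (r - q)) := by
    rw [eq_div_iff (mul_ne_zero hD hrq'), e₁]
  have s₂ : η₁ + η₂ * q = (Dx * (p - r) + D * (px - rx) +
      ((Dy * (p - r) + D * (py - ry)) * q + D * (p - r) * qy)) / (D * (p - r)) := by
    rw [eq_div_iff (mul_ne_zero hD hpr'), e₂]
  have t₂ : η₂ = ((Dx * (r - q) + D * (rx - qx) +
      ((Dy * (r - q) + D * (ry - qy)) * p + D * (r - q) * py)) / (D * (r - q)) -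
      (Dx * (p - r) + D * (px - rx) +
      ((Dy * (p - r) + D * (py - ry)) * q + D * (p - r) * qy)) / (D * (p - r))) / (p - q) := by
    rw [eq_div_iff hpq', ← s₁, ← s₂]; ring
  have c₂ : η₂ = Dy / D + (py - qy) / (p - q) + (qy - ry) / (q - r) + (ry - py) / (r - p) -
        ((px + p * py) / ((p - q) * (p - r)) + (qx + q * qy) / ((q - r) * (q - p)) +
          (rx + r * ry) / ((r - p) * (r - q))) := by
    rw [t₂, ← neg_sub p q, ← neg_sub q r, ← neg_sub r p]
    have a1 : r - p = -(p - q) - (q - r) := by ring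
    field_simp
    ring
  refine ⟨c₂, ?_⟩
  have t₁ : η₁ = (Dx * (r - q) + D * (rx - qx) +
      ((Dy * (r - q) + D * (ry - qy)) * p + D * (r - q) * py)) / (D * (r - q)) - η₂ * p := by
    rw [← s₁]; ring
  rw [t₁, c₂, ← neg_sub p q, ← neg_sub q r, ← neg_sub r p]
  field_simp
  ring

end fundamental

end PlanarWeb

end

noncomputable section

namespace PlanarWeb

open Filter Metric Set

/-! ### The fundamental form in terms of slopes -/

section slopes

/-- The share of slope `p` in the part of `η₁` that involves the accelerations; it is symmetric in
`q` and `r`. `tripleB` plays the same role for `η₂`. -/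
def tripleA (p q r : ℂ × ℂ → ℂ) (z : ℂ × ℂ) : ℂ :=
  accel p z * (p z - q z - r z) / ((p z - q z) * (p z - r z))

def tripleB (p q r : ℂ × ℂ → ℂ) (z : ℂ × ℂ) : ℂ :=
  accel p z / ((p z - q z) * (p z - r z))

variable {V : Set (ℂ × ℂ)} {α β γ η : ℂ × ℂ → ℂ × ℂ} {p q r f g h : ℂ × ℂ → ℂ} {z : ℂ × ℂ}

/-- With `α = f (dy - p dx)` and similarly for the others, the normalised form is `D (r - q)(dy - p
dx)` where `D = f g h`. This is one structure equation, written out in the shape required by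
`fundamental_coeffs`. -/
lemma extD_slope (hα : α =ᶠ[𝓝 z] fun w => f w • (-p w, 1)) (hβ : β =ᶠ[𝓝 z] fun w => g w • (-q w, 1))
    (hγ : γ =ᶠ[𝓝 z] fun w => h w • (-r w, 1)) (hf : AnalyticAt ℂ f z) (hg : AnalyticAt ℂ g z)
    (hh : AnalyticAt ℂ h z) (hp : AnalyticAt ℂ p z) (hq : AnalyticAt ℂ q z)
    (hr : AnalyticAt ℂ r z)
    (e : extD (fun w => wedge (β w) (γ w) • α w) z = wedge (η z) (wedge (β z) (γ z) • α z)) :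
    ((η z).1 + (η z).2 * p z) * (f z * g z * h z * (r z - q z)) =
      partialX (fun w => f w * g w * h w) z * (r z - q z) +
        f z * g z * h z * (partialX r z - partialX q z) +
      ((partialY (fun w => f w * g w * h w) z * (r z - q z) +
        f z * g z * h z * (partialY r z - partialY q z)) * p z +
        f z * g z * h z * (r z - q z) * partialY p z) := by
  set D : ℂ × ℂ → ℂ := fun w => f w * g w * h w with hD
  have hDa : DifferentiableAt ℂ D z := ((hf.mul hg).mul hh).differentiableAt
  have h1 : (fun w => wedge (β w) (γ w) • α w) =ᶠ[𝓝 z]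
      fun w => (-(D w * (r w - q w) * p w), D w * (r w - q w)) := by
    filter_upwards [hα, hβ, hγ] with w h1 h2 h3
    rw [h1, h2, h3]
    ext <;> simp [wedge, hD] <;> ring
  rw [extD_congr h1, hα.eq_of_nhds, hβ.eq_of_nhds, hγ.eq_of_nhds] at e
  have hrq := hr.differentiableAt.fun_sub hq.differentiableAt
  simp only [extD] at e
  rw [partialY_neg, partialY_mul (hDa.fun_mul hrq) hp.differentiableAt, partialX_mul hDa hrq,
    partialY_mul hDa hrq, partialX_sub hr.differentiableAt hq.differentiableAt,
    partialY_sub hr.differentiableAt hq.differentiableAt] at e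
  simp only [wedge, Prod.smul_fst, Prod.smul_snd, smul_eq_mul] at e
  simp only [hD] at e ⊢
  linear_combination -e

/-- The choice of the defining forms, that is of `f`, `g`, `h`, enters only through the closed
`dlog` term. -/
lemma IsFundamentalForm₃.eq_slopes (hV : IsOpen V) (H : IsFundamentalForm₃ V α β γ η) (hz : z ∈ V)
    (hα : ∀ w ∈ V, α w = f w • (-p w, 1)) (hβ : ∀ w ∈ V, β w = g w • (-q w, 1))
    (hγ : ∀ w ∈ V, γ w = h w • (-r w, 1)) (hf : AnalyticAt ℂ f z) (hg : AnalyticAt ℂ g z)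
    (hh : AnalyticAt ℂ h z) (hp : AnalyticAt ℂ p z) (hq : AnalyticAt ℂ q z)
    (hr : AnalyticAt ℂ r z) (hf0 : f z ≠ 0) (hg0 : g z ≠ 0) (hh0 : h z ≠ 0)
    (hpq : p z ≠ q z) (hqr : q z ≠ r z) (hrp : r z ≠ p z) :
    η z = dlog (fun w => f w * g w * h w * ((p w - q w) * (q w - r w) * (r w - p w))) z +
      (-(tripleA p q r z + tripleA q r p z + tripleA r p q z) +
        (partialY p z + partialY q z + partialY r z),
        -(tripleB p q r z + tripleB q r p z + tripleB r p q z)) := by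
  have hn := hV.mem_nhds hz
  have ha := eventuallyEq_of_mem hn hα
  have hb := eventuallyEq_of_mem hn hβ
  have hc := eventuallyEq_of_mem hn hγ
  obtain ⟨e1, e2, -⟩ := H.2 z hz
  have c1 := extD_slope ha hb hc hf hg hh hp hq hr e1
  have c2 := extD_slope hb hc ha hg hh hf hq hr hp e2
  have hperm : (fun w => g w * h w * f w) = fun w => f w * g w * h w := by ext; ring
  rw [hperm, show g z * h z * f z = f z * g z * h z by ring] at c2
  obtain ⟨d2, d1⟩ := fundamental_coeffs (mul_ne_zero (mul_ne_zero hf0 hg0) hh0) hpq hqr hrp c1 c2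
  have hD := (hf.fun_mul hg).fun_mul hh
  have hpq' := hp.fun_sub hq
  have hqr' := hq.fun_sub hr
  have hrp' := hr.fun_sub hp
  have n1 : p z - q z ≠ 0 := sub_ne_zero.2 hpq
  have n2 : q z - r z ≠ 0 := sub_ne_zero.2 hqr
  have n3 : r z - p z ≠ 0 := sub_ne_zero.2 hrp
  ext
  · rw [d1]
    simp only [dlog, grad, Prod.fst_add, Prod.smul_fst, smul_eq_mul, tripleA, accel]
    rw [partialX_mul hD.differentiableAt ((hpq'.fun_mul hqr').fun_mul hrp').differentiableAt,
      partialX_mul (hpq'.fun_mul hqr').differentiableAt hrp'.differentiableAt,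
      partialX_mul hpq'.differentiableAt hqr'.differentiableAt,
      partialX_sub hp.differentiableAt hq.differentiableAt,
      partialX_sub hq.differentiableAt hr.differentiableAt,
      partialX_sub hr.differentiableAt hp.differentiableAt]
    have : (f z * g z * h z * ((p z - q z) * (q z - r z) * (r z - p z)))⁻¹ *
      (partialX (fun w => f w * g w * h w) z * ((p z - q z) * (q z - r z) * (r z - p z)) +
        f z * g z * h z * (((partialX p z - partialX q z) * (q z - r z) +
          (p z - q z) * (partialX q z - partialX r z)) * (r z - p z) +
          (p z - q z) * (q z - r z) * (partialX r z - partialX p z))) =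
      partialX (fun w => f w * g w * h w) z / (f z * g z * h z) +
        (partialX p z - partialX q z) / (p z - q z) + (partialX q z - partialX r z) / (q z - r z) +
        (partialX r z - partialX p z) / (r z - p z) := by
      field_simp; ring
    rw [this]; ring
  · rw [d2]
    simp only [dlog, grad, Prod.snd_add, Prod.smul_snd, smul_eq_mul, tripleB, accel]
    rw [partialY_mul hD.differentiableAt ((hpq'.fun_mul hqr').fun_mul hrp').differentiableAt,
      partialY_mul (hpq'.fun_mul hqr').differentiableAt hrp'.differentiableAt,
      partialY_mul hpq'.differentiableAt hqr'.differentiableAt,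
      partialY_sub hp.differentiableAt hq.differentiableAt,
      partialY_sub hq.differentiableAt hr.differentiableAt,
      partialY_sub hr.differentiableAt hp.differentiableAt]
    have : (f z * g z * h z * ((p z - q z) * (q z - r z) * (r z - p z)))⁻¹ *
      (partialY (fun w => f w * g w * h w) z * ((p z - q z) * (q z - r z) * (r z - p z)) +
        f z * g z * h z * (((partialY p z - partialY q z) * (q z - r z) +
          (p z - q z) * (partialY q z - partialY r z)) * (r z - p z) +
          (p z - q z) * (q z - r z) * (partialY r z - partialY p z))) =
      partialY (fun w => f w * g w * h w) z / (f z * g z * h z) +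
        (partialY p z - partialY q z) / (p z - q z) + (partialY q z - partialY r z) / (q z - r z) +
        (partialY r z - partialY p z) / (r z - p z) := by
      field_simp; ring
    rw [this]; ring

end slopes

/-! ### Sums over triples -/

/-- Choosing an unordered triple with a distinguished element is the same as choosing the element
and then an ordered pair of others, each pair being counted twice. This turns the sum of the
`η_{rst}` into a sum over single roots. -/
lemma sum_triples {d : ℕ} (X : Fin d → Fin d → Fin d → ℂ) (hX : ∀ r s t, X r s t = X r t s) :
    ∑ r, ∑ s, ∑ t, (if r < s ∧ s < t then X r s t + X s t r + X t r s else 0) =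
      2⁻¹ * ∑ r, ∑ s ∈ Finset.univ.erase r, ∑ t ∈ (Finset.univ.erase r).erase s, X r s t := by
  have h1 : ∀ r, ∑ s ∈ Finset.univ.erase r, ∑ t ∈ (Finset.univ.erase r).erase s, X r s t =
      ∑ s, ∑ t, if r ≠ s ∧ r ≠ t ∧ s ≠ t then X r s t else 0 := by
    intro r
    have e1 : Finset.univ.erase r = Finset.univ.filter fun s => r ≠ s := by
      ext s; simp [eq_comm]
    have e2 : ∀ s, (Finset.univ.erase r).erase s = Finset.univ.filter fun t => r ≠ t ∧ s ≠ t := by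
      intro s; ext t; simp [eq_comm, and_comm]
    simp only [e2]
    rw [e1, Finset.sum_filter]
    refine Finset.sum_congr rfl fun s _ => ?_
    rw [Finset.sum_filter]
    split_ifs with hrs
    · refine Finset.sum_congr rfl fun t _ => ?_
      simp [hrs]
    · simp [hrs]
  simp only [h1]
  set T : (Fin d → Fin d → Fin d → ℂ) → ℂ := fun Y => ∑ r, ∑ s, ∑ t, Y r s t with hT
  have swap₁ : ∀ Y, T (fun r s t => Y s r t) = T Y := fun Y => Finset.sum_comm
  have swap₂ : ∀ Y, T (fun r s t => Y r t s) = T Y := fun Y =>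
    Finset.sum_congr rfl fun r _ => Finset.sum_comm
  have hadd : ∀ Y Z : Fin d → Fin d → Fin d → ℂ, T (fun r s t => Y r s t + Z r s t) = T Y + T Z :=
    fun Y Z => by simp only [hT, Finset.sum_add_distrib]
  set I : Fin d → Fin d → Fin d → ℂ := fun r s t => if r < s ∧ s < t then X r s t else 0 with hI
  set J : Fin d → Fin d → Fin d → ℂ := fun r s t => if r < s ∧ s < t then X s t r else 0 with hJ
  set L : Fin d → Fin d → Fin d → ℂ := fun r s t => if r < s ∧ s < t then X t r s else 0 with hL
  have e1 : T (fun r s t => if r < s ∧ s < t then X r s t + X s t r + X t r s else 0) =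
      T I + T J + T L := by
    rw [← hadd, ← hadd]
    congr 1; ext r s t
    simp only [hI, hJ, hL]
    split_ifs <;> simp
  have hno : ∀ a b : Fin d, ¬ (a < b ∧ b < a) := fun a b h => lt_asymm h.1 h.2
  -- Three distinct indices are in exactly one of the six orders; the symmetry `hX` matches these
  -- orders in pairs with `I`, `J` and `L`.
  have e2 : T (fun r s t => if r ≠ s ∧ r ≠ t ∧ s ≠ t then X r s t else 0) =
      T (fun r s t => I r s t) + T (fun r s t => I r t s) + T (fun r s t => J s r t) +
      T (fun r s t => J t r s) + T (fun r s t => L s t r) + T (fun r s t => L t s r) := by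
    simp only [← hadd]
    congr 1; ext r s t
    simp only [hI, hJ, hL]
    rcases lt_trichotomy r s with h | h | h <;> rcases lt_trichotomy s t with h' | h' | h' <;>
      rcases lt_trichotomy r t with h'' | h'' | h'' <;>
      first
      | (exfalso; omega)
      | (subst h; simp [hno])
      | (subst h'; simp [hno])
      | (subst h''; simp [not_lt_of_gt h])
      | simp [h, h', h'', h.ne, h'.ne, h''.ne, h.ne', h'.ne', h''.ne', not_lt_of_gt, hX r t s]
  have f2 : T (fun r s t => J t r s) = T J :=
    (swap₂ (fun r s t => J s r t)).trans (swap₁ J)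
  have f3 : T (fun r s t => L s t r) = T L :=
    (swap₁ (fun r s t => L r t s)).trans (swap₂ L)
  have f4 : T (fun r s t => L t s r) = T L :=
    (swap₂ (fun r s t => L s t r)).trans f3
  change T _ = 2⁻¹ * T _
  rw [e1, e2, swap₂ I, swap₁ J, f2, f3, f4]
  ring

/-! ### Logarithmic derivatives of split polynomials -/

open Polynomial in
lemma eval_derivative_prod_X_sub_C {ι : Type*} [DecidableEq ι] (S : Finset ι) (p : ι → ℂ) {x : ℂ}
    (hx : ∀ s ∈ S, x ≠ p s) :
    (derivative (∏ s ∈ S, (X - C (p s)))).eval x =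
      (∏ s ∈ S, (X - C (p s))).eval x * ∑ s ∈ S, (x - p s)⁻¹ := by
  rw [derivative_prod_finset, eval_finsetSum, Finset.mul_sum]
  refine Finset.sum_congr rfl fun s hs => ?_
  rw [← Finset.mul_prod_erase S _ hs]
  have := sub_ne_zero.2 (hx s hs)
  simp only [derivative_X_sub_C, mul_one, eval_mul, eval_sub, eval_X, eval_C]
  field_simp

open Polynomial in
lemma eval_derivative_derivative_prod_X_sub_C {ι : Type*} [DecidableEq ι] (S : Finset ι)
    (p : ι → ℂ) {x : ℂ} (hx : ∀ s ∈ S, x ≠ p s) :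
    (derivative (derivative (∏ s ∈ S, (X - C (p s))))).eval x =
      (∏ s ∈ S, (X - C (p s))).eval x *
        ∑ s ∈ S, ∑ t ∈ S.erase s, ((x - p s) * (x - p t))⁻¹ := by
  rw [derivative_prod_finset]
  simp only [derivative_X_sub_C, mul_one, derivative_sum]
  rw [eval_finsetSum, Finset.mul_sum]
  refine Finset.sum_congr rfl fun s hs => ?_
  rw [eval_derivative_prod_X_sub_C _ _ fun t ht => hx t (Finset.mem_of_mem_erase ht),
    ← Finset.mul_prod_erase S _ hs]
  have := sub_ne_zero.2 (hx s hs)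
  simp only [eval_mul, eval_sub, eval_X, eval_C, mul_inv, ← Finset.mul_sum]
  field_simp

open Polynomial in
-- Near the root `p r` write `P = (X - p r) R`: the first three derivatives of `P` there are `R`, `2
-- R'` and `3 R''`, and `R'/R`, `R''/R` are the sums of inverse differences of roots.
lemma eval_derivatives_at_root {d : ℕ} (c : ℂ) (p : Fin d → ℂ) (hp : Function.Injective p)
    (r : Fin d) {P : ℂ[X]} (hP : P = C c * ∏ s, (X - C (p s))) :
    ∃ G : ℂ, G = c * ∏ s ∈ Finset.univ.erase r, (p r - p s) ∧ (derivative P).eval (p r) = G ∧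
      (derivative (derivative P)).eval (p r) =
        2 * G * ∑ s ∈ Finset.univ.erase r, (p r - p s)⁻¹ ∧
      (derivative (derivative (derivative P))).eval (p r) =
        3 * G * ∑ s ∈ Finset.univ.erase r, ∑ t ∈ (Finset.univ.erase r).erase s,
          ((p r - p s) * (p r - p t))⁻¹ := by
  have hx : ∀ s ∈ Finset.univ.erase r, p r ≠ p s := fun s hs h =>
    (Finset.ne_of_mem_erase hs) (hp h).symm
  set Q := ∏ s ∈ Finset.univ.erase r, (X - C (p s)) with hQ
  have hPQ : P = C c * ((X - C (p r)) * Q) := by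
    rw [hP, ← Finset.mul_prod_erase _ _ (Finset.mem_univ r)]
  have hQe : Q.eval (p r) = ∏ s ∈ Finset.univ.erase r, (p r - p s) := by
    simp [hQ, eval_prod]
  refine ⟨_, rfl, ?_, ?_, ?_⟩
  · rw [hPQ]; simp [derivative_mul, hQe]
  · rw [hPQ, ← hQe, mul_assoc, mul_assoc, ← eval_derivative_prod_X_sub_C _ _ hx, ← hQ]
    simp [derivative_mul]; ring
  · rw [hPQ, ← hQe, mul_assoc, mul_assoc, ← eval_derivative_derivative_prod_X_sub_C _ _ hx, ← hQ]
    simp [derivative_mul]; ring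

end PlanarWeb

end

noncomputable section

namespace PlanarWeb

open Filter Metric Set Polynomial

/-! ### Slopes as roots of the implicit equation -/

variable {d : ℕ}

/-- The polynomial `F(x,y,p)` in `p`. -/
def slopePolynomial (a : Fin (d + 1) → ℂ × ℂ → ℂ) (z : ℂ × ℂ) : ℂ[X] :=
  ∑ k : Fin (d + 1), C (a k z) * X ^ (d - (k : ℕ))

lemma eval_slopePolynomial (a : Fin (d + 1) → ℂ × ℂ → ℂ) (z : ℂ × ℂ) (p : ℂ) :
    (slopePolynomial a z).eval p = slopePoly a z p := by
  simp [slopePolynomial, slopePoly, eval_finsetSum]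

/-- `∂ₓF + p ∂_yF`. -/
def accelNum (a : Fin (d + 1) → ℂ × ℂ → ℂ) (z : ℂ × ℂ) (p : ℂ) : ℂ :=
  slopePoly (fun k => partialX (a k)) z p + p * slopePoly (fun k => partialY (a k)) z p

/-- `m`-th derivative of `F` in `p`. -/
def slopeDeriv (a : Fin (d + 1) → ℂ × ℂ → ℂ) (m : ℕ) (z : ℂ × ℂ) (p : ℂ) : ℂ :=
  (derivative^[m] (slopePolynomial a z)).eval p

/-- Half of minus the double sum of `tripleB` for a root `p`: the acceleration is `-accelNum / ∂ₚF`,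
and the double sum of inverse products is `∂ₚ³F / (3 ∂ₚF)`. -/
def rootB (a : Fin (d + 1) → ℂ × ℂ → ℂ) (z : ℂ × ℂ) (p : ℂ) : ℂ :=
  accelNum a z p * slopeDeriv a 3 z p / (6 * slopeDeriv a 1 z p ^ 2)

/-- Same origin as `rootB`. The factors `d - 2` and `(d - 1)(d - 2) / 2` count the choices of the
second index, and the pairs of other roots over which `∂_yp` is summed. The term in `∂ₚ³F` is `-p *
rootB`. -/
def rootA (a : Fin (d + 1) → ℂ × ℂ → ℂ) (z : ℂ × ℂ) (p : ℂ) : ℂ :=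
  accelNum a z p * (((d : ℂ) - 2) * slopeDeriv a 2 z p / 2 - p * slopeDeriv a 3 z p / 6) /
      slopeDeriv a 1 z p ^ 2 -
    ((d : ℂ) - 1) * ((d : ℂ) - 2) / 2 *
      (slopePoly (fun k => partialY (a k)) z p / slopeDeriv a 1 z p)

/-- The fundamental form of the web defined by `F`, up to a closed form, as a sum over the
roots of `F`. -/
def rootForm (a : Fin (d + 1) → ℂ × ℂ → ℂ) (z : ℂ × ℂ) : ℂ × ℂ :=
  (((slopePolynomial a z).roots.map (rootA a z)).sum,
    ((slopePolynomial a z).roots.map (rootB a z)).sum)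

lemma slopeDeriv_zero (a : Fin (d + 1) → ℂ × ℂ → ℂ) (z : ℂ × ℂ) (p : ℂ) :
    slopeDeriv a 0 z p = slopePoly a z p := eval_slopePolynomial a z p

lemma slopeDeriv_eq_sum (a : Fin (d + 1) → ℂ × ℂ → ℂ) (m : ℕ) (z : ℂ × ℂ) (p : ℂ) :
    slopeDeriv a m z p =
      ∑ k : Fin (d + 1), a k z * (((d - (k : ℕ)).descFactorial m : ℕ) * p ^ (d - (k : ℕ) - m)) := by
  simp only [slopeDeriv, slopePolynomial, iterate_derivative_sum, eval_finsetSum,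
    iterate_derivative_C_mul, iterate_derivative_X_pow_eq_natCast_mul, eval_mul, eval_C,
    eval_natCast, eval_pow, eval_X]

lemma hasDerivAt_slopeDeriv (a : Fin (d + 1) → ℂ × ℂ → ℂ) (m : ℕ) (z : ℂ × ℂ) (p : ℂ) :
    HasDerivAt (slopeDeriv a m z) (slopeDeriv a (m + 1) z p) p := by
  have := (derivative^[m] (slopePolynomial a z)).hasDerivAt p
  rw [slopeDeriv, Function.iterate_succ_apply']
  exact this

/-- `slopeDeriv a m` is analytic as a function of `(z, p)`. -/
lemma analyticAt_slopeDeriv {a : Fin (d + 1) → ℂ × ℂ → ℂ} (m : ℕ) {u : (ℂ × ℂ) × ℂ}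
    (ha : ∀ k, AnalyticAt ℂ (a k) u.1) :
    AnalyticAt ℂ (fun u : (ℂ × ℂ) × ℂ => slopeDeriv a m u.1 u.2) u := by
  simp only [slopeDeriv_eq_sum]
  refine Finset.analyticAt_fun_sum _ fun k _ => ?_
  exact ((ha k).fun_comp analyticAt_fst).mul (analyticAt_const.mul (analyticAt_snd.pow _))

lemma analyticAt_slopePoly {a : Fin (d + 1) → ℂ × ℂ → ℂ} {u : (ℂ × ℂ) × ℂ}
    (ha : ∀ k, AnalyticAt ℂ (a k) u.1) :
    AnalyticAt ℂ (fun u : (ℂ × ℂ) × ℂ => slopePoly a u.1 u.2) u := by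
  simp only [← slopeDeriv_zero]
  exact analyticAt_slopeDeriv 0 ha

lemma fderiv_slopePoly_apply {a : Fin (d + 1) → ℂ × ℂ → ℂ} {u : (ℂ × ℂ) × ℂ}
    (ha : ∀ k, AnalyticAt ℂ (a k) u.1) (v : (ℂ × ℂ) × ℂ) :
    fderiv ℂ (fun u : (ℂ × ℂ) × ℂ => slopePoly a u.1 u.2) u v =
      slopePoly (fun k => partialX (a k)) u.1 u.2 * v.1.1 +
      slopePoly (fun k => partialY (a k)) u.1 u.2 * v.1.2 + slopeDeriv a 1 u.1 u.2 * v.2 := by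
  have h : HasFDerivAt (fun u : (ℂ × ℂ) × ℂ => slopePoly a u.1 u.2)
      (∑ k : Fin (d + 1), (a k u.1 • (((d - (k : ℕ) : ℕ) : ℂ) * u.2 ^ (d - (k : ℕ) - 1)) •
        ContinuousLinearMap.snd ℂ (ℂ × ℂ) ℂ + u.2 ^ (d - (k : ℕ)) •
          (fderiv ℂ (a k) u.1).comp (ContinuousLinearMap.fst ℂ (ℂ × ℂ) ℂ))) u := by
    simp only [slopePoly]
    refine HasFDerivAt.fun_sum fun k _ => ?_
    have h1 : HasFDerivAt (fun u : (ℂ × ℂ) × ℂ => a k u.1)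
        ((fderiv ℂ (a k) u.1).comp (ContinuousLinearMap.fst ℂ (ℂ × ℂ) ℂ)) u :=
      (ha k).differentiableAt.hasFDerivAt.comp u hasFDerivAt_fst
    have h2 : HasFDerivAt (fun u : (ℂ × ℂ) × ℂ => u.2 ^ (d - (k : ℕ)))
        ((((d - (k : ℕ) : ℕ) : ℂ) * u.2 ^ (d - (k : ℕ) - 1)) •
          ContinuousLinearMap.snd ℂ (ℂ × ℂ) ℂ) u :=
      (hasDerivAt_pow _ _).comp_hasFDerivAt u hasFDerivAt_snd
    exact h1.mul h2
  rw [h.fderiv]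
  simp only [sum_apply, add_apply,
    smul_apply, ContinuousLinearMap.comp_apply,
    ContinuousLinearMap.coe_fst', ContinuousLinearMap.coe_snd', fderiv_apply_eq (a _) u.1 v.1,
    slopePoly, slopeDeriv_eq_sum, Nat.descFactorial_one, smul_eq_mul, Finset.sum_mul]
  rw [← Finset.sum_add_distrib, ← Finset.sum_add_distrib]
  exact Finset.sum_congr rfl fun k _ => by ring

lemma slopePoly_root_deriv {a : Fin (d + 1) → ℂ × ℂ → ℂ} {z : ℂ × ℂ} {p : ℂ × ℂ → ℂ}
    (ha : ∀ k, AnalyticAt ℂ (a k) z) (hp : AnalyticAt ℂ p z)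
    (h : ∀ᶠ w in 𝓝 z, slopePoly a w (p w) = 0) :
    slopePoly (fun k => partialX (a k)) z (p z) + slopeDeriv a 1 z (p z) * partialX p z = 0 ∧
    slopePoly (fun k => partialY (a k)) z (p z) + slopeDeriv a 1 z (p z) * partialY p z = 0 := by
  have hF : DifferentiableAt ℂ (fun u : (ℂ × ℂ) × ℂ => slopePoly a u.1 u.2) (z, p z) :=
    (analyticAt_slopePoly ha).differentiableAt
  have h1 : HasFDerivAt (fun w => (w, p w)) ((ContinuousLinearMap.id ℂ _).prod (fderiv ℂ p z)) z :=
    (hasFDerivAt_id z).prodMk hp.differentiableAt.hasFDerivAt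
  have h2 : HasFDerivAt (fun w => slopePoly a w (p w)) _ z :=
    HasFDerivAt.comp (f := fun w => (w, p w)) z hF.hasFDerivAt h1
  have h3 : fderiv ℂ (fun w => slopePoly a w (p w)) z = 0 := by
    have : (fun w => slopePoly a w (p w)) =ᶠ[𝓝 z] fun _ => (0 : ℂ) := h
    rw [this.fderiv_eq]; simp
  rw [h2.fderiv] at h3
  have hv : ∀ v, fderiv ℂ (fun u : (ℂ × ℂ) × ℂ => slopePoly a u.1 u.2) (z, p z)
      (v, fderiv ℂ p z v) = 0 := fun v => by
    simpa using DFunLike.congr_fun h3 v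
  simp only [fderiv_slopePoly_apply (u := (z, p z)) ha] at hv
  constructor
  · simpa [partialX] using hv (1, 0)
  · simpa [partialY] using hv (0, 1)

lemma rootForm_eq_sum {a : Fin (d + 1) → ℂ × ℂ → ℂ} {z : ℂ × ℂ} {c : ℂ} {p : Fin d → ℂ}
    (hc : c ≠ 0) (h : slopePolynomial a z = C c * ∏ j, (X - C (p j))) :
    rootForm a z = ∑ j, (rootA a z (p j), rootB a z (p j)) := by
  have hr : (slopePolynomial a z).roots = Finset.univ.val.map p := by
    rw [h, roots_C_mul _ hc]
    have := roots_multiset_prod_X_sub_C (Finset.univ.val.map p)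
    rw [Multiset.map_map] at this
    exact this
  ext
  · rw [rootForm, hr, Multiset.map_map, Prod.fst_sum]; rfl
  · rw [rootForm, hr, Multiset.map_map, Multiset.map_map, Prod.snd_sum]; rfl

end PlanarWeb

end

/-! ### The fundamental form as a sum over a system of simple roots -/

noncomputable section

namespace PlanarWeb

open Filter Metric Set Polynomial

variable {d : ℕ}

/-- On `V`, the functions `p j` are the `d` distinct roots of `F`. -/
structure IsRootSystem (a : Fin (d + 1) → ℂ × ℂ → ℂ) (V : Set (ℂ × ℂ))
    (p : Fin d → ℂ × ℂ → ℂ) : Prop where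
  isOpen : IsOpen V
  analytic : ∀ j, AnalyticOnNhd ℂ (p j) V
  coeff : ∀ k, AnalyticOnNhd ℂ (a k) V
  injective : ∀ z ∈ V, Function.Injective fun j => p j z
  lead : ∀ z ∈ V, a 0 z ≠ 0
  eq_prod : ∀ z ∈ V, slopePolynomial a z = C (a 0 z) * ∏ j, (X - C (p j z))

namespace IsRootSystem

variable {a : Fin (d + 1) → ℂ × ℂ → ℂ} {V : Set (ℂ × ℂ)} {p : Fin d → ℂ × ℂ → ℂ}

lemma slopePoly_eq (h : IsRootSystem a V p) {z : ℂ × ℂ} (hz : z ∈ V) (x : ℂ) :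
    slopePoly a z x = a 0 z * ∏ j, (x - p j z) := by
  rw [← eval_slopePolynomial, h.eq_prod z hz]
  simp [eval_prod]

lemma slopePoly_root (h : IsRootSystem a V p) {z : ℂ × ℂ} (hz : z ∈ V) (j : Fin d) :
    slopePoly a z (p j z) = 0 := by
  rw [h.slopePoly_eq hz, Finset.prod_eq_zero (Finset.mem_univ j) (sub_self _), mul_zero]

lemma derivs (h : IsRootSystem a V p) {z : ℂ × ℂ} (hz : z ∈ V) (r : Fin d) :
    slopeDeriv a 1 z (p r z) ≠ 0 ∧
    slopeDeriv a 2 z (p r z) = 2 * slopeDeriv a 1 z (p r z) *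
      ∑ s ∈ Finset.univ.erase r, (p r z - p s z)⁻¹ ∧
    slopeDeriv a 3 z (p r z) = 3 * slopeDeriv a 1 z (p r z) *
      ∑ s ∈ Finset.univ.erase r, ∑ t ∈ (Finset.univ.erase r).erase s,
        ((p r z - p s z) * (p r z - p t z))⁻¹ := by
  obtain ⟨G, hG, h1, h2, h3⟩ := eval_derivatives_at_root (a 0 z) (fun j => p j z)
    (h.injective z hz) r (h.eq_prod z hz)
  have e1 : slopeDeriv a 1 z (p r z) = G := h1
  rw [e1]
  refine ⟨?_, h2, h3⟩
  rw [hG]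
  refine mul_ne_zero (h.lead z hz) (Finset.prod_ne_zero_iff.2 fun s hs => ?_)
  exact sub_ne_zero.2 fun h' => (Finset.ne_of_mem_erase hs) (h.injective z hz h').symm

lemma partials (h : IsRootSystem a V p) {z : ℂ × ℂ} (hz : z ∈ V) (r : Fin d) :
    accel (p r) z = -accelNum a z (p r z) / slopeDeriv a 1 z (p r z) ∧
    partialY (p r) z = -slopePoly (fun k => partialY (a k)) z (p r z) /
      slopeDeriv a 1 z (p r z) := by
  obtain ⟨h1, h2⟩ := slopePoly_root_deriv (fun k => h.coeff k z hz) (h.analytic r z hz)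
    (eventually_of_mem (h.isOpen.mem_nhds hz) fun w hw => h.slopePoly_root hw r)
  have h0 := (h.derivs hz r).1
  constructor
  · rw [eq_div_iff h0, accel, accelNum]
    linear_combination h1 + p r z * h2
  · rw [eq_div_iff h0]
    linear_combination h2

lemma sum_tripleB (h : IsRootSystem a V p) {z : ℂ × ℂ} (hz : z ∈ V) (r : Fin d) :
    ∑ s ∈ Finset.univ.erase r, ∑ t ∈ (Finset.univ.erase r).erase s,
      tripleB (p r) (p s) (p t) z = -2 * rootB a z (p r z) := by
  obtain ⟨h0, h2, h3⟩ := h.derivs hz r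
  simp only [tripleB, div_eq_mul_inv, ← Finset.mul_sum, (h.partials hz r).1]
  rw [rootB, h3]
  field_simp
  ring

/-- Splitting `p - q - r = (p - q) + (p - r) - p` reduces the double sum to the two sums evaluated
by `derivs`. -/
lemma sum_tripleA (h : IsRootSystem a V p) {z : ℂ × ℂ} (hz : z ∈ V) (r : Fin d) :
    ∑ s ∈ Finset.univ.erase r, ∑ t ∈ (Finset.univ.erase r).erase s,
      (-tripleA (p r) (p s) (p t) z + partialY (p r) z) = 2 * rootA a z (p r z) := by
  obtain ⟨h0, h2, h3⟩ := h.derivs hz r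
  have hd : 1 ≤ d := Fin.pos r
  have hcard : ((Finset.univ.erase r).card : ℂ) = d - 1 := by
    rw [Finset.card_erase_of_mem (Finset.mem_univ r), Finset.card_fin, Nat.cast_sub hd,
      Nat.cast_one]
  have hcard₂ : ∀ s ∈ Finset.univ.erase r,
      (((Finset.univ.erase r).erase s).card : ℂ) = d - 2 := fun s hs => by
    rw [Finset.card_erase_of_mem hs, Nat.cast_sub (Finset.card_pos.2 ⟨s, hs⟩), hcard]
    push_cast; ring
  set S := ∑ s ∈ Finset.univ.erase r, (p r z - p s z)⁻¹ with hS
  have e1 : ∀ s ∈ Finset.univ.erase r, ∀ t ∈ (Finset.univ.erase r).erase s,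
      -tripleA (p r) (p s) (p t) z + partialY (p r) z =
        -accel (p r) z * (p r z - p t z)⁻¹ + (-accel (p r) z * (p r z - p s z)⁻¹) +
          accel (p r) z * p r z * ((p r z - p s z) * (p r z - p t z))⁻¹ + partialY (p r) z := by
    intro s hs t ht
    have n1 : p r z - p s z ≠ 0 := sub_ne_zero.2 fun h' =>
      (Finset.ne_of_mem_erase hs) (h.injective z hz h').symm
    have n2 : p r z - p t z ≠ 0 := sub_ne_zero.2 fun h' =>
      (Finset.ne_of_mem_erase (Finset.mem_of_mem_erase ht)) (h.injective z hz h').symm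
    rw [tripleA]
    field_simp
    ring
  have e2 : ∀ s ∈ Finset.univ.erase r, ∑ t ∈ (Finset.univ.erase r).erase s,
      (-tripleA (p r) (p s) (p t) z + partialY (p r) z) =
        -accel (p r) z * (S - (p r z - p s z)⁻¹) +
          ((d : ℂ) - 2) * (-accel (p r) z * (p r z - p s z)⁻¹) +
          accel (p r) z * p r z * ∑ t ∈ (Finset.univ.erase r).erase s,
            ((p r z - p s z) * (p r z - p t z))⁻¹ + ((d : ℂ) - 2) * partialY (p r) z := by
    intro s hs
    rw [Finset.sum_congr rfl (e1 s hs)]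
    simp only [Finset.sum_add_distrib, ← Finset.mul_sum, Finset.sum_const, nsmul_eq_mul,
      hcard₂ s hs]
    rw [Finset.sum_erase_eq_sub hs, ← hS]
    ring
  rw [Finset.sum_congr rfl e2]
  simp only [Finset.sum_add_distrib, ← Finset.mul_sum, Finset.sum_const, nsmul_eq_mul, hcard,
    Finset.sum_sub_distrib, ← hS]
  rw [rootA, h2, h3, (h.partials hz r).1, (h.partials hz r).2]
  field_simp
  ring

lemma sum_triples_eq_rootForm (h : IsRootSystem a V p) {z : ℂ × ℂ} (hz : z ∈ V) :
    (∑ r, ∑ s, ∑ t, if r < s ∧ s < t then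
      (-(tripleA (p r) (p s) (p t) z + tripleA (p s) (p t) (p r) z +
          tripleA (p t) (p r) (p s) z) +
        (partialY (p r) z + partialY (p s) z + partialY (p t) z),
        -(tripleB (p r) (p s) (p t) z + tripleB (p s) (p t) (p r) z +
          tripleB (p t) (p r) (p s) z)) else ((0, 0) : ℂ × ℂ)) = rootForm a z := by
  rw [rootForm_eq_sum (h.lead z hz) (h.eq_prod z hz)]
  have e1 := sum_triples (fun r s t => -tripleA (p r) (p s) (p t) z + partialY (p r) z)
    (fun r s t => by simp only [tripleA]; ring)
  have e2 := sum_triples (fun r s t => -tripleB (p r) (p s) (p t) z)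
    (fun r s t => by simp only [tripleB]; ring)
  rw [Finset.sum_congr rfl fun r _ => h.sum_tripleA hz r, ← Finset.mul_sum,
    inv_mul_cancel_left₀ two_ne_zero] at e1
  simp only [Finset.sum_neg_distrib, h.sum_tripleB hz, ← Finset.mul_sum] at e2
  have e3 : (2 : ℂ)⁻¹ * -(-2 * ∑ r, rootB a z (p r z)) = ∑ r, rootB a z (p r z) := by ring
  rw [e3] at e2
  ext
  · simp only [Prod.fst_sum]
    rw [← e1]
    refine Finset.sum_congr rfl fun r _ => Finset.sum_congr rfl fun s _ =>
      Finset.sum_congr rfl fun t _ => ?_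
    split_ifs <;> simp; ring
  · simp only [Prod.snd_sum]
    rw [← e2]
    refine Finset.sum_congr rfl fun r _ => Finset.sum_congr rfl fun s _ =>
      Finset.sum_congr rfl fun t _ => ?_
    split_ifs <;> simp; ring

/-- `rootForm` is defined through the multiset of roots, so it needs no labelling; analyticity is
seen after labelling the roots locally. -/
lemma analyticAt_rootForm (h : IsRootSystem a V p) {z : ℂ × ℂ} (hz : z ∈ V) :
    AnalyticAt ℂ (rootForm a) z := by
  have hm : ∀ (b : Fin (d + 1) → ℂ × ℂ → ℂ), (∀ k, AnalyticAt ℂ (b k) z) → ∀ (m : ℕ) (j : Fin d),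
      AnalyticAt ℂ (fun w => slopeDeriv b m w (p j w)) z := fun b hb m j =>
    AnalyticAt.fun_comp (g := fun u : (ℂ × ℂ) × ℂ => slopeDeriv b m u.1 u.2)
      (f := fun w => (w, p j w)) (analyticAt_slopeDeriv m hb)
      (analyticAt_id.prod (h.analytic j z hz))
  have hX := fun k => analyticAt_partialX (h.coeff k z hz)
  have hY := fun k => analyticAt_partialY (h.coeff k z hz)
  have ha := fun k => h.coeff k z hz
  have hA : ∀ j, AnalyticAt ℂ (fun w => (rootA a w (p j w), rootB a w (p j w))) z := by
    intro j
    have h1 := hm a ha 1 j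
    have h2 := hm a ha 2 j
    have h3 := hm a ha 3 j
    have hx := hm _ hX 0 j
    have hy := hm _ hY 0 j
    have hp := h.analytic j z hz
    simp only [slopeDeriv_zero] at hx hy
    have h0 : slopeDeriv a 1 z (p j z) ≠ 0 := (h.derivs hz j).1
    have hN : AnalyticAt ℂ (fun w => accelNum a w (p j w)) z := hx.add (hp.mul hy)
    refine AnalyticAt.prod ?_ ?_
    · simp only [rootA]
      refine AnalyticAt.sub (AnalyticAt.div (hN.mul ?_) (h1.pow 2) (pow_ne_zero _ h0))
        (analyticAt_const.mul (hy.div h1 h0))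
      exact ((analyticAt_const.mul h2).div_const).sub ((hp.mul h3).div_const)
    · simp only [rootB]
      exact (hN.mul h3).div (analyticAt_const.mul (h1.pow 2))
        (mul_ne_zero (by norm_num) (pow_ne_zero _ h0))
  refine (Finset.univ.analyticAt_fun_sum fun j _ => hA j).congr ?_
  filter_upwards [h.isOpen.mem_nhds hz] with w hw
  exact (rootForm_eq_sum (h.lead w hw) (h.eq_prod w hw)).symm

/-- Summing `eq_slopes` over all triples, the fundamental form is `rootForm a` plus logarithmic
differentials, which are closed. -/
theorem extD_fundamentalForm (h : IsRootSystem a V p) {θ : Fin d → ℂ × ℂ → ℂ × ℂ}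
    {f : Fin d → ℂ × ℂ → ℂ} {η : ℂ × ℂ → ℂ × ℂ} (hf : ∀ j, AnalyticOnNhd ℂ (f j) V)
    (hf0 : ∀ j, ∀ z ∈ V, f j z ≠ 0) (hθ : ∀ j, ∀ z ∈ V, θ j z = f j z • (-p j z, 1))
    (hη : IsFundamentalForm V θ η) {z : ℂ × ℂ} (hz : z ∈ V) :
    extD η z = extD (rootForm a) z := by
  obtain ⟨η₃, h₃, hsum⟩ := hη
  set G : Fin d → Fin d → Fin d → ℂ × ℂ → ℂ := fun r s t w => f r w * f s w * f t w *
    ((p r w - p s w) * (p s w - p t w) * (p t w - p r w)) with hG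
  have hGa : ∀ r s t, AnalyticAt ℂ (G r s t) z := fun r s t =>
    (((hf r z hz).mul (hf s z hz)).mul (hf t z hz)).mul
      ((((h.analytic r z hz).sub (h.analytic s z hz)).mul
        ((h.analytic s z hz).sub (h.analytic t z hz))).mul
          ((h.analytic t z hz).sub (h.analytic r z hz)))
  have hG0 : ∀ r s t, r < s → s < t → G r s t z ≠ 0 := fun r s t hrs hst => by
    have hn : ∀ i j : Fin d, i ≠ j → p i z - p j z ≠ 0 := fun i j hij =>
      sub_ne_zero.2 fun h' => hij (h.injective z hz h')
    exact mul_ne_zero (mul_ne_zero (mul_ne_zero (hf0 r z hz) (hf0 s z hz)) (hf0 t z hz))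
      (mul_ne_zero (mul_ne_zero (hn _ _ hrs.ne) (hn _ _ hst.ne)) (hn _ _ (hrs.trans hst).ne'))
  set L : Fin d → Fin d → Fin d → ℂ × ℂ → ℂ × ℂ := fun r s t w =>
    if r < s ∧ s < t then dlog (G r s t) w else 0 with hL
  have hLa : ∀ r s t, DifferentiableAt ℂ (L r s t) z := fun r s t => by
    by_cases hr : r < s ∧ s < t
    · simp only [hL, hr, and_self, if_true]
      exact (analyticAt_dlog (hGa r s t) (hG0 r s t hr.1 hr.2)).differentiableAt
    · simp only [hL, hr, if_false]
      exact differentiableAt_const _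
  have hLd : ∀ r s t, extD (L r s t) z = 0 := fun r s t => by
    by_cases hr : r < s ∧ s < t
    · simp only [hL, hr, and_self, if_true]
      exact extD_dlog (hGa r s t) (hG0 r s t hr.1 hr.2)
    · simp only [hL, hr, if_false]
      simp [extD, partialX, partialY]
  have e : η =ᶠ[𝓝 z] fun w => (∑ r, ∑ s, ∑ t, L r s t w) + rootForm a w := by
    filter_upwards [h.isOpen.mem_nhds hz] with w hw
    rw [hsum, ← h.sum_triples_eq_rootForm hw]
    simp only [← Finset.sum_add_distrib]
    refine Finset.sum_congr rfl fun r _ => Finset.sum_congr rfl fun s _ =>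
      Finset.sum_congr rfl fun t _ => ?_
    by_cases hr : r < s ∧ s < t
    · have hn : ∀ i j : Fin d, i ≠ j → p i w ≠ p j w := fun i j hij h' =>
        hij (h.injective w hw h')
      simp only [hL, hr, and_self, if_true]
      exact (h₃ r s t hr.1 hr.2).eq_slopes h.isOpen hw (hθ r) (hθ s) (hθ t) (hf r w hw)
        (hf s w hw) (hf t w hw) (h.analytic r w hw) (h.analytic s w hw) (h.analytic t w hw)
        (hf0 r w hw) (hf0 s w hw) (hf0 t w hw) (hn _ _ hr.1.ne) (hn _ _ hr.2.ne)
        (hn _ _ (hr.1.trans hr.2).ne')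
    · simp only [hL, hr, if_false]
      ext <;> simp
  have d3 : ∀ r s, DifferentiableAt ℂ (fun w => ∑ t, L r s t w) z := fun r s =>
    DifferentiableAt.fun_sum fun t _ => hLa r s t
  have d2 : ∀ r, DifferentiableAt ℂ (fun w => ∑ s, ∑ t, L r s t w) z := fun r =>
    DifferentiableAt.fun_sum fun s _ => d3 r s
  rw [extD_congr e, extD_add (DifferentiableAt.fun_sum fun r _ => d2 r)
    (h.analyticAt_rootForm hz).differentiableAt, extD_sum _ fun r _ => d2 r]
  rw [Finset.sum_eq_zero, zero_add]
  intro r _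
  rw [extD_sum _ fun s _ => d3 r s]
  refine Finset.sum_eq_zero fun s _ => ?_
  rw [extD_sum _ fun t _ => hLa r s t]
  exact Finset.sum_eq_zero fun t _ => hLd r s t

end IsRootSystem

/-! ### Decompositions and root systems -/

lemma symForm_one {a : Fin (d + 1) → ℂ × ℂ → ℂ} (z : ℂ × ℂ) (x : ℂ) :
    symForm a z (1, x) = slopePoly a z x := by
  simp [symForm, slopePoly]

lemma symForm_vertical {a : Fin (d + 1) → ℂ × ℂ → ℂ} (z : ℂ × ℂ) :
    symForm a z (0, 1) = a 0 z := by
  rw [symForm, Finset.sum_eq_single 0]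
  · simp
  · intro k _ hk
    have : (k : ℕ) ≠ 0 := fun h => hk (Fin.ext h)
    simp [this]
  · simp

lemma symForm_eq_slopePoly {a : Fin (d + 1) → ℂ × ℂ → ℂ} (z : ℂ × ℂ) (v : ℂ × ℂ) (hv : v.1 ≠ 0) :
    symForm a z v = v.1 ^ d * slopePoly a z (v.2 / v.1) := by
  rw [symForm, slopePoly, Finset.mul_sum]
  refine Finset.sum_congr rfl fun k _ => ?_
  have : v.1 ^ d = v.1 ^ (k : ℕ) * v.1 ^ (d - (k : ℕ)) := by
    rw [← pow_add]; congr 1; omega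
  rw [this, div_pow]
  field_simp

/-- The coefficient `a 0` is the value of the symmetric form on the vertical vector. Its being
non-zero says that no foliation is vertical, so every `θ j` has a finite slope, and transversality
makes the slopes distinct. -/
lemma exists_isRootSystem_of_decomposition {a : Fin (d + 1) → ℂ × ℂ → ℂ} {V : Set (ℂ × ℂ)}
    (hV : IsOpen V) {θ : Fin d → ℂ × ℂ → ℂ × ℂ} (ha : ∀ k, AnalyticOnNhd ℂ (a k) V)
    (ha0 : ∀ z ∈ V, a 0 z ≠ 0) (hθ : ∀ j, AnalyticOnNhd ℂ (θ j) V)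
    (hw : ∀ z ∈ V, ∀ j k, j ≠ k → wedge (θ j z) (θ k z) ≠ 0)
    (h : ∀ z ∈ V, ∃ c : ℂ, ∀ v, symForm a z v = c * ∏ j, evalForm (θ j z) v) :
    (∀ j, ∀ z ∈ V, (θ j z).2 ≠ 0) ∧
      IsRootSystem a V fun j z => -(θ j z).1 / (θ j z).2 := by
  have h2 : ∀ j, ∀ z ∈ V, (θ j z).2 ≠ 0 := by
    intro j z hz h0
    obtain ⟨c, hc⟩ := h z hz
    have := hc (0, 1)
    rw [symForm_vertical, Finset.prod_eq_zero (Finset.mem_univ j) (by simp [evalForm, h0]),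
      mul_zero] at this
    exact ha0 z hz this
  refine ⟨h2, hV, fun j z hz => ?_, ha, fun z hz j k hjk => ?_, ha0, fun z hz => ?_⟩
  · exact (analyticAt_fst.fun_comp (hθ j z hz)).neg.div (analyticAt_snd.fun_comp (hθ j z hz)) (h2 j z hz)
  · by_contra hne
    refine hw z hz j k hne ?_
    have h3 := h2 j z hz
    have h4 := h2 k z hz
    simp only at hjk
    rw [div_eq_div_iff h3 h4] at hjk
    rw [wedge]; linear_combination -hjk
  · obtain ⟨c, hc⟩ := h z hz
    have e0 := hc (0, 1)
    rw [symForm_vertical] at e0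
    refine Polynomial.funext fun x => ?_
    rw [eval_slopePolynomial, ← symForm_one, hc, e0]
    simp only [evalForm, eval_mul, eval_C, eval_prod, eval_sub, eval_X]
    rw [mul_assoc, ← Finset.prod_mul_distrib]
    congr 1
    refine Finset.prod_congr rfl fun j _ => ?_
    have := h2 j z hz
    field_simp
    ring

/-- The degree is at most `d` and the coefficient of `p ^ d` is `a 0 z`, so `d` distinct roots leave
only a constant factor. The zero polynomial is allowed. -/
lemma slopePolynomial_eq_of_roots {a : Fin (d + 1) → ℂ × ℂ → ℂ} {z : ℂ × ℂ} (p : Fin d → ℂ)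
    (hp : Function.Injective p) (h : ∀ j, slopePoly a z (p j) = 0) :
    slopePolynomial a z = C (a 0 z) * ∏ j, (X - C (p j)) := by
  have hdeg : (slopePolynomial a z).natDegree ≤ d := by
    refine natDegree_sum_le_of_forall_le _ _ fun k _ => ?_
    exact (natDegree_C_mul_X_pow_le _ _).trans (Nat.sub_le _ _)
  have hcoeff : (slopePolynomial a z).coeff d = a 0 z := by
    rw [slopePolynomial, finsetSum_coeff, Finset.sum_eq_single 0]
    · simp
    · intro k _ hk
      have : (k : ℕ) ≠ 0 := fun h => hk (Fin.ext h)
      have hk' := k.2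
      rw [coeff_C_mul, coeff_X_pow, if_neg (by omega), mul_zero]
    · simp
  have hprod : (∏ j, (X - C (p j))).Monic := monic_prod_X_sub_C _ _
  have hpd : (∏ j, (X - C (p j))).natDegree = d := by simp
  have hdvd : (∏ j, (X - C (p j))) ∣ slopePolynomial a z := by
    refine Finset.prod_dvd_of_coprime (fun i _ j _ hij => ?_) fun j _ => ?_
    · exact pairwise_coprime_X_sub_C hp hij
    · rw [dvd_iff_isRoot, IsRoot, eval_slopePolynomial, h]
  obtain ⟨q, hq⟩ := hdvd
  rcases eq_or_ne q 0 with rfl | hq0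
  · rw [mul_zero] at hq
    rw [hq] at hcoeff ⊢
    rw [← hcoeff]; simp
  · have h1 := hprod.natDegree_mul' hq0
    rw [← hq, hpd] at h1
    have h2 : q.natDegree = 0 := by omega
    obtain ⟨c, rfl⟩ := natDegree_eq_zero.1 h2
    have : c = a 0 z := by
      rw [← hcoeff, hq, mul_comm, coeff_C_mul]
      have := hprod.coeff_natDegree
      rw [hpd] at this
      rw [this, mul_one]
    rw [hq, this, mul_comm]

lemma exists_isRootSystem {a : Fin (d + 1) → ℂ × ℂ → ℂ} {z : ℂ × ℂ}
    (ha : ∀ k, AnalyticAt ℂ (a k) z) (ha0 : a 0 z ≠ 0) (p : Fin d → ℂ)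
    (hp : Function.Injective p) (h : ∀ j, slopePoly a z (p j) = 0) :
    ∃ V q, z ∈ V ∧ IsRootSystem a V q ∧ ∀ j, q j z = p j := by
  have hP := slopePolynomial_eq_of_roots p hp h
  have hd : ∀ j, slopeDeriv a 1 z (p j) ≠ 0 := fun j => by
    obtain ⟨G, hG, h1, -⟩ := eval_derivatives_at_root _ p hp j hP
    rw [show slopeDeriv a 1 z (p j) = G from h1, hG]
    refine mul_ne_zero ha0 (Finset.prod_ne_zero_iff.2 fun s hs => ?_)
    exact sub_ne_zero.2 fun h' => (Finset.ne_of_mem_erase hs) (hp h').symm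
  have hq : ∀ j, ∃ q : ℂ × ℂ → ℂ, AnalyticAt ℂ q z ∧ q z = p j ∧
      ∀ᶠ w in 𝓝 z, slopePoly a w (q w) = 0 := fun j => by
    refine exists_analytic_root (G := fun u : (ℂ × ℂ) × ℂ => slopePoly a u.1 u.2)
      (analyticAt_slopePoly ha) (h j) ?_
    rw [fderiv_slopePoly_apply ha]
    simpa using hd j
  choose q hqa hqz hq0 using hq
  have hinj : ∀ᶠ w in 𝓝 z, ∀ i j, i ≠ j → q i w ≠ q j w := by
    refine eventually_all.2 fun i => eventually_all.2 fun j => ?_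
    by_cases hij : i = j
    · simp [hij]
    · have : q i z ≠ q j z := by
        rw [hqz, hqz]; exact fun h' => hij (hp h')
      filter_upwards [((hqa i).continuousAt.sub (hqa j).continuousAt).eventually_ne
        (sub_ne_zero.2 this)] with w hw _
      exact sub_ne_zero.1 hw
  have hall : ∀ᶠ w in 𝓝 z, (∀ j, AnalyticAt ℂ (q j) w) ∧ (∀ k, AnalyticAt ℂ (a k) w) ∧
      (∀ i j, i ≠ j → q i w ≠ q j w) ∧ a 0 w ≠ 0 ∧ ∀ j, slopePoly a w (q j w) = 0 :=
    (eventually_all.2 fun j => (hqa j).eventually_analyticAt).and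
      ((eventually_all.2 fun k => (ha k).eventually_analyticAt).and
        (hinj.and (((ha 0).continuousAt.eventually_ne ha0).and (eventually_all.2 hq0))))
  obtain ⟨V, hV, hVo, hzV⟩ := _root_.eventually_nhds_iff.1 hall
  refine ⟨V, q, hzV, ⟨hVo, fun j w hw => (hV w hw).1 j, fun k w hw => (hV w hw).2.1 k,
    fun w hw i j hij => ?_, fun w hw => (hV w hw).2.2.2.1, fun w hw => ?_⟩, hqz⟩
  · by_contra hne
    exact (hV w hw).2.2.1 i j hne hij
  · refine slopePolynomial_eq_of_roots _ (fun i j hij => ?_) (hV w hw).2.2.2.2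
    by_contra hne
    exact (hV w hw).2.2.1 i j hne hij

end PlanarWeb

end

noncomputable section

namespace PlanarWeb

open Filter Metric Set

variable {d : ℕ} {M : Type*} [TopologicalSpace M] [ChartedSpace (ℂ × ℂ) M]
  {e e' : OpenPartialHomeomorph M (ℂ × ℂ)}

/-! ### Changes of coordinates -/

section charts

lemma mdifferentiable_coord (he : e ∈ Coord M) : e.MDifferentiable I₂ I₂ :=
  ⟨(contMDiffOn_of_mem_maximalAtlas he).mdifferentiableOn (by simp),
    (contMDiffOn_symm_of_mem_maximalAtlas he).mdifferentiableOn (by simp)⟩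

lemma analyticAt_transition (he : e ∈ Coord M) (he' : e' ∈ Coord M) {z : ℂ × ℂ}
    (hz : z ∈ (e'.symm.trans e).source) : AnalyticAt ℂ (e'.symm.trans e) z := by
  have hz1 : z ∈ e'.target := by simpa using hz.1
  have hz2 : e'.symm z ∈ e.source := by simpa using hz.2
  have h1 : ContMDiffAt I₂ I₂ ω (e ∘ e'.symm) z :=
    ContMDiffAt.comp z (contMDiffAt_of_mem_maximalAtlas he hz2)
      (contMDiffAt_symm_of_mem_maximalAtlas he' hz1)
  exact (contMDiffAt_iff_contDiffAt.1 h1).analyticAt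

lemma mfderiv_symm_transition (he : e ∈ Coord M) (he' : e' ∈ Coord M) {z : ℂ × ℂ}
    (hz : z ∈ (e'.symm.trans e).source) (v : ℂ × ℂ) :
    (mfderiv I₂ I₂ e'.symm z v : ℂ × ℂ) =
      (mfderiv I₂ I₂ e.symm (e'.symm.trans e z)
        (fderiv ℂ (e'.symm.trans e) z v : ℂ × ℂ) : ℂ × ℂ) := by
  have hz1 : z ∈ e'.target := by simpa using hz.1
  have hz2 : e'.symm z ∈ e.source := by simpa using hz.2
  have hev : (e'.symm : ℂ × ℂ → M) =ᶠ[𝓝 z] e.symm ∘ (e'.symm.trans e) := by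
    filter_upwards [(e'.symm.trans e).open_source.mem_nhds hz] with w hw
    have hw2 : e'.symm w ∈ e.source := by simpa using hw.2
    simp [e.left_inv hw2]
  rw [hev.mfderiv_eq]
  have h1 : MDifferentiableAt I₂ I₂ e.symm (e'.symm.trans e z) :=
    (mdifferentiable_coord he).mdifferentiableAt_symm (by simpa using e.map_source hz2)
  have h2 : DifferentiableAt ℂ (e'.symm.trans e) z :=
    (analyticAt_transition he he' hz).differentiableAt
  rw [mfderiv_comp z h1 h2.mdifferentiableAt, mfderiv_eq_fderiv]
  rfl

lemma inCoord_transition (he : e ∈ Coord M) (he' : e' ∈ Coord M) {z : ℂ × ℂ}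
    (hz : z ∈ (e'.symm.trans e).source) (s : (m : M) → TangentSpace I₂ m → ℂ) (v : ℂ × ℂ) :
    inCoord e' s z v = inCoord e s (e'.symm.trans e z) (fderiv ℂ (e'.symm.trans e) z v) := by
  have hz2 : e'.symm z ∈ e.source := by simpa using hz.2
  have hpt : e.symm (e'.symm.trans e z) = e'.symm z := by simp [e.left_inv hz2]
  -- The two base points are only propositionally equal, while all tangent spaces are definitionally
  -- `ℂ × ℂ`; this transports the argument without casts.
  have hs : ∀ (m m' : M) (_ : m = m') (u : ℂ × ℂ), s m u = s m' u := by
    rintro m _ rfl u; rfl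
  have := mfderiv_symm_transition he he' hz v
  simp only [inCoord]
  refine (congrArg (fun u : ℂ × ℂ => s (e'.symm z) u) this).trans ?_
  exact hs _ _ hpt.symm _

lemma jac_transition_ne_zero (he : e ∈ Coord M) (he' : e' ∈ Coord M) {z : ℂ × ℂ}
    (hz : z ∈ (e'.symm.trans e).source) : jac (e'.symm.trans e) z ≠ 0 := by
  set T := e'.symm.trans e with hT
  have hz1 : z ∈ e'.target := by simpa using hz.1
  have hz2 : e'.symm z ∈ e.source := by simpa using hz.2
  have hTz : T z ∈ (e.symm.trans e').source := by
    refine ⟨by simpa [hT] using e.map_source hz2, ?_⟩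
    simpa [hT, e.left_inv hz2] using e'.map_target hz1
  have ha := analyticAt_transition he he' hz
  have hb := analyticAt_transition he' he hTz
  set S := e.symm.trans e' with hS
  have hid : (fun w => S (T w)) =ᶠ[𝓝 z] id := by
    filter_upwards [T.open_source.mem_nhds hz] with w hw
    have hw2 : e'.symm w ∈ e.source := by simpa using hw.2
    have hw1 : w ∈ e'.target := by simpa using hw.1
    simp [hS, hT, e.left_inv hw2, e'.right_inv hw1]
  have g1 : grad (fun w => (S (T w)).1) z = pull T (grad fun w => (S w).1) z :=
    grad_comp (f := fun w => (S w).1) hb.differentiableAt.fst ha.differentiableAt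
  have g2 : grad (fun w => (S (T w)).2) z = pull T (grad fun w => (S w).2) z :=
    grad_comp (f := fun w => (S w).2) hb.differentiableAt.snd ha.differentiableAt
  have i1 : grad (fun w => (S (T w)).1) z = (1, 0) := by
    have h : (fun w => (S (T w)).1) =ᶠ[𝓝 z] fun w => w.1 := hid.fun_comp Prod.fst
    rw [grad, partialX_congr h, partialY_congr h]
    simp [partialX, partialY, fderiv_fst]
  have i2 : grad (fun w => (S (T w)).2) z = (0, 1) := by
    have h : (fun w => (S (T w)).2) =ᶠ[𝓝 z] fun w => w.2 := hid.fun_comp Prod.snd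
    rw [grad, partialX_congr h, partialY_congr h]
    simp [partialX, partialY, fderiv_snd]
  have key := wedge_pull (Φ := T) (z := z) (α := grad fun w => (S w).1)
    (β := grad fun w => (S w).2)
  rw [← g1, ← g2, i1, i2] at key
  intro h0
  rw [h0, zero_mul] at key
  simp [wedge] at key

end charts

/-! ### The fundamental form of a decomposition -/

lemma IsFundamentalForm.analyticOnNhd {V : Set (ℂ × ℂ)} {θ : Fin d → ℂ × ℂ → ℂ × ℂ}
    {η : ℂ × ℂ → ℂ × ℂ} (h : IsFundamentalForm V θ η) : AnalyticOnNhd ℂ η V := by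
  obtain ⟨η₃, h₃, hs⟩ := h
  intro z hz
  rw [funext hs]
  refine Finset.analyticAt_fun_sum _ fun r _ => Finset.analyticAt_fun_sum _ fun s _ =>
    Finset.analyticAt_fun_sum _ fun t _ => ?_
  by_cases hr : r < s ∧ s < t
  · simp only [hr, and_self, if_true]
    exact (h₃ r s t hr.1 hr.2).1 z hz
  · simp only [hr, if_false]
    exact analyticAt_const

lemma exists_isFundamentalForm {V : Set (ℂ × ℂ)} {θ : Fin d → ℂ × ℂ → ℂ × ℂ}
    (hθ : ∀ j, AnalyticOnNhd ℂ (θ j) V)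
    (hw : ∀ z ∈ V, ∀ j k, j ≠ k → wedge (θ j z) (θ k z) ≠ 0) :
    ∃ η, IsFundamentalForm V θ η := by
  have h : ∀ r s t, ∃ η, r < s → s < t → IsFundamentalForm₃ V (θ r) (θ s) (θ t) η := by
    intro r s t
    by_cases hr : r < s ∧ s < t
    · obtain ⟨η, hη⟩ := exists_isFundamentalForm₃ (hθ r) (hθ s) (hθ t)
        (fun z hz => hw z hz _ _ hr.1.ne) (fun z hz => hw z hz _ _ hr.2.ne)
        (fun z hz => hw z hz _ _ (hr.1.trans hr.2).ne')
      exact ⟨η, fun _ _ => hη⟩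
    · exact ⟨0, fun h1 h2 => absurd ⟨h1, h2⟩ hr⟩
  choose η₃ h₃ using h
  exact ⟨_, η₃, h₃, fun z => rfl⟩

/-- Every triple contributes the same correction `dlog (jac Φ)`, so the total correction is `N`
times it, with `N` the number of triples. It is closed, which makes the curvature a genuine
`2`-form. -/
lemma IsFundamentalForm.pull {V V' : Set (ℂ × ℂ)} {θ : Fin d → ℂ × ℂ → ℂ × ℂ}
    {η : ℂ × ℂ → ℂ × ℂ} (h : IsFundamentalForm V θ η) (hθ : ∀ j, AnalyticOnNhd ℂ (θ j) V)
    {Φ : ℂ × ℂ → ℂ × ℂ} (hΦ : AnalyticOnNhd ℂ Φ V') (hV : ∀ z ∈ V', Φ z ∈ V)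
    (hJ : ∀ z ∈ V', jac Φ z ≠ 0) :
    ∃ η', IsFundamentalForm V' (fun j => pull Φ (θ j)) η' ∧
      ∀ z ∈ V', extD η' z = jac Φ z * extD η (Φ z) := by
  have hη := h.analyticOnNhd
  obtain ⟨η₃, h₃, hs⟩ := h
  set N : ℂ := ∑ r : Fin d, ∑ s : Fin d, ∑ t : Fin d, if r < s ∧ s < t then 1 else 0 with hN
  have key : ∀ z, (∑ r : Fin d, ∑ s : Fin d, ∑ t : Fin d, if r < s ∧ s < t then
      PlanarWeb.pull Φ (η₃ r s t) z + dlog (jac Φ) z else 0) =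
      PlanarWeb.pull Φ η z + N • dlog (jac Φ) z := by
    intro z
    have hp : ∀ c : ℂ × ℂ, c.1 • grad (fun w => (Φ w).1) z + c.2 • grad (fun w => (Φ w).2) z =
      (LinearMap.toSpanSingleton ℂ (ℂ × ℂ) (grad (fun w => (Φ w).1) z) ∘ₗ LinearMap.fst ℂ ℂ ℂ +
       LinearMap.toSpanSingleton ℂ (ℂ × ℂ) (grad (fun w => (Φ w).2) z) ∘ₗ LinearMap.snd ℂ ℂ ℂ) c :=
      fun c => by simp
    simp only [PlanarWeb.pull, hs, hN]
    rw [hp]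
    simp only [map_sum, Finset.sum_smul, ← Finset.sum_add_distrib]
    refine Finset.sum_congr rfl fun r _ => Finset.sum_congr rfl fun s _ =>
      Finset.sum_congr rfl fun t _ => ?_
    by_cases hr : r < s ∧ s < t
    · simp only [hr, and_self, if_true, one_smul, ← hp]
    · simp [hr]
  refine ⟨fun z => PlanarWeb.pull Φ η z + N • dlog (jac Φ) z,
    ⟨fun r s t z => PlanarWeb.pull Φ (η₃ r s t) z + dlog (jac Φ) z, fun r s t hrs hst =>
      (h₃ r s t hrs hst).pull (hθ r) (hθ s) (hθ t) hΦ hV hJ, fun z => (key z).symm⟩, ?_⟩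
  intro z hz
  have hj := analyticAt_jac (hΦ z hz)
  have hl := analyticAt_dlog hj (hJ z hz)
  rw [extD_add (β := fun w => N • dlog (jac Φ) w)
    (analyticAt_pull (hΦ z hz) (hη _ (hV z hz))).differentiableAt
    (hl.differentiableAt.const_smul N), extD_pull (hΦ z hz) (hη _ (hV z hz)),
    extD_smul (g := fun _ => N) (by fun_prop) hl.differentiableAt, extD_dlog hj (hJ z hz)]
  simp [wedge, grad, partialX, partialY]

section webs

variable {W : Web d M}

lemma IsCurvatureAt.transition (he : e ∈ Coord M) (he' : e' ∈ Coord M) {z : ℂ × ℂ}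
    (hz : z ∈ (e'.symm.trans e).source) {k : ℂ}
    (h : IsCurvatureAt W e (e'.symm.trans e z) k) :
    IsCurvatureAt W e' z (jac (e'.symm.trans e) z * k) := by
  obtain ⟨V, θ, η, hzV, ⟨hVo, hVt, hθ, hw, hdec⟩, hη, rfl⟩ := h
  set T := e'.symm.trans e with hT
  set V' := T.source ∩ T ⁻¹' V with hV'
  have hTa : AnalyticOnNhd ℂ T V' := fun w hw => analyticAt_transition he he' hw.1
  have hJ : ∀ w ∈ V', jac T w ≠ 0 := fun w hw => jac_transition_ne_zero he he' hw.1
  obtain ⟨η', h1, h2⟩ := hη.pull hθ hTa (fun w hw => hw.2) hJ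
  refine ⟨V', fun j => pull T (θ j), η', ⟨hz, hzV⟩, ⟨T.isOpen_inter_preimage hVo, ?_, ?_, ?_, ?_⟩,
    h1, (h2 z ⟨hz, hzV⟩).symm⟩
  · intro w hw
    simpa using hw.1.1
  · exact fun j w hw => analyticAt_pull (hTa w hw) (hθ j _ hw.2)
  · intro w hw' j k hjk
    rw [wedge_pull]
    exact mul_ne_zero (hJ w hw') (hw _ hw'.2 j k hjk)
  · intro i w hw' hi
    have hw2 : e'.symm w ∈ e.source := by simpa using hw'.1.2
    obtain ⟨c, hc, hv⟩ := hdec i (T w) hw'.2 (by simpa [hT, e.left_inv hw2] using hi)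
    refine ⟨c, hc, fun v => ?_⟩
    rw [inCoord_transition he he' hw'.1, hv]
    exact congrArg _ (Finset.prod_congr rfl fun j _ =>
      (evalForm_pull (hTa w hw').differentiableAt v).symm)

end webs

end PlanarWeb

end

noncomputable section

namespace PlanarWeb

open Filter Metric Set

variable {d : ℕ} {M : Type*} [TopologicalSpace M] [ChartedSpace (ℂ × ℂ) M]
  {e e' : OpenPartialHomeomorph M (ℂ × ℂ)} {W : Web d M}

/-! ### Local equations of a web -/

/-- Near `z`, the symmetric form with holomorphic coefficients `a` differs from the forms of `W`
by nonvanishing factors. -/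
structure IsLocalEquation (W : Web d M) (e : OpenPartialHomeomorph M (ℂ × ℂ)) (z : ℂ × ℂ)
    (a : Fin (d + 1) → ℂ × ℂ → ℂ) : Prop where
  analyticAt : ∀ k, AnalyticAt ℂ (a k) z
  mem_target : z ∈ e.target
  eventually_eq : ∀ᶠ w in 𝓝 z, ∀ i, e.symm w ∈ W.U i →
    ∃ c : ℂ, c ≠ 0 ∧ ∀ v, inCoord e (W.form i) w v = c * symForm a w v

namespace IsLocalEquation

variable {z : ℂ × ℂ} {a : Fin (d + 1) → ℂ × ℂ → ℂ}

lemma eventually (h : IsLocalEquation W e z a) : ∀ᶠ w in 𝓝 z, IsLocalEquation W e w a := by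
  filter_upwards [eventually_all.2 fun k => (h.analyticAt k).eventually_analyticAt,
    e.open_target.mem_nhds h.mem_target, h.eventually_eq.eventually_nhds] with w h1 h2 h3
  exact ⟨h1, h2, h3⟩

lemma exists_index (W : Web d M) (m : M) : ∃ i, m ∈ W.U i := by
  have : m ∈ ⋃ i, W.U i := by rw [W.cover]; trivial
  exact mem_iUnion.1 this

end IsLocalEquation

lemma IsImplicitEquation.isLocalEquation {a : Fin (d + 1) → ℂ × ℂ → ℂ}
    (h : IsImplicitEquation W e a) {z : ℂ × ℂ} (hz : z ∈ e.target) : IsLocalEquation W e z a := by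
  refine ⟨fun k => h.1 k z hz, hz, ?_⟩
  filter_upwards [e.open_target.mem_nhds hz] with w hw i hi
  obtain ⟨g, -, hg⟩ := h.2 i
  exact ⟨g w, (hg w ⟨hw, hi⟩).1, (hg w ⟨hw, hi⟩).2⟩

lemma exists_isLocalEquation (W : Web d M) (he : e ∈ Coord M) {z : ℂ × ℂ} (hz : z ∈ e.target) :
    ∃ a, IsLocalEquation W e z a := by
  obtain ⟨i, hi⟩ := IsLocalEquation.exists_index W (e.symm z)
  obtain ⟨a, ha, hs⟩ := W.isSymForm i e he
  refine ⟨a, fun k => ha k z ⟨hz, hi⟩, hz, ?_⟩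
  filter_upwards [(e.isOpen_inter_preimage_symm (W.isOpen_U i)).mem_nhds ⟨hz, hi⟩] with w hw j hj
  obtain ⟨g, -, hg⟩ := W.compat j i
  obtain ⟨hg0, hgv⟩ := hg (e.symm w) ⟨hj, hw.2⟩
  refine ⟨g (e.symm w), hg0, fun v => ?_⟩
  rw [← hs w hw v]
  exact hgv _

lemma SplitsDistinct.linear_ne_zero {T : Type*} [AddCommGroup T] [Module ℂ T] {l : Fin d → T →ₗ[ℂ] ℂ}
    (hd : 2 ≤ d) (h : ∀ i j, i ≠ j → LinearIndependent ℂ ![l i, l j]) (i : Fin d) : l i ≠ 0 := by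
  have : Nontrivial (Fin d) := Fin.nontrivial_iff_two_le.2 hd
  obtain ⟨j, hj⟩ := exists_ne i
  exact (h i j hj.symm).ne_zero 0

namespace IsLocalEquation

variable {z : ℂ × ℂ} {a : Fin (d + 1) → ℂ × ℂ → ℂ}

section roots

/-- Each linear factor `l` is non-zero on the vertical vector because `a 0 z ≠ 0`, so its kernel has
the slope `-l(1,0) / l(0,1)`; independence of the factors makes these slopes distinct. -/
lemma exists_roots (he : e ∈ Coord M) (h : IsLocalEquation W e z a) (h0 : a 0 z ≠ 0)
    (hz : e.symm z ∉ discriminant W) :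
    ∃ p : Fin d → ℂ, Function.Injective p ∧ ∀ j, slopePoly a z (p j) = 0 := by
  obtain ⟨i, hi⟩ := exists_index W (e.symm z)
  have hs : SplitsDistinct d (W.form i (e.symm z)) := by
    by_contra hs
    exact hz ⟨i, hi, hs⟩
  obtain ⟨l, hl, hprod⟩ := hs
  obtain ⟨c, hc, hv⟩ := h.eventually_eq.self_of_nhds i hi
  let A : ℂ × ℂ →ₗ[ℂ] TangentSpace I₂ (e.symm z) := (mfderiv I₂ I₂ e.symm z).toLinearMap
  have hA : Function.Surjective A :=
    (mdifferentiable_coord he).symm.mfderiv_surjective (x := z) (by simpa using h.mem_target)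
  have hform : ∀ v, c * symForm a z v = ∏ j, l j (A v) := fun v => by
    rw [← hv v, ← hprod]; rfl
  have hlin : ∀ j (v : ℂ × ℂ), l j (A v) = v.1 * l j (A (1, 0)) + v.2 * l j (A (0, 1)) := by
    intro j v
    have : v = v.1 • ((1, 0) : ℂ × ℂ) + v.2 • ((0, 1) : ℂ × ℂ) := by ext <;> simp
    conv_lhs => rw [this]
    simp only [map_add, map_smul, smul_eq_mul]
  have hβ : ∀ j, l j (A (0, 1)) ≠ 0 := by
    intro j hj
    have := hform (0, 1)
    rw [symForm_vertical, Finset.prod_eq_zero (Finset.mem_univ j) hj] at this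
    exact (mul_ne_zero hc h0) this
  refine ⟨fun j => -l j (A (1, 0)) / l j (A (0, 1)), fun j k hjk => ?_, fun j => ?_⟩
  · by_contra hne
    have hb := hβ j
    have hb' := hβ k
    simp only at hjk
    rw [div_eq_div_iff hb hb'] at hjk
    have hli := hl j k hne
    rw [LinearIndependent.pair_iff] at hli
    refine hβ k (hli (l k (A (0, 1))) (-l j (A (0, 1))) ?_).1
    ext u
    obtain ⟨v, rfl⟩ := hA u
    simp only [LinearMap.add_apply, LinearMap.smul_apply, smul_eq_mul, LinearMap.zero_apply]
    rw [hlin j v, hlin k v]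
    linear_combination -v.1 * hjk
  · have hb := hβ j
    have := hform (1, -l j (A (1, 0)) / l j (A (0, 1)))
    rw [symForm_one, Finset.prod_eq_zero (Finset.mem_univ j) ?_] at this
    · exact (mul_eq_zero.1 this).resolve_left hc
    · rw [hlin]; field_simp; ring

lemma symForm_eq_prod {p : Fin d → ℂ} (hp : Function.Injective p)
    (h : ∀ j, slopePoly a z (p j) = 0) (v : ℂ × ℂ) :
    symForm a z v = a 0 z * ∏ j, (v.2 - p j * v.1) := by
  by_cases hv : v.1 = 0
  · rw [symForm, Finset.sum_eq_single 0]
    · simp [hv]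
    · intro k _ hk
      have : (k : ℕ) ≠ 0 := fun h => hk (Fin.ext h)
      simp [hv, this]
    · simp
  · have := slopePolynomial_eq_of_roots p hp h
    rw [symForm_eq_slopePoly z v hv, ← eval_slopePolynomial, this]
    simp only [Polynomial.eval_mul, Polynomial.eval_C, Polynomial.eval_prod, Polynomial.eval_sub,
      Polynomial.eval_X]
    rw [mul_left_comm]
    congr 1
    have : v.1 ^ d = ∏ _j : Fin d, v.1 := by simp
    rw [this, ← Finset.prod_mul_distrib]
    refine Finset.prod_congr rfl fun j _ => ?_
    field_simp

lemma notMem_discriminant (he : e ∈ Coord M) (hd : d ≠ 0) (h : IsLocalEquation W e z a)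
    (h0 : a 0 z ≠ 0) {p : Fin d → ℂ} (hp : Function.Injective p)
    (hr : ∀ j, slopePoly a z (p j) = 0) : e.symm z ∉ discriminant W := by
  rintro ⟨i, hi, hs⟩
  refine hs ?_
  obtain ⟨c, hc, hv⟩ := h.eventually_eq.self_of_nhds i hi
  -- A `d`-th root of the scalar, absorbed equally by the `d` linear factors.
  obtain ⟨κ, hκ⟩ := IsAlgClosed.exists_pow_nat_eq (c * a 0 z) (Nat.pos_of_ne_zero hd)
  have hκ0 : κ ≠ 0 := by
    rintro rfl
    rw [zero_pow hd] at hκ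
    exact mul_ne_zero hc h0 hκ.symm
  have hzs : z ∈ e.symm.source := by simpa using h.mem_target
  let A' := (mdifferentiable_coord he).symm.mfderiv hzs
  let A : ℂ × ℂ →ₗ[ℂ] TangentSpace I₂ (e.symm z) := A'.toLinearEquiv.toLinearMap
  let B : TangentSpace I₂ (e.symm z) →ₗ[ℂ] ℂ × ℂ := A'.symm.toLinearEquiv.toLinearMap
  have hBA : ∀ u, A (B u) = u := fun u => A'.apply_symm_apply u
  have hAB : ∀ v, B (A v) = v := fun u => A'.symm_apply_apply u
  refine ⟨fun j => κ • (LinearMap.snd ℂ ℂ ℂ ∘ₗ B - p j • (LinearMap.fst ℂ ℂ ℂ ∘ₗ B)),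
    fun j k hjk => ?_, fun u => ?_⟩
  · rw [LinearIndependent.pair_iff]
    intro s t hst
    have h1 := LinearMap.congr_fun hst (A (0, 1))
    have h2 := LinearMap.congr_fun hst (A (1, 0))
    simp only [LinearMap.add_apply, LinearMap.smul_apply, LinearMap.sub_apply, LinearMap.comp_apply,
      hAB, LinearMap.fst_apply, LinearMap.snd_apply, smul_eq_mul, LinearMap.zero_apply] at h1 h2
    have h3 : s + t = 0 := by
      have : κ * (s + t) = 0 := by linear_combination h1
      exact (mul_eq_zero.1 this).resolve_left hκ0
    have h4 : s * p j + t * p k = 0 := by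
      have : κ * (s * p j + t * p k) = 0 := by linear_combination -h2
      exact (mul_eq_zero.1 this).resolve_left hκ0
    have h5 : s * (p j - p k) = 0 := by linear_combination h4 - p k * h3
    have h6 : s = 0 := (mul_eq_zero.1 h5).resolve_right (sub_ne_zero.2 fun h' => hjk (hp h'))
    exact ⟨h6, by rw [h6, zero_add] at h3; exact h3⟩
  · have h1 := hv (B u)
    have h2 : inCoord e (W.form i) z (B u) = W.form i (e.symm z) u :=
      congrArg (W.form i (e.symm z)) (hBA u)
    rw [h2, symForm_eq_prod hp hr, ← mul_assoc, ← hκ] at h1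
    rw [h1]
    simp only [LinearMap.smul_apply, LinearMap.sub_apply, LinearMap.comp_apply,
      LinearMap.fst_apply, LinearMap.snd_apply, smul_eq_mul]
    rw [Finset.prod_mul_distrib]
    simp

lemma exists_isRootSystem (he : e ∈ Coord M) (h : IsLocalEquation W e z a) (h0 : a 0 z ≠ 0)
    (hz : e.symm z ∉ discriminant W) : ∃ V p, z ∈ V ∧ IsRootSystem a V p ∧
      ∀ w ∈ V, IsLocalEquation W e w a := by
  obtain ⟨p, hp, hr⟩ := h.exists_roots he h0 hz
  obtain ⟨V, q, hzV, hV, -⟩ := PlanarWeb.exists_isRootSystem h.analyticAt h0 p hp hr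
  obtain ⟨U, hU, hUo, hzU⟩ := _root_.eventually_nhds_iff.1 h.eventually
  refine ⟨V ∩ U, q, ⟨hzV, hzU⟩, ⟨hV.isOpen.inter hUo, fun j w hw => hV.analytic j w hw.1,
    fun k w hw => hV.coeff k w hw.1, fun w hw => hV.injective w hw.1, fun w hw => hV.lead w hw.1,
    fun w hw => hV.eq_prod w hw.1⟩, fun w hw => hU w hw.2⟩

/-- Near a point off the discriminant, there is a curvature, given by the sum over the roots. -/
lemma exists_isCurvatureAt (he : e ∈ Coord M) (h : IsLocalEquation W e z a) (h0 : a 0 z ≠ 0)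
    (hz : e.symm z ∉ discriminant W) : ∃ k, IsCurvatureAt W e z k := by
  obtain ⟨V, p, hzV, hV, hloc⟩ := h.exists_isRootSystem he h0 hz
  set θ : Fin d → ℂ × ℂ → ℂ × ℂ := fun j w => (-p j w, 1) with hθ
  have hθa : ∀ j, AnalyticOnNhd ℂ (θ j) V := fun j w hw => (hV.analytic j w hw).neg.prod analyticAt_const
  have hw : ∀ w ∈ V, ∀ j k, j ≠ k → wedge (θ j w) (θ k w) ≠ 0 := fun w hw j k hjk h' => by
    refine hjk (hV.injective w hw ?_)
    simp only [hθ, wedge] at h'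
    simp only
    linear_combination -h'
  obtain ⟨η, hη⟩ := exists_isFundamentalForm hθa hw
  refine ⟨_, V, θ, η, hzV, ⟨hV.isOpen, fun w hw => (hloc w hw).mem_target, hθa, hw, ?_⟩, hη, rfl⟩
  intro i w hwV hi
  obtain ⟨c, hc, hv⟩ := (hloc w hwV).eventually_eq.self_of_nhds i hi
  refine ⟨c * a 0 w, mul_ne_zero hc (hV.lead w hwV), fun v => ?_⟩
  rw [hv, symForm_eq_prod (hV.injective w hwV) (hV.slopePoly_root hwV), mul_assoc]
  congr 2
  refine Finset.prod_congr rfl fun j _ => ?_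
  simp only [evalForm, hθ]; ring

/-- The slopes of any decomposition form a root system of the same `a`, so the value depends on the
web only. This is what makes the choice in `curvature` harmless. -/
lemma isCurvatureAt_eq (h : IsLocalEquation W e z a) (h0 : a 0 z ≠ 0) {k : ℂ}
    (hk : IsCurvatureAt W e z k) : k = extD (rootForm a) z := by
  obtain ⟨V, θ, η, hzV, ⟨hVo, hVt, hθ, hw, hdec⟩, hη, rfl⟩ := hk
  have hev : ∀ᶠ w in 𝓝 z, w ∈ V ∧ IsLocalEquation W e w a ∧ a 0 w ≠ 0 :=
    Filter.Eventually.and (hVo.mem_nhds hzV) (h.eventually.and ((h.analyticAt 0).continuousAt.eventually_ne h0))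
  obtain ⟨U, hU, hUo, hzU⟩ := _root_.eventually_nhds_iff.1 hev
  have hsub : ∀ w ∈ U, w ∈ V := fun w hw => (hU w hw).1
  obtain ⟨h2, hR⟩ := exists_isRootSystem_of_decomposition (a := a) hUo
    (fun k w hw => (hU w hw).2.1.analyticAt k) (fun w hw => (hU w hw).2.2)
    (fun j w hw => hθ j w (hsub w hw)) (fun w hw' => hw w (hsub w hw')) (by
      intro w hw'
      obtain ⟨i, hi⟩ := exists_index W (e.symm w)
      obtain ⟨c, hc, hv⟩ := (hU w hw').2.1.eventually_eq.self_of_nhds i hi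
      obtain ⟨c', hc', hv'⟩ := hdec i w (hsub w hw') hi
      refine ⟨c⁻¹ * c', fun v => ?_⟩
      rw [mul_assoc, ← hv', hv, inv_mul_cancel_left₀ hc])
  refine hR.extD_fundamentalForm (f := fun j w => (θ j w).2) (θ := θ)
    (fun j w hw => analyticAt_snd.fun_comp (hθ j w (hsub w hw))) h2 ?_ ?_ hzU
  · intro j w hw
    have := h2 j w hw
    ext
    · simp; field_simp
    · simp
  · obtain ⟨η₃, h₃, hs⟩ := hη
    exact ⟨η₃, fun r s t hrs hst => ⟨fun w hw => (h₃ r s t hrs hst).1 w (hsub w hw),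
      fun w hw => (h₃ r s t hrs hst).2 w (hsub w hw)⟩, hs⟩

end roots

end IsLocalEquation

lemma curvature_spec {z : ℂ × ℂ} (h : ∃ k, IsCurvatureAt W e z k) :
    IsCurvatureAt W e z (curvature W e z) := by
  rw [curvature, dif_pos h]
  exact h.choose_spec

lemma IsLocalEquation.curvature_eq {z : ℂ × ℂ} {a : Fin (d + 1) → ℂ × ℂ → ℂ} (he : e ∈ Coord M)
    (h : IsLocalEquation W e z a) (h0 : a 0 z ≠ 0) (hz : e.symm z ∉ discriminant W) :
    curvature W e z = extD (rootForm a) z :=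
  h.isCurvatureAt_eq h0 (curvature_spec (h.exists_isCurvatureAt he h0 hz))

end PlanarWeb

end

/-! ### Invariance of the curvature and its extension along a component -/

noncomputable section

namespace PlanarWeb

open Filter Metric Set

variable {d : ℕ} {M : Type*} [TopologicalSpace M] {e e' : OpenPartialHomeomorph M (ℂ × ℂ)}

lemma mem_transition_source {m : M} (hm : m ∈ e.source) (hm' : m ∈ e'.source) :
    e' m ∈ (e'.symm.trans e).source ∧ e'.symm.trans e (e' m) = e m := by
  refine ⟨⟨by simpa using e'.map_source hm', ?_⟩, by simp [e'.left_inv hm']⟩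
  simpa [e'.left_inv hm'] using hm

variable [ChartedSpace (ℂ × ℂ) M] {W : Web d M}

/-- Near `m`, the curvature coincides off the discriminant with a holomorphic form. -/
def ExtendsAt (W : Web d M) (e : OpenPartialHomeomorph M (ℂ × ℂ)) (m : M) : Prop :=
  ∃ h : ℂ × ℂ → ℂ, AnalyticAt ℂ h (e m) ∧
    ∀ᶠ z in 𝓝 (e m), e.symm z ∉ discriminant W → curvature W e z = h z

lemma isOpen_setOf_extendsAt (W : Web d M) :
    IsOpen {m : M | ∃ e ∈ Coord M, m ∈ e.source ∧ ExtendsAt W e m} := by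
  rw [isOpen_iff_mem_nhds]
  rintro m ⟨e, he, hm, f, hf, hev⟩
  filter_upwards [e.open_source.mem_nhds hm,
    (e.continuousAt hm).eventually (hf.eventually_analyticAt.and hev.eventually_nhds)] with m' h1 h2
  exact ⟨e, he, h1, f, h2.1, h2.2⟩

variable [IsManifold I₂ ω M]

/-! ### The curvature off the discriminant -/

/-- The linear map `(x, y) ↦ (x + t y, y)`. -/
def shear (t : ℂ) : (ℂ × ℂ) ≃L[ℂ] ℂ × ℂ :=
  ContinuousLinearEquiv.equivOfInverse
    ((ContinuousLinearMap.fst ℂ ℂ ℂ + t • ContinuousLinearMap.snd ℂ ℂ ℂ).prod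
      (ContinuousLinearMap.snd ℂ ℂ ℂ))
    ((ContinuousLinearMap.fst ℂ ℂ ℂ - t • ContinuousLinearMap.snd ℂ ℂ ℂ).prod
      (ContinuousLinearMap.snd ℂ ℂ ℂ)) (fun v => by ext <;> simp) (fun v => by ext <;> simp)

lemma transHomeomorph_mem_coord (he : e ∈ Coord M) (L : (ℂ × ℂ) ≃L[ℂ] ℂ × ℂ) :
    e.transHomeomorph L.toHomeomorph ∈ Coord M := by
  refine (IsManifold.mem_maximalAtlas_iff_contMDiffOn (I := I₂) (n := ω) _).2 ⟨?_, ?_⟩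
  · exact L.contDiff.contMDiff.comp_contMDiffOn (contMDiffOn_of_mem_maximalAtlas he)
  · exact (contMDiffOn_symm_of_mem_maximalAtlas he).comp L.symm.contDiff.contMDiff.contMDiffOn
      fun z hz => hz

/-- Off the discriminant the form is a product of linear forms, all non-zero since `d ≥ 2` and they
are pairwise independent. Some direction `(t, 1)` is therefore tangent to no leaf, and a shear makes
it vertical. Hence every point off the discriminant can be treated by the formula in terms of
slopes. -/
lemma exists_coord_lead_ne_zero (hd : 2 ≤ d) {m : M} (hm : m ∉ discriminant W) :
    ∃ e ∈ Coord M, m ∈ e.source ∧ ∃ a, IsLocalEquation W e (e m) a ∧ a 0 (e m) ≠ 0 := by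
  set e₀ := chartAt (ℂ × ℂ) m with he₀
  have h₀ : e₀ ∈ Coord M := IsManifold.chart_mem_maximalAtlas m
  have hm₀ : m ∈ e₀.source := mem_chart_source _ m
  obtain ⟨a₀, ha₀⟩ := exists_isLocalEquation W h₀ (e₀.map_source hm₀)
  obtain ⟨i, hi⟩ := IsLocalEquation.exists_index W m
  have hs : SplitsDistinct d (W.form i m) := by
    by_contra hs
    exact hm ⟨i, hi, hs⟩
  have hi' : e₀.symm (e₀ m) ∈ W.U i := by rwa [e₀.left_inv hm₀]
  have hne : ∃ v, inCoord e₀ (W.form i) (e₀ m) v ≠ 0 := by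
    have hs' : SplitsDistinct d (W.form i (e₀.symm (e₀ m))) := by rwa [e₀.left_inv hm₀]
    obtain ⟨l, hl, hprod⟩ := hs'
    obtain ⟨u, hu⟩ := Module.Dual.exists_forall_ne_zero_of_forall_exists l fun j => by
      by_contra! hj
      exact SplitsDistinct.linear_ne_zero hd hl j (LinearMap.ext hj)
    obtain ⟨v, hv⟩ := (mdifferentiable_coord h₀).symm.mfderiv_surjective (x := e₀ m)
      (by simpa using e₀.map_source hm₀) u
    refine ⟨v, ?_⟩
    have : inCoord e₀ (W.form i) (e₀ m) v = ∏ j, l j u := by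
      rw [← hprod]
      exact congrArg (W.form i (e₀.symm (e₀ m))) hv
    rw [this]
    exact Finset.prod_ne_zero_iff.2 fun j _ => hu j
  obtain ⟨c, hc, hcv⟩ := ha₀.eventually_eq.self_of_nhds i hi'
  -- A form vanishing at every `(t, 1)` is the zero polynomial in `t`, so all its coefficients
  -- vanish.
  obtain ⟨t, ht⟩ : ∃ t : ℂ, symForm a₀ (e₀ m) (t, 1) ≠ 0 := by
    by_contra! hall
    have hP : (∑ k : Fin (d + 1), Polynomial.C (a₀ k (e₀ m)) * Polynomial.X ^ (k : ℕ)) = 0 := by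
      refine Polynomial.funext fun t => ?_
      have := hall t
      simp only [symForm, one_pow, mul_one] at this
      simpa [Polynomial.eval_finsetSum] using this
    obtain ⟨v, hv⟩ := hne
    refine hv ?_
    rw [hcv, symForm, Finset.sum_eq_zero, mul_zero]
    intro k _
    have := congrArg (fun P => Polynomial.coeff P (k : ℕ)) hP
    simp only [Polynomial.finsetSum_coeff, Polynomial.coeff_C_mul, Polynomial.coeff_X_pow,
      Polynomial.coeff_zero] at this
    rw [Finset.sum_eq_single k (fun j _ hj => by
      rw [if_neg (fun h => hj (Fin.ext h.symm)), mul_zero]) (by simp)] at this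
    simp at this
    simp [this]
  set e := e₀.transHomeomorph (shear t).symm.toHomeomorph with hedef
  have he : e ∈ Coord M := transHomeomorph_mem_coord h₀ (shear t).symm
  have hme : m ∈ e.source := hm₀
  obtain ⟨a, ha⟩ := exists_isLocalEquation W he (e.map_source hme)
  refine ⟨e, he, hme, a, ha, fun h0 => ?_⟩
  have hz : e m ∈ (e.symm.trans e₀).source := by
    refine ⟨by simpa using e.map_source hme, ?_⟩
    simpa [e.left_inv hme] using hm₀
  have hT : (e.symm.trans e₀ : ℂ × ℂ → ℂ × ℂ) =ᶠ[𝓝 (e m)] shear t := by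
    filter_upwards [(e.symm.trans e₀).open_source.mem_nhds hz] with w hw
    have hw1 : w ∈ e.target := by simpa using hw.1
    have hw2 : shear t w ∈ e₀.target := hw1
    change e₀ (e₀.symm (shear t w)) = shear t w
    exact e₀.right_inv hw2
  have hTm : (e.symm.trans e₀) (e m) = e₀ m := by simp [e.left_inv hme]
  obtain ⟨c', hc', hcv'⟩ := ha.eventually_eq.self_of_nhds i (by rwa [e.left_inv hme])
  have h1 := inCoord_transition h₀ he hz (W.form i) (0, 1)
  rw [hcv', symForm_vertical, h0, mul_zero, hTm, hcv, hT.fderiv_eq] at h1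
  have h2 : fderiv ℂ (shear t) (e m) (0, 1) = (t, 1) := by
    rw [ContinuousLinearEquiv.fderiv]
    ext <;> simp [shear]
  rw [h2] at h1
  exact mul_ne_zero hc ht h1.symm

lemma isClosed_discriminant (hd : 2 ≤ d) (W : Web d M) : IsClosed (discriminant W) := by
  rw [← isOpen_compl_iff, isOpen_iff_mem_nhds]
  intro m hm
  obtain ⟨e, he, hme, a, ha, h0⟩ := exists_coord_lead_ne_zero hd hm
  obtain ⟨V, p, hzV, hV, hloc⟩ := ha.exists_isRootSystem he h0 (by rwa [e.left_inv hme])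
  have : ∀ᶠ m' in 𝓝 m, m' ∈ e.source ∧ e m' ∈ V :=
    Filter.Eventually.and (e.open_source.mem_nhds hme)
      ((e.continuousAt hme).eventually (hV.isOpen.mem_nhds hzV))
  filter_upwards [this] with m' hm'
  have := (hloc _ hm'.2).notMem_discriminant he (by omega) (hV.lead _ hm'.2)
    (hV.injective _ hm'.2) (hV.slopePoly_root hm'.2)
  rwa [e.left_inv hm'.1] at this

lemma exists_isCurvatureAt (hd : 2 ≤ d) (he : e ∈ Coord M) {z : ℂ × ℂ} (hz : z ∈ e.target)
    (hzd : e.symm z ∉ discriminant W) : ∃ k, IsCurvatureAt W e z k := by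
  obtain ⟨e₁, he₁, hm₁, a, ha, h0⟩ := exists_coord_lead_ne_zero hd hzd
  obtain ⟨k, hk⟩ := ha.exists_isCurvatureAt he₁ h0 (by rwa [e₁.left_inv hm₁])
  obtain ⟨h1, h2⟩ := mem_transition_source hm₁ (e.map_target hz)
  rw [e.right_inv hz] at h1 h2
  rw [← h2] at hk
  exact ⟨_, hk.transition he₁ he h1⟩

lemma isCurvatureAt_unique (hd : 2 ≤ d) (he : e ∈ Coord M) {z : ℂ × ℂ} (hz : z ∈ e.target)
    (hzd : e.symm z ∉ discriminant W) {k k' : ℂ} (hk : IsCurvatureAt W e z k)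
    (hk' : IsCurvatureAt W e z k') : k = k' := by
  obtain ⟨e₁, he₁, hm₁, a, ha, h0⟩ := exists_coord_lead_ne_zero hd hzd
  obtain ⟨h1, h2⟩ := mem_transition_source (e.map_target hz) hm₁
  rw [e.right_inv hz] at h2
  rw [← h2] at hk hk'
  have e1 := ha.isCurvatureAt_eq h0 (hk.transition he he₁ h1)
  have e2 := ha.isCurvatureAt_eq h0 (hk'.transition he he₁ h1)
  exact mul_left_cancel₀ (jac_transition_ne_zero he he₁ h1) (e1.trans e2.symm)

lemma curvature_transition (hd : 2 ≤ d) (he : e ∈ Coord M) (he' : e' ∈ Coord M) {z : ℂ × ℂ}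
    (hz : z ∈ (e'.symm.trans e).source) (hzd : e'.symm z ∉ discriminant W) :
    curvature W e' z = jac (e'.symm.trans e) z * curvature W e (e'.symm.trans e z) := by
  have hz1 : z ∈ e'.target := by simpa using hz.1
  have hz2 : e'.symm z ∈ e.source := by simpa using hz.2
  have ht : e'.symm.trans e z ∈ e.target := by simpa using e.map_source hz2
  refine isCurvatureAt_unique hd he' hz1 hzd
    (curvature_spec (exists_isCurvatureAt hd he' hz1 hzd)) ?_
  refine (curvature_spec (exists_isCurvatureAt hd he ht ?_)).transition he he' hz
  simpa [e.left_inv hz2] using hzd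

lemma analyticAt_curvature (hd : 2 ≤ d) (he : e ∈ Coord M) {z : ℂ × ℂ} (hz : z ∈ e.target)
    (hzd : e.symm z ∉ discriminant W) : AnalyticAt ℂ (curvature W e) z := by
  obtain ⟨e₁, he₁, hm₁, a, ha, h0⟩ := exists_coord_lead_ne_zero hd hzd
  obtain ⟨h1, h2⟩ := mem_transition_source hm₁ (e.map_target hz)
  rw [e.right_inv hz] at h1 h2
  set T := e.symm.trans e₁ with hT
  rw [← h2] at ha h0
  have hT1 : e₁.symm (T z) = e.symm z := by rw [h2, e₁.left_inv hm₁]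
  obtain ⟨V, p, hzV, hV, -⟩ := ha.exists_isRootSystem he₁ h0 (by rwa [hT1])
  have hTa := analyticAt_transition he₁ he h1
  have han : AnalyticAt ℂ (fun w => jac T w * extD (rootForm a) (T w)) z :=
    (analyticAt_jac hTa).mul ((analyticAt_extD (hV.analyticAt_rootForm hzV)).fun_comp hTa)
  refine han.congr ?_
  have hd' : ∀ᶠ w in 𝓝 z, e.symm w ∉ discriminant W :=
    (e.continuousAt_symm hz).eventually ((isClosed_discriminant hd W).isOpen_compl.mem_nhds hzd)
  filter_upwards [T.open_source.mem_nhds h1, hd', hTa.continuousAt.eventually ha.eventually,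
    hTa.continuousAt.eventually ((ha.analyticAt 0).continuousAt.eventually_ne h0)] with w w1 w2 w3 w4
  rw [curvature_transition hd he₁ he w1 w2]
  have w5 : e.symm w ∈ e₁.source := by simpa using w1.2
  rw [w3.curvature_eq he₁ w4 (by simpa [hT, e₁.left_inv w5] using w2)]

/-! ### Extension of the curvature across the discriminant -/

lemma ExtendsAt.transition (hd : 2 ≤ d) (he : e ∈ Coord M) (he' : e' ∈ Coord M) {m : M}
    (hm : m ∈ e.source) (hm' : m ∈ e'.source) (h : ExtendsAt W e m) : ExtendsAt W e' m := by
  obtain ⟨f, hf, hev⟩ := h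
  obtain ⟨h1, h2⟩ := mem_transition_source hm hm'
  have hTa := analyticAt_transition he he' h1
  rw [← h2] at hf hev
  refine ⟨fun w => jac (e'.symm.trans e) w * f (e'.symm.trans e w),
    (analyticAt_jac hTa).mul (hf.fun_comp hTa), ?_⟩
  filter_upwards [(e'.symm.trans e).open_source.mem_nhds h1, hTa.continuousAt.eventually hev]
    with w w1 w2 w3
  have w5 : e'.symm w ∈ e.source := by simpa using w1.2
  rw [curvature_transition hd he he' w1 w3, w2 (by simpa [e.left_inv w5] using w3)]

lemma eventually_bounded_of_extension {K h : ℂ × ℂ → ℂ} {x₁ : ℂ} (hh : ContinuousAt h (x₁, 0))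
    (hK : ∀ᶠ z in 𝓝 ((x₁, 0) : ℂ × ℂ), z.2 ≠ 0 → K z = h z) :
    ∀ᶠ x in 𝓝 x₁, ∃ B : ℝ, ∀ᶠ y in 𝓝[≠] (0 : ℂ), ‖K (x, y)‖ ≤ B := by
  have hb : ∀ᶠ z in 𝓝 ((x₁, 0) : ℂ × ℂ), ‖h z‖ ≤ ‖h (x₁, 0)‖ + 1 :=
    (hh.norm.eventually_lt continuousAt_const (lt_add_one _)).mono fun _ => le_of_lt
  filter_upwards [(hK.and hb).curry_nhds] with x hx
  refine ⟨‖h (x₁, 0)‖ + 1, ?_⟩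
  filter_upwards [nhdsWithin_le_nhds hx, self_mem_nhdsWithin] with y hy hy0
  rw [hy.1 hy0]
  exact hy.2

/-- In a polydisc where the discriminant is `{y = 0}`, an extension at one point of the axis bounds
the curvature on nearby slices, and `exists_analytic_extension` spreads the extension to the whole
polydisc. -/
lemma exists_nhds_extendsAt (hd : 2 ≤ d) {m : M} (hm : m ∈ regularLocus (discriminant W)) :
    ∃ N, IsOpen N ∧ m ∈ N ∧ ((∃ m' ∈ N ∩ discriminant W, ∃ e ∈ Coord M, m' ∈ e.source ∧
      ExtendsAt W e m') → ∃ e ∈ Coord M, m ∈ e.source ∧ ExtendsAt W e m) := by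
  obtain ⟨hmd, e, he, hme, hAe⟩ := hm
  have hmem : ∀ m' ∈ e.source, (m' ∈ discriminant W ↔ (e m').2 = 0) := fun m' hm' => by
    have := Set.ext_iff.1 hAe m'
    simpa [hm'] using this
  have hm0 : (e m).2 = 0 := (hmem m hme).1 hmd
  obtain ⟨r, hr, hball⟩ := Metric.nhds_basis_closedBall.mem_iff.1
    (e.open_target.mem_nhds (e.map_source hme))
  have hprod : ∀ z : ℂ × ℂ, z.1 ∈ closedBall (e m).1 r → z.2 ∈ closedBall (0 : ℂ) r →
      z ∈ e.target := fun z h1 h2 => by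
    refine hball ?_
    rw [← hm0] at h2
    rw [mem_closedBall, Prod.dist_eq]
    exact max_le h1 h2
  refine ⟨e.source ∩ e ⁻¹' (ball (e m) r), e.isOpen_inter_preimage isOpen_ball,
    ⟨hme, mem_ball_self hr⟩, ?_⟩
  rintro ⟨m', ⟨⟨hm's, hm'b⟩, hm'd⟩, e', he', hm'e', hext⟩
  obtain ⟨h, hh, hev⟩ := hext.transition hd he' he hm'e' hm's
  have hm'0 : (e m').2 = 0 := (hmem m' hm's).1 hm'd
  have hpt : e m' = ((e m').1, 0) := Prod.ext rfl hm'0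
  have hoff : ∀ z ∈ e.target, z.2 ≠ 0 → e.symm z ∉ discriminant W := fun z hz hz0 hzd => by
    rw [hmem _ (e.map_target hz), e.right_inv hz] at hzd
    exact hz0 hzd
  have hx : (e m').1 ∈ ball (e m).1 r := by
    have : dist (e m') (e m) < r := hm'b
    rw [Prod.dist_eq] at this
    exact (le_max_left _ _).trans_lt this
  have hev' : ∀ᶠ z in 𝓝 (((e m').1, 0) : ℂ × ℂ), z.2 ≠ 0 → curvature W e z = h z := by
    rw [← hpt]
    filter_upwards [hev, e.open_target.mem_nhds (e.map_source hm's)] with z hz hzt hz0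
    exact hz (hoff z hzt hz0)
  have hb := eventually_bounded_of_extension (hpt ▸ hh.continuousAt) hev'
  obtain ⟨f, hf, hfe⟩ := exists_analytic_extension (K := curvature W e) (x₀ := (e m).1) hr
    (fun z h1 h2 h3 => analyticAt_curvature hd he (hprod z h1 h2) (hoff z (hprod z h1 h2) h3)) hx
    (hb.filter_mono nhdsWithin_le_nhds).frequently
  have hmb : e m ∈ ball (e m).1 r ×ˢ ball (0 : ℂ) r :=
    ⟨mem_ball_self hr, by rw [hm0]; exact mem_ball_self hr⟩
  refine ⟨e, he, hme, f, hf _ hmb, ?_⟩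
  filter_upwards [(isOpen_ball.prod isOpen_ball).mem_nhds hmb] with z hz hzd
  refine (hfe z hz fun hz0 => hzd ?_).symm
  have hzt := hprod z (ball_subset_closedBall hz.1) (ball_subset_closedBall hz.2)
  rw [hmem _ (e.map_target hzt), e.right_inv hzt, hz0]

/-- Points of extension form an open set, and by `exists_nhds_extendsAt` the others are relatively
open in the regular locus as well; the component is connected. -/
lemma extendsAt_of_mem_connectedComponentIn (hd : 2 ≤ d) {m₀ : M}
    (h : ∃ m ∈ connectedComponentIn (regularLocus (discriminant W)) m₀,
      ∃ e ∈ Coord M, m ∈ e.source ∧ ExtendsAt W e m) :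
    ∀ m ∈ connectedComponentIn (regularLocus (discriminant W)) m₀,
      ∃ e ∈ Coord M, m ∈ e.source ∧ ExtendsAt W e m := by
  set C := connectedComponentIn (regularLocus (discriminant W)) m₀ with hC
  have hCs : C ⊆ regularLocus (discriminant W) := connectedComponentIn_subset _ _
  set G : Set M := {m : M | ∃ e ∈ Coord M, m ∈ e.source ∧ ExtendsAt W e m} with hG
  set G' : Set M := {m : M | ∃ N, IsOpen N ∧ m ∈ N ∧ ∀ m' ∈ N ∩ discriminant W, m' ∉ G} with hG'
  have hG'o : IsOpen G' := by
    rw [isOpen_iff_mem_nhds]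
    rintro m ⟨N, hN, hmN, hNG⟩
    filter_upwards [hN.mem_nhds hmN] with m' hm'
    exact ⟨N, hN, hm', hNG⟩
  have hcov : C ⊆ G ∪ G' := by
    intro m hm
    by_cases hmG : m ∈ G
    · exact Or.inl hmG
    · obtain ⟨N, hN, hmN, himp⟩ := exists_nhds_extendsAt hd (hCs hm)
      refine Or.inr ⟨N, hN, hmN, fun m' hm' hm'G => hmG (himp ⟨m', hm', hm'G⟩)⟩
  intro m hm
  by_contra hmG
  obtain ⟨m₁, hm₁, hm₁G⟩ := h
  obtain ⟨m₂, hm₂, hm₂G, N, -, hm₂N, hN⟩ := isPreconnected_connectedComponentIn (F := regularLocus (discriminant W))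
    (x := m₀) G G' (isOpen_setOf_extendsAt W) hG'o hcov ⟨m₁, hm₁, hm₁G⟩
    ⟨m, hm, (hcov hm).resolve_left hmG⟩
  exact hN m₂ ⟨hm₂N, (hCs hm₂).1⟩ hm₂G

/-- It is enough to extend the curvature at one point of an irreducible component. -/
theorem curvatureHolomorphicOn_of_extendsAt (hd : 2 ≤ d) {D : Set M}
    (hD : IsIrreducibleComponent (discriminant W) D) {m : M} (hm : m ∈ D) (he : e ∈ Coord M)
    (hme : m ∈ e.source) (h : ExtendsAt W e m) : CurvatureHolomorphicOn W D := by
  obtain ⟨m₀, hm₀, rfl⟩ := hD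
  have hG := isOpen_setOf_extendsAt W
  -- `D` is only the closure of a component of the regular locus, so `m` may lie outside it;
  -- openness of extension provides a point inside.
  obtain ⟨m₁, h1, h2⟩ := mem_closure_iff.1 hm _ hG ⟨e, he, hme, h⟩
  have hall := extendsAt_of_mem_connectedComponentIn hd ⟨m₁, h2, h1⟩
  refine ⟨_, hG, closure_mono fun m hm => ⟨subset_closure hm, hall m hm⟩, ?_⟩
  rintro m ⟨-, e₁, he₁, hm₁, hext⟩ e₂ he₂ hm₂
  exact hext.transition hd he₁ he₂ hm₁ hm₂

end PlanarWeb

end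

noncomputable section

namespace PlanarWeb

open Filter Metric Set

/-! ### Smooth hypersurfaces and their equations -/

section smooth

variable {E : Type*} [NormedAddCommGroup E] [NormedSpace ℂ E]

/-- The maximum principle for `1 / k`, where `k l = h l / l` has no zero in the disc and takes the
value `h'(0)` at the centre; on the circle `|1 / k| ≤ r / c`. -/
lemma norm_deriv_ge_of_forall_ne_zero {h : ℂ → ℂ} {r c : ℝ} (hr : 0 < r)
    (hh : DifferentiableOn ℂ h (closedBall 0 r))
    (hd : deriv h 0 ≠ 0) (h0 : h 0 = 0) (hne : ∀ l ∈ closedBall (0 : ℂ) r, l ≠ 0 → h l ≠ 0)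
    (hc : 0 < c) (hlow : ∀ l ∈ sphere (0 : ℂ) r, c ≤ ‖h l‖) : c ≤ r * ‖deriv h 0‖ := by
  set k := dslope h 0 with hk
  have hmem : closedBall (0 : ℂ) r ∈ 𝓝 (0 : ℂ) := closedBall_mem_nhds 0 hr
  have hkd : DifferentiableOn ℂ k (closedBall 0 r) :=
    (Complex.differentiableOn_dslope hmem).2 hh
  have hk0 : k 0 = deriv h 0 := dslope_same h 0
  have hkl : ∀ l, l ≠ 0 → k l = h l / l := fun l hl => by
    rw [hk, dslope_of_ne _ hl, slope_def_field, h0]; simp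
  have hkne : ∀ l ∈ closedBall (0 : ℂ) r, k l ≠ 0 := fun l hl => by
    by_cases h' : l = 0
    · rw [h', hk0]; exact hd
    · rw [hkl l h']; exact div_ne_zero (hne l hl h') h'
  have hdiff : DiffContOnCl ℂ (fun l => (k l)⁻¹) (ball 0 r) := by
    refine DifferentiableOn.diffContOnCl ?_
    rw [closure_ball _ hr.ne']
    exact hkd.inv hkne
  have := Complex.norm_le_of_forall_mem_frontier_norm_le (C := r / c) isBounded_ball hdiff
    (fun l hl => ?_) (subset_closure (mem_ball_self hr))
  · rw [hk0, norm_inv, inv_le_comm₀ (norm_pos_iff.2 hd) (div_pos hr hc), inv_div,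
      div_le_iff₀ hr] at this
    linarith
  · rw [frontier_ball _ hr.ne'] at hl
    have hn : ‖l‖ = r := by simpa using hl
    have hl0 : l ≠ 0 := by rw [← norm_pos_iff, hn]; exact hr
    rw [norm_inv, hkl l hl0, norm_div, hn, inv_div]
    exact div_le_div_of_nonneg_left hr.le hc (hlow l hl)

/-- Near `s₀`, each line in the direction `v` meets the zero set of `g`, hence that of `F`, at most
once. If `F s = 0` and the derivative along `v` at `s` were non-zero, `F` would have on the line a
single simple zero, and `norm_deriv_ge_of_forall_ne_zero` would bound this derivative below by a
constant uniform in `s`. It is however close to its value `0` at `s₀`. -/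
lemma fderiv_apply_eq_zero_of_transverse {F g : E → ℂ} {s₀ v : E} (hF : AnalyticAt ℂ F s₀)
    (hg : AnalyticAt ℂ g s₀) (h : ∀ᶠ u in 𝓝 s₀, F u = 0 ↔ g u = 0) (hv : fderiv ℂ g s₀ v ≠ 0)
    (h0 : F s₀ = 0) (hF' : fderiv ℂ F s₀ v = 0) :
    ∀ᶠ s in 𝓝 s₀, F s = 0 → fderiv ℂ F s v = 0 := by
  have hstrict := hg.hasStrictFDerivAt
  set L := fderiv ℂ g s₀ with hL
  have hvn : v ≠ 0 := fun h' => hv (by rw [h', map_zero])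
  have hvpos : 0 < ‖v‖ := norm_pos_iff.2 hvn
  -- With this error `g (s + l • v) - g s` has norm at least `‖l‖ ‖L v‖ / 2`, so `g` is injective on
  -- short segments in the direction `v`.
  have hε : 0 < ‖L v‖ / (2 * ‖v‖) := div_pos (norm_pos_iff.2 hv) (by positivity)
  have h1 := (Asymptotics.isLittleO_iff.1 hstrict.isLittleO hε)
  obtain ⟨ρ, hρ, hball⟩ : ∃ ρ > 0, ∀ u ∈ ball s₀ ρ, ∀ w ∈ ball s₀ ρ,
      ‖g u - g w - L (u - w)‖ ≤ ‖L v‖ / (2 * ‖v‖) * ‖u - w‖ ∧ (F u = 0 ↔ g u = 0) ∧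
        AnalyticAt ℂ F u := by
    rw [nhds_prod_eq] at h1
    obtain ⟨t, ht, h1⟩ := eventually_prod_self_iff (r := fun x y => ‖g x - g y - L (x - y)‖ ≤ ‖L v‖ / (2 * ‖v‖) * ‖x - y‖) |>.1 h1
    obtain ⟨ρ, hρ, hsub⟩ := Metric.eventually_nhds_iff_ball.1
      (Filter.Eventually.and ht (h.and hF.eventually_analyticAt))
    exact ⟨ρ, hρ, fun u hu w hw => ⟨h1 u (hsub u hu).1 w (hsub w hw).1, (hsub u hu).2⟩⟩
  set r := ρ / (2 * ‖v‖) / 2 with hr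
  have hrpos : 0 < r := by positivity
  have hmem : ∀ s ∈ ball s₀ (ρ / 2), ∀ l ∈ closedBall (0 : ℂ) r, s + l • v ∈ ball s₀ ρ := by
    intro s hs l hl
    have hl' : ‖l‖ ≤ r := by simpa using hl
    have h2 : ‖l • v‖ ≤ ρ / 4 := by
      rw [norm_smul]
      calc ‖l‖ * ‖v‖ ≤ r * ‖v‖ := by gcongr
        _ = ρ / 4 := by rw [hr]; field_simp; ring
    rw [mem_ball, dist_eq_norm] at hs ⊢
    calc ‖s + l • v - s₀‖ = ‖(s - s₀) + l • v‖ := by congr 1; abel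
      _ ≤ ‖s - s₀‖ + ‖l • v‖ := norm_add_le _ _
      _ < ρ := by linarith
  have hne : ∀ s ∈ ball s₀ (ρ / 2), F s = 0 → ∀ l ∈ closedBall (0 : ℂ) r, l ≠ 0 →
      F (s + l • v) ≠ 0 := by
    intro s hs hFs l hl hl0 hF0
    have hs' : s ∈ ball s₀ ρ := ball_subset_ball (by linarith) hs
    obtain ⟨e1, e2, -⟩ := hball _ (hmem s hs l hl) s hs'
    rw [e2.1 hF0, ((hball s hs' s hs').2.1).1 hFs, add_sub_cancel_left, sub_zero, zero_sub,
      norm_neg, map_smul, norm_smul, norm_smul] at e1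
    have hlp : 0 < ‖l‖ := norm_pos_iff.2 hl0
    have hLp : 0 < ‖L v‖ := norm_pos_iff.2 hv
    have e3 : ‖L v‖ / (2 * ‖v‖) * (‖l‖ * ‖v‖) = ‖l‖ * ‖L v‖ / 2 := by field_simp
    rw [e3] at e1
    nlinarith [mul_pos hlp hLp]
  have hs₀ : s₀ ∈ ball s₀ (ρ / 2) := mem_ball_self (by positivity)
  -- a lower bound on the circle of radius `r`, uniform in the base point
  obtain ⟨c, hc, hlow⟩ : ∃ c > 0, ∀ l ∈ sphere (0 : ℂ) r, c < ‖F (s₀ + l • v)‖ := by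
    have hcont : ContinuousOn (fun l : ℂ => ‖F (s₀ + l • v)‖) (sphere 0 r) := fun l hl => by
      have := (hball _ (hmem s₀ hs₀ l (sphere_subset_closedBall hl)) s₀
        (mem_ball_self hρ)).2.2.continuousAt
      exact (ContinuousAt.comp (f := fun l : ℂ => s₀ + l • v) this
        (by fun_prop)).norm.continuousWithinAt
    obtain ⟨l₁, hl₁, hmin⟩ := (isCompact_sphere (0 : ℂ) r).exists_isMinOn
      (NormedSpace.sphere_nonempty.2 hrpos.le) hcont
    have hl₁0 : l₁ ≠ 0 := by
      rintro rfl
      simp [hrpos.ne] at hl₁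
    have hp : 0 < ‖F (s₀ + l₁ • v)‖ :=
      norm_pos_iff.2 (hne s₀ hs₀ h0 l₁ (sphere_subset_closedBall hl₁) hl₁0)
    exact ⟨_, half_pos hp, fun l hl => (half_lt_self hp).trans_le (hmin hl)⟩
  have hunif : ∀ᶠ s in 𝓝 s₀, ∀ l ∈ sphere (0 : ℂ) r, c < ‖F (s + l • v)‖ := by
    refine (isCompact_sphere (0 : ℂ) r).eventually_forall_of_forall_eventually fun l hl => ?_
    have hca := (hball _ (hmem s₀ hs₀ l (sphere_subset_closedBall hl)) s₀
      (mem_ball_self hρ)).2.2.continuousAt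
    have : ContinuousAt (fun q : E × ℂ => ‖F (q.1 + q.2 • v)‖) (s₀, l) :=
      (ContinuousAt.comp (f := fun q : E × ℂ => q.1 + q.2 • v) (x := (s₀, l)) hca
        (by fun_prop)).norm
    exact this.eventually (lt_mem_nhds (hlow l hl))
  have hsmall : ∀ᶠ s in 𝓝 s₀, r * ‖fderiv ℂ F s v‖ < c := by
    have : ContinuousAt (fun s => r * ‖fderiv ℂ F s v‖) s₀ :=
      continuousAt_const.mul ((hF.fderiv.continuousAt.clm_apply continuousAt_const).norm)
    refine this.eventually (gt_mem_nhds ?_)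
    simpa only [hF', norm_zero, mul_zero] using hc
  filter_upwards [hunif, hsmall, ball_mem_nhds s₀ (half_pos hρ)] with s hs1 hs2 hs3 hFs
  by_contra hcon
  have hline : ∀ l ∈ closedBall (0 : ℂ) r,
      HasDerivAt (fun l : ℂ => F (s + l • v)) (fderiv ℂ F (s + l • v) v) l := fun l hl => by
    have e1 := (hball _ (hmem s hs3 l hl) s₀ (mem_ball_self hρ)).2.2.differentiableAt.hasFDerivAt
    have e2 : HasDerivAt (fun l : ℂ => s + l • v) v l := by
      simpa using ((hasDerivAt_id l).smul_const v).const_add s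
    exact e1.comp_hasDerivAt l e2
  have hd0 := (hline 0 (mem_closedBall_self hrpos.le)).deriv
  simp only [zero_smul, add_zero] at hd0
  have := norm_deriv_ge_of_forall_ne_zero (h := fun l : ℂ => F (s + l • v)) hrpos
    (fun l hl => (hline l hl).differentiableAt.differentiableWithinAt) (by rw [hd0]; exact hcon)
    (by simpa using hFs) (hne s hs3 hFs) hc (fun l hl => (hs1 l hl).le)
  rw [hd0] at this
  linarith

/-- If `F` and a submersion `g` have the same zero set near `s₀` and `F` is not a submersion
at `s₀`, then the differential of `F` vanishes along that zero set. -/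
lemma fderiv_apply_eq_zero_of_smooth {F g : E → ℂ} {s₀ : E} (hF : AnalyticAt ℂ F s₀)
    (hg : AnalyticAt ℂ g s₀) (h : ∀ᶠ u in 𝓝 s₀, F u = 0 ↔ g u = 0) (hg' : fderiv ℂ g s₀ ≠ 0)
    (h0 : F s₀ = 0) (hF' : fderiv ℂ F s₀ = 0) (w : E) :
    ∀ᶠ s in 𝓝 s₀, F s = 0 → fderiv ℂ F s w = 0 := by
  have key : ∀ v, fderiv ℂ g s₀ v ≠ 0 → ∀ᶠ s in 𝓝 s₀, F s = 0 → fderiv ℂ F s v = 0 :=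
    fun v hv => fderiv_apply_eq_zero_of_transverse hF hg h hv h0 (by rw [hF']; rfl)
  -- A tangent direction `w` is the difference of the transverse directions `v + w` and `v`.
  by_cases hw : fderiv ℂ g s₀ w = 0
  · obtain ⟨v, hv⟩ : ∃ v, fderiv ℂ g s₀ v ≠ 0 := by
      by_contra! hcon
      exact hg' (ContinuousLinearMap.ext hcon)
    filter_upwards [key v hv, key (v + w) (by rwa [map_add, hw, add_zero])] with s h1 h2 hs
    have := h2 hs
    rwa [map_add, h1 hs, zero_add] at this
  · exact key w hw

end smooth

/-! ### The characteristic surface near a point of finite slope -/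

variable {d : ℕ} {M : Type*} [TopologicalSpace M] [ChartedSpace (ℂ × ℂ) M]
  {e : OpenPartialHomeomorph M (ℂ × ℂ)} {W : Web d M}

lemma SplitsDistinct.const_mul (hd : d ≠ 0) {T : Type*} [AddCommGroup T] [Module ℂ T] {f g : T → ℂ}
    {c : ℂ} (hc : c ≠ 0) (hf : SplitsDistinct d f) (hg : ∀ v, g v = c * f v) :
    SplitsDistinct d g := by
  obtain ⟨l, hl, hp⟩ := hf
  obtain ⟨b, hb⟩ := IsAlgClosed.exists_pow_nat_eq c (Nat.pos_of_ne_zero hd)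
  have hb0 : b ≠ 0 := by
    rintro rfl
    rw [zero_pow hd] at hb
    exact hc hb.symm
  refine ⟨fun i => b • l i, fun i j hij => ?_, fun v => ?_⟩
  · have := hl i j hij
    rw [LinearIndependent.pair_iff] at this ⊢
    intro s t hst
    obtain ⟨h1, h2⟩ := this (s * b) (t * b) (by simpa [smul_smul] using hst)
    exact ⟨(mul_eq_zero.1 h1).resolve_right hb0, (mul_eq_zero.1 h2).resolve_right hb0⟩
  · rw [hg, hp, ← hb]
    simp [Finset.prod_mul_distrib]

lemma dense_compl_discriminant (hd : d ≠ 0) (W : Web d M) : Dense (discriminant W)ᶜ := by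
  intro m
  obtain ⟨i, hi⟩ := IsLocalEquation.exists_index W m
  refine closure_mono ?_ (W.generic_splits i hi)
  rintro m' ⟨hm', hs⟩ ⟨j, hj, hns⟩
  obtain ⟨g, -, hg⟩ := W.compat j i
  exact hns (hs.const_mul hd (hg m' ⟨hj, hm'⟩).1 (hg m' ⟨hj, hm'⟩).2)

lemma frequently_notMem_discriminant (hd : d ≠ 0) {z : ℂ × ℂ} (hz : z ∈ e.target) :
    ∃ᶠ w in 𝓝 z, e.symm w ∉ discriminant W := by
  have h := mem_closure_iff_frequently.1 (dense_compl_discriminant hd W (e.symm z))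
  have := e.symm.map_nhds_eq (x := z) hz
  rw [← this] at h
  exact h

lemma symForm_slope (a : Fin (d + 1) → ℂ × ℂ → ℂ) (z : ℂ × ℂ) (t p : ℂ) :
    symForm a z (t, p * t) = t ^ d * slopePoly a z p := by
  rw [symForm, slopePoly, Finset.mul_sum]
  refine Finset.sum_congr rfl fun k _ => ?_
  have : t ^ d = t ^ (k : ℕ) * t ^ (d - (k : ℕ)) := by
    rw [← pow_add, Nat.add_sub_cancel' (Nat.lt_succ_iff.1 k.2)]
  simp only [mul_pow, this]
  ring

variable {a : Fin (d + 1) → ℂ × ℂ → ℂ}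

/-- The covector `dy - p dx` has the line of slope `p` as kernel, and the web's form on `(t, p t)`
is a non-zero multiple of `t ^ d F(x, y, p)`. -/
lemma charSurface_eq (ha : IsImplicitEquation W e a) :
    charSurface W e = closure {s | s.1 ∈ e.target ∧ e.symm s.1 ∉ discriminant W ∧
      slopePoly a s.1 s.2 = 0} ∩ {s | s.1 ∈ e.target} := by
  rw [charSurface]
  congr 2
  ext ⟨z, p⟩
  refine and_congr_right fun hz => and_congr_right fun _ => ?_
  have hin : ∀ i, e.symm z ∈ W.U i → ∃ c : ℂ, c ≠ 0 ∧ ∀ v,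
      W.form i (e.symm z) (mfderiv I₂ I₂ e.symm z v) = c * symForm a z v := fun i hi => by
    obtain ⟨g, -, hg⟩ := ha.2 i
    exact ⟨g z, hg z ⟨hz, hi⟩⟩
  constructor
  · intro h
    obtain ⟨i, hi, h0⟩ := h (1, p) (by simp [evalForm])
    obtain ⟨c, hc, hv⟩ := hin i hi
    have e1 := hv (1, p)
    rw [h0] at e1
    have e2 := symForm_slope a z 1 p
    rw [mul_one, one_pow, one_mul] at e2
    rw [e2] at e1
    exact (mul_eq_zero.1 e1.symm).resolve_left hc
  · intro h v hv
    obtain ⟨i, hi⟩ := IsLocalEquation.exists_index W (e.symm z)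
    obtain ⟨c, hc, hcv⟩ := hin i hi
    refine ⟨i, hi, ?_⟩
    have hv2 : v = (v.1, p * v.1) := by
      refine Prod.ext rfl ?_
      simp only [evalForm] at hv
      linear_combination hv
    rw [hcv v, hv2, symForm_slope, h, mul_zero, mul_zero]

lemma IsLocalEquation.slopePolynomial_eq {z : ℂ × ℂ} (he : e ∈ Coord M)
    (h : IsLocalEquation W e z a) (h0 : a 0 z ≠ 0) (hz : e.symm z ∉ discriminant W) :
    ∃ p : Fin d → ℂ, Function.Injective p ∧
      slopePolynomial a z = Polynomial.C (a 0 z) * ∏ j, (Polynomial.X - Polynomial.C (p j)) := by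
  obtain ⟨p, hp, hr⟩ := h.exists_roots he h0 hz
  exact ⟨p, hp, slopePolynomial_eq_of_roots p hp hr⟩

/-- If every root were at distance at least `ε` from `p₀`, the value at `p₀` would have norm at
least `‖a 0 z‖ ε ^ d`. -/
lemma exists_root_near {z : ℂ × ℂ} {p : Fin d → ℂ} {p₀ : ℂ} {ε : ℝ} (hε : 0 < ε)
    (h : slopePolynomial a z = Polynomial.C (a 0 z) * ∏ j, (Polynomial.X - Polynomial.C (p j)))
    (hlt : ‖slopePoly a z p₀‖ < ‖a 0 z‖ * ε ^ d) : ∃ j, dist (p j) p₀ < ε := by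
  by_contra! hcon
  rw [← eval_slopePolynomial, h] at hlt
  simp only [Polynomial.eval_mul, Polynomial.eval_C, Polynomial.eval_prod, Polynomial.eval_sub,
    Polynomial.eval_X, norm_mul, norm_prod] at hlt
  refine hlt.not_ge (mul_le_mul_of_nonneg_left ?_ (norm_nonneg _))
  calc ε ^ d = ∏ _j : Fin d, ε := by simp
    _ ≤ _ := Finset.prod_le_prod (fun _ _ => hε.le) fun j _ => by
      rw [← dist_eq_norm, dist_comm]; exact hcon j

/-- Roots vary continuously and the discriminant has dense complement, so every zero of `F` is a
limit of zeros over points off the discriminant, where the roots are simple. In particular `F` is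
reduced as an equation of its zero set. -/
lemma frequently_simple_root (hd : d ≠ 0) (he : e ∈ Coord M) (ha : IsImplicitEquation W e a)
    {s : (ℂ × ℂ) × ℂ} (hs : s.1 ∈ e.target) (h0 : a 0 s.1 ≠ 0) (hF : slopePoly a s.1 s.2 = 0) :
    ∃ᶠ u in 𝓝 s, (u.1 ∈ e.target ∧ e.symm u.1 ∉ discriminant W ∧ slopePoly a u.1 u.2 = 0) ∧
      slopeDeriv a 1 u.1 u.2 ≠ 0 := by
  rw [Metric.nhds_basis_ball.frequently_iff]
  intro ε hε
  have h0p : 0 < ‖a 0 s.1‖ := norm_pos_iff.2 h0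
  have hc0 := (ha.1 0 s.1 hs).continuousAt
  have hcF : ContinuousAt (fun z => slopePoly a z s.2) s.1 :=
    ((analyticAt_slopePoly (u := s) fun k => ha.1 k s.1 hs).continuousAt).comp
      (f := fun z : ℂ × ℂ => (z, s.2)) (x := s.1) (by fun_prop)
  have hlt : ∀ᶠ z in 𝓝 s.1, ‖slopePoly a z s.2‖ < ‖a 0 z‖ * ε ^ d := by
    refine hcF.norm.eventually_lt (hc0.norm.mul continuousAt_const) ?_
    rw [hF, norm_zero]
    positivity
  obtain ⟨z, hz, h1, h2, h3, h4⟩ := ((frequently_notMem_discriminant (W := W) hd hs).and_eventually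
    (hlt.and ((hc0.eventually_ne h0).and (Filter.Eventually.and (e.open_target.mem_nhds hs)
      (ball_mem_nhds s.1 hε))))).exists
  obtain ⟨p, hp, hprod⟩ := (ha.isLocalEquation h3).slopePolynomial_eq he h2 hz
  obtain ⟨j, hj⟩ := exists_root_near hε hprod h1
  refine ⟨(z, p j), ?_, ⟨h3, hz, ?_⟩, ?_⟩
  · rw [mem_ball, Prod.dist_eq]
    exact max_lt h4 hj
  · rw [← eval_slopePolynomial, hprod]
    simp [Polynomial.eval_prod, Finset.prod_eq_zero (Finset.mem_univ j)]
  · obtain ⟨G, hG, hG1, -⟩ := eval_derivatives_at_root (a 0 z) p hp j hprod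
    have : slopeDeriv a 1 z (p j) = G := hG1
    rw [this, hG]
    refine mul_ne_zero h2 (Finset.prod_ne_zero_iff.2 fun i hi => ?_)
    exact sub_ne_zero.2 fun h' => (Finset.ne_of_mem_erase hi) (hp h').symm

lemma mem_charSurface_iff (hd : d ≠ 0) (he : e ∈ Coord M) (ha : IsImplicitEquation W e a)
    {s : (ℂ × ℂ) × ℂ} (hs : s.1 ∈ e.target) (h0 : a 0 s.1 ≠ 0) :
    s ∈ charSurface W e ↔ slopePoly a s.1 s.2 = 0 := by
  rw [charSurface_eq ha]
  constructor
  · rintro ⟨h, -⟩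
    rw [mem_closure_iff_frequently] at h
    by_contra hne
    have := (analyticAt_slopePoly (u := s) fun k => ha.1 k s.1 hs).continuousAt.eventually_ne hne
    obtain ⟨u, hu, hu'⟩ := (h.and_eventually this).exists
    exact hu' hu.2.2
  · intro h
    exact ⟨mem_closure_iff_frequently.2
      ((frequently_simple_root hd he ha hs h0 h).mono fun u hu => hu.1), hs⟩

/-- Where the characteristic surface is smooth, its implicit equation is a submersion. -/
lemma fderiv_slopePoly_ne_zero (hd : d ≠ 0) (he : e ∈ Coord M) (ha : IsImplicitEquation W e a)
    {s : (ℂ × ℂ) × ℂ} (hs : s.1 ∈ e.target) (h0 : a 0 s.1 ≠ 0) (hF : slopePoly a s.1 s.2 = 0)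
    (hsm : IsSmoothSurfaceAt (charSurface W e) s) :
    fderiv ℂ (fun u : (ℂ × ℂ) × ℂ => slopePoly a u.1 u.2) s ≠ 0 := by
  intro hF'
  obtain ⟨g, hg, hg', hev⟩ := hsm
  have htgt : ∀ᶠ u : (ℂ × ℂ) × ℂ in 𝓝 s, u.1 ∈ e.target :=
    continuous_fst.continuousAt.eventually (e.open_target.mem_nhds hs)
  have h0' : ∀ᶠ u : (ℂ × ℂ) × ℂ in 𝓝 s, a 0 u.1 ≠ 0 :=
    ((ha.1 0 s.1 hs).continuousAt.comp continuous_fst.continuousAt).eventually_ne h0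
  have hiff : ∀ᶠ u : (ℂ × ℂ) × ℂ in 𝓝 s, slopePoly a u.1 u.2 = 0 ↔ g u = 0 := by
    filter_upwards [htgt, h0', hev] with u h1 h2 h3
    rw [← mem_charSurface_iff hd he ha h1 h2, h3]
  -- In the direction of `p` the differential is `∂ₚF`; its vanishing on the zero set contradicts
  -- `frequently_simple_root`.
  have hz := fderiv_apply_eq_zero_of_smooth
    (analyticAt_slopePoly (u := s) fun k => ha.1 k s.1 hs) hg hiff hg' hF hF' ((0, 0), 1)
  obtain ⟨u, ⟨⟨h1, -, h2⟩, h3⟩, h4⟩ :=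
    ((frequently_simple_root hd he ha hs h0 hF).and_eventually hz).exists
  have := h4 h2
  rw [fderiv_slopePoly_apply fun k => ha.1 k u.1 h1] at this
  exact h3 (by simpa using this)

end PlanarWeb

end

noncomputable section

namespace PlanarWeb

open Filter Metric Set Polynomial

/-! ### Limits along roots of unity -/

/-- Every `y` in the punctured disc of radius `δ ^ ν` is `t ^ ν` with `t` in the punctured disc of
radius `δ`. -/
lemma tendsto_of_comp_pow {ν : ℕ} (hν : ν ≠ 0) {h : ℂ → ℂ} {l : Filter ℂ}
    (hh : Tendsto (fun t => h (t ^ ν)) (𝓝[≠] 0) l) : Tendsto h (𝓝[≠] 0) l := by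
  intro s hs
  have := hh hs
  rw [mem_map, Metric.mem_nhdsWithin_iff] at this ⊢
  obtain ⟨δ, hδ, hsub⟩ := this
  refine ⟨δ ^ ν, by positivity, ?_⟩
  rintro y ⟨hy, hy0⟩
  obtain ⟨t, rfl⟩ := IsAlgClosed.exists_pow_nat_eq y (Nat.pos_of_ne_zero hν)
  refine hsub (a := t) ⟨?_, ?_⟩
  · rw [mem_ball_zero_iff, norm_pow] at hy
    exact mem_ball_zero_iff.2 (lt_of_pow_lt_pow_left₀ ν hδ.le hy)
  · rintro rfl
    exact hy0 (by simp [hν])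

/-- The terms `m 0 / (ζ ^ j t)` cancel in the sum over the conjugates, since `∑ ζ ^ (-j) = 0`; what
remains is a sum of `ν` difference quotients. This is why a ramified branch produces only a simple
pole in `y`. -/
lemma tendsto_sum_rootsOfUnity {ν : ℕ} (hν : 2 ≤ ν) {ζ : ℂ} (hζ : IsPrimitiveRoot ζ ν)
    {m : ℂ → ℂ} {m' : ℂ} (hm : HasDerivAt m m' 0) :
    Tendsto (fun t => ∑ j : Fin ν, m (ζ ^ (j : ℕ) * t) / (ζ ^ (j : ℕ) * t)) (𝓝[≠] 0)
      (𝓝 (ν * m')) := by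
  have hζ0 : ζ ≠ 0 := hζ.ne_zero (by omega)
  have hsum : ∑ j : Fin ν, (ζ ^ (j : ℕ))⁻¹ = 0 := by
    have := hζ.inv.geom_sum_eq_zero (by omega)
    rw [Finset.sum_range] at this
    simpa [inv_pow] using this
  have h1 : Tendsto (slope m 0) (𝓝[≠] 0) (𝓝 m') := hasDerivAt_iff_tendsto_slope.1 hm
  have h2 : ∀ j : Fin ν, Tendsto (fun t => ζ ^ (j : ℕ) * t) (𝓝[≠] 0) (𝓝[≠] 0) := fun j => by
    refine tendsto_nhdsWithin_iff.2 ⟨?_, ?_⟩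
    · have : Continuous fun t : ℂ => ζ ^ (j : ℕ) * t := by fun_prop
      simpa using (this.tendsto 0).mono_left nhdsWithin_le_nhds
    · filter_upwards [self_mem_nhdsWithin] with t ht
      exact mul_ne_zero (pow_ne_zero _ hζ0) ht
  have h3 : Tendsto (fun t => ∑ j : Fin ν, slope m 0 (ζ ^ (j : ℕ) * t)) (𝓝[≠] 0)
      (𝓝 (∑ _j : Fin ν, m')) := tendsto_finsetSum _ fun j _ => h1.comp (h2 j)
  simp only [Finset.sum_const, Finset.card_univ, Fintype.card_fin, nsmul_eq_mul] at h3
  refine h3.congr' ?_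
  filter_upwards [self_mem_nhdsWithin] with t ht
  have ht0 : t ≠ 0 := ht
  have h4 : ∀ j : Fin ν, m (ζ ^ (j : ℕ) * t) / (ζ ^ (j : ℕ) * t) =
      slope m 0 (ζ ^ (j : ℕ) * t) + m 0 / t * (ζ ^ (j : ℕ))⁻¹ := fun j => by
    have := pow_ne_zero (j : ℕ) hζ0
    rw [slope_def_field]
    field_simp
    ring
  rw [Finset.sum_congr rfl fun j _ => h4 j, Finset.sum_add_distrib, ← Finset.mul_sum, hsum,
    mul_zero, add_zero]

/-! ### Division by `y` -/

lemma hasDerivAt_slice {f : ℂ × ℂ → ℂ} {z : ℂ × ℂ} (hf : AnalyticAt ℂ f z) :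
    HasDerivAt (fun y => f (z.1, y)) (partialY f z) z.2 := by
  have h1 : HasDerivAt (fun y : ℂ => (z.1, y)) ((0, 1) : ℂ × ℂ) z.2 :=
    (hasDerivAt_const z.2 z.1).prodMk (hasDerivAt_id z.2)
  exact hf.differentiableAt.hasFDerivAt.comp_hasDerivAt (f := fun y : ℂ => (z.1, y)) z.2 h1

/-- The quotient `(f(x, y) - f(x, 0)) / y` has a limit on each slice, so it extends across the axis.
-/
lemma exists_divided_difference {f : ℂ × ℂ → ℂ} {x₀ : ℂ} (hf : AnalyticAt ℂ f (x₀, 0)) :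
    ∃ g : ℂ × ℂ → ℂ, AnalyticAt ℂ g (x₀, 0) ∧ partialY f (x₀, 0) = g (x₀, 0) ∧
      ∀ᶠ z in 𝓝 ((x₀, 0) : ℂ × ℂ), f z = f (z.1, 0) + z.2 * g z := by
  obtain ⟨r, hr, hball⟩ := Metric.nhds_basis_closedBall.eventually_iff.1 hf.eventually_analyticAt
  have han : ∀ z : ℂ × ℂ, z.1 ∈ closedBall x₀ r → z.2 ∈ closedBall (0 : ℂ) r → AnalyticAt ℂ f z :=
    fun z h1 h2 => hball (by rw [← closedBall_prod_same]; exact ⟨h1, h2⟩)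
  have h0 : ∀ x ∈ closedBall x₀ r, AnalyticAt ℂ f (x, 0) := fun x hx =>
    han (x, 0) hx (mem_closedBall_self hr.le)
  obtain ⟨g, hg, hgf⟩ := exists_analytic_extension (K := fun z => (f z - f (z.1, 0)) / z.2) hr
    (fun z h1 h2 h3 => ((han z h1 h2).sub ((h0 z.1 h1).fun_comp
      (f := fun z : ℂ × ℂ => (z.1, (0 : ℂ))) (analyticAt_fst.prod analyticAt_const))).div
        analyticAt_snd h3)
    (mem_ball_self hr) (by
      refine Eventually.frequently ?_
      filter_upwards [nhdsWithin_le_nhds (ball_mem_nhds x₀ hr)] with x hx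
      have h1 := hasDerivAt_iff_tendsto_slope.1
        (hasDerivAt_slice (h0 x (ball_subset_closedBall hx)))
      obtain ⟨B, hB⟩ := h1.norm.isBoundedUnder_le
      refine ⟨B, ?_⟩
      filter_upwards [hB] with y hy
      simpa [slope_def_field] using hy)
  have hmem : (x₀, (0 : ℂ)) ∈ ball x₀ r ×ˢ ball (0 : ℂ) r := ⟨mem_ball_self hr, mem_ball_self hr⟩
  have hev : ∀ᶠ z in 𝓝 ((x₀, 0) : ℂ × ℂ), f z = f (z.1, 0) + z.2 * g z := by
    filter_upwards [(isOpen_ball.prod isOpen_ball).mem_nhds hmem] with z hz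
    by_cases hz0 : z.2 = 0
    · have : (z.1, (0 : ℂ)) = z := Prod.ext rfl hz0.symm
      rw [this, hz0, zero_mul, add_zero]
    · rw [hgf z hz hz0]
      field_simp
      ring
  refine ⟨g, hg _ hmem, ?_, hev⟩
  have h1 := hasDerivAt_slice hf
  have h2 : HasDerivAt (fun y => f (x₀, 0) + y * g (x₀, y)) (g (x₀, 0)) 0 := by
    have := ((hasDerivAt_id (0 : ℂ)).mul (hasDerivAt_slice (hg _ hmem))).const_add (f (x₀, 0))
    simpa using this
  exact h1.unique (h2.congr_of_eventuallyEq hev.curry_nhds.self_of_nhds)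

/-! ### Derivatives at a root of multiplicity `ν` -/

/-- Leibniz' rule, multiplied by `s ^ m` so that the exponents `ν - m`, which would be truncated for
small `ν`, do not appear. -/
lemma pow_mul_iterate_derivative (ν : ℕ) (c s : ℂ) (U : ℂ[X]) :
    s * (derivative^[1] ((X - C c) ^ ν * U)).eval (c + s) =
      s ^ ν * (ν * U.eval (c + s) + s * (derivative U).eval (c + s)) ∧
    s ^ 2 * (derivative^[2] ((X - C c) ^ ν * U)).eval (c + s) =
      s ^ ν * (ν * (ν - 1) * U.eval (c + s) + 2 * ν * s * (derivative U).eval (c + s) +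
        s ^ 2 * (derivative (derivative U)).eval (c + s)) ∧
    s ^ 3 * (derivative^[3] ((X - C c) ^ ν * U)).eval (c + s) =
      s ^ ν * (ν * (ν - 1) * (ν - 2) * U.eval (c + s) +
        3 * ν * (ν - 1) * s * (derivative U).eval (c + s) +
        3 * ν * s ^ 2 * (derivative (derivative U)).eval (c + s) +
        s ^ 3 * (derivative (derivative (derivative U))).eval (c + s)) := by
  rcases ν with _ | _ | _ | k
  all_goals
    simp only [Function.iterate_succ, Function.iterate_zero, Function.comp_apply, id,
      derivative_mul, derivative_add, derivative_X_sub_C_pow, eval_add, eval_mul, eval_pow, eval_sub,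
      eval_X, eval_C, add_sub_cancel_left, Nat.add_sub_cancel, derivative_C, derivative_zero, eval_zero]
    push_cast
    refine ⟨by ring, by ring, by ring⟩

end PlanarWeb

end

noncomputable section

namespace PlanarWeb

open Filter Metric Set Polynomial

variable {d : ℕ}

/-! ### Contribution of a ramified branch to the fundamental form -/

/-- For fixed `x`, the equation `F(x, y, p) = (p - p₀)^ν U(p) + y G(x, y, p)` has the roots
`p = p₀ + t v(t)`, `y = t^ν`. -/
structure IsBranch (a b : Fin (d + 1) → ℂ × ℂ → ℂ) (ν : ℕ) (x p₀ : ℂ) (U : ℂ[X]) (v : ℂ → ℂ) :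
    Prop where
  two_le : 2 ≤ ν
  coeff : ∀ k, AnalyticAt ℂ (a k) (x, 0)
  coeff' : ∀ k, AnalyticAt ℂ (b k) (x, 0)
  partialY_eq : ∀ k, partialY (a k) (x, 0) = b k (x, 0)
  slopePoly_partialX : slopePoly (fun k => partialX (a k)) (x, 0) p₀ = 0
  -- For `ν ≥ 3` the mixed derivative vanishes. For `ν = 2` it need not, but it will only occur
  -- multiplied by `ν - 2`.
  slopeDeriv_partialX : ((ν : ℂ) - 2) * slopeDeriv (fun k => partialX (a k)) 1 (x, 0) p₀ = 0
  eval_ne_zero : U.eval p₀ ≠ 0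
  expansion : ∀ᶠ y in 𝓝 (0 : ℂ),
    slopePolynomial a (x, y) = (X - C p₀) ^ ν * U + C y * slopePolynomial b (x, y)
  differentiable : DifferentiableAt ℂ v 0
  ne_zero : v 0 ≠ 0
  equation : ∀ᶠ t in 𝓝 (0 : ℂ),
    v t ^ ν * U.eval (p₀ + t * v t) + slopePoly b (x, t ^ ν) (p₀ + t * v t) = 0

/-- Since `ν ≥ 2`, `y = t ^ ν` has zero derivative at `t = 0`, so only the variation of `p` is seen
to first order. -/
lemma hasDerivAt_slopeDeriv_branch {c : Fin (d + 1) → ℂ × ℂ → ℂ} {ν : ℕ} (hν : 2 ≤ ν) {x p₀ : ℂ}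
    {v : ℂ → ℂ} (hc : ∀ k, AnalyticAt ℂ (c k) (x, 0)) (hv : DifferentiableAt ℂ v 0) (m : ℕ) :
    HasDerivAt (fun t => slopeDeriv c m (x, t ^ ν) (p₀ + t * v t))
      (slopeDeriv c (m + 1) (x, 0) p₀ * v 0) 0 := by
  set F := fun u : (ℂ × ℂ) × ℂ => slopeDeriv c m u.1 u.2 with hF
  have hd : DifferentiableAt ℂ F ((x, 0), p₀) :=
    (analyticAt_slopeDeriv m (u := ((x, 0), p₀)) hc).differentiableAt
  have h1 : HasDerivAt (fun p => F ((x, 0), p)) (fderiv ℂ F ((x, 0), p₀) ((0, 0), 1)) p₀ :=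
    hd.hasFDerivAt.comp_hasDerivAt (f := fun p : ℂ => (((x, 0), p) : (ℂ × ℂ) × ℂ)) p₀
      ((hasDerivAt_const p₀ ((x, 0) : ℂ × ℂ)).prodMk (hasDerivAt_id p₀))
  have h2 := h1.unique (hasDerivAt_slopeDeriv c m (x, 0) p₀)
  have hlin : HasDerivAt (fun t => p₀ + t * v t) (v 0) 0 := by
    simpa using ((hasDerivAt_id (0 : ℂ)).mul hv.hasDerivAt).const_add p₀
  have hpow : HasDerivAt (fun t : ℂ => t ^ ν) 0 0 := by
    have := hasDerivAt_pow ν (0 : ℂ)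
    rwa [zero_pow (by omega), mul_zero] at this
  have hcurve : HasDerivAt (fun t => (((x, t ^ ν), p₀ + t * v t) : (ℂ × ℂ) × ℂ))
      ((0, 0), v 0) 0 := ((hasDerivAt_const 0 x).prodMk hpow).prodMk hlin
  have hpt : (((x, (0 : ℂ) ^ ν), p₀ + 0 * v 0) : (ℂ × ℂ) × ℂ) = ((x, 0), p₀) := by
    rw [zero_pow (by omega), zero_mul, add_zero]
  have h3 : HasDerivAt (fun t => F ((x, t ^ ν), p₀ + t * v t))
      (fderiv ℂ F ((x, 0), p₀) ((0, 0), v 0)) 0 :=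
    HasFDerivAt.comp_hasDerivAt_of_eq (f := fun t => (((x, t ^ ν), p₀ + t * v t) : (ℂ × ℂ) × ℂ)) 0
      hd.hasFDerivAt hcurve hpt.symm
  convert h3 using 1
  have : (((0, 0), v 0) : (ℂ × ℂ) × ℂ) = v 0 • (((0, 0), 1) : (ℂ × ℂ) × ℂ) := by ext <;> simp
  rw [this, map_smul, h2, smul_eq_mul, mul_comm]

namespace IsBranch

variable {a b : Fin (d + 1) → ℂ × ℂ → ℂ} {ν : ℕ} {x p₀ : ℂ} {U : ℂ[X]} {v : ℂ → ℂ}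

lemma analyticAt_partialX (h : IsBranch a b ν x p₀ U v) (k : Fin (d + 1)) :
    AnalyticAt ℂ (partialX (a k)) (x, 0) := PlanarWeb.analyticAt_partialX (h.coeff k)

lemma analyticAt_partialY (h : IsBranch a b ν x p₀ U v) (k : Fin (d + 1)) :
    AnalyticAt ℂ (partialY (a k)) (x, 0) := PlanarWeb.analyticAt_partialY (h.coeff k)

lemma slopeDeriv_partialY (h : IsBranch a b ν x p₀ U v) (m : ℕ) :
    slopeDeriv (fun k => partialY (a k)) m (x, 0) p₀ = slopeDeriv b m (x, 0) p₀ := by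
  simp only [slopeDeriv_eq_sum, h.partialY_eq]

lemma hasDerivAt_line (h : IsBranch a b ν x p₀ U v) :
    HasDerivAt (fun t => p₀ + t * v t) (v 0) 0 := by
  simpa using ((hasDerivAt_id (0 : ℂ)).mul h.differentiable.hasDerivAt).const_add p₀

lemma hasDerivAt_eval (h : IsBranch a b ν x p₀ U v) (V : ℂ[X]) :
    HasDerivAt (fun t => V.eval (p₀ + t * v t)) ((derivative V).eval p₀ * v 0) 0 := by
  have := V.hasDerivAt (p₀ + 0 * v 0)
  have h2 := HasDerivAt.comp (h := fun t => p₀ + t * v t) 0 this h.hasDerivAt_line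
  rw [zero_mul, add_zero] at h2
  exact h2

lemma hasDerivAt_accelNum (h : IsBranch a b ν x p₀ U v) :
    HasDerivAt (fun t => accelNum a (x, t ^ ν) (p₀ + t * v t))
      ((slopeDeriv (fun k => partialX (a k)) 1 (x, 0) p₀ + slopePoly b (x, 0) p₀ +
        p₀ * slopeDeriv b 1 (x, 0) p₀) * v 0) 0 := by
  have h1 := hasDerivAt_slopeDeriv_branch h.two_le (p₀ := p₀) h.analyticAt_partialX
    h.differentiable 0
  have h2 := hasDerivAt_slopeDeriv_branch h.two_le (p₀ := p₀) h.analyticAt_partialY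
    h.differentiable 0
  have h3 := h1.add (h.hasDerivAt_line.mul h2)
  simp only [slopeDeriv_zero, zero_pow (show ν ≠ 0 by have := h.two_le; omega), zero_mul, add_zero,
    zero_add] at h3
  refine h3.congr_deriv ?_
  rw [h.slopeDeriv_partialY 1, ← slopeDeriv_zero (fun k => partialY (a k)), h.slopeDeriv_partialY 0,
    slopeDeriv_zero]
  ring

lemma accelNum_zero (h : IsBranch a b ν x p₀ U v) :
    accelNum a (x, 0) p₀ = p₀ * slopePoly b (x, 0) p₀ := by
  rw [accelNum, h.slopePoly_partialX, ← slopeDeriv_zero (fun k => partialY (a k)),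
    h.slopeDeriv_partialY 0, slopeDeriv_zero, zero_add]

lemma equation_zero (h : IsBranch a b ν x p₀ U v) :
    v 0 ^ ν * U.eval p₀ + slopePoly b (x, 0) p₀ = 0 := by
  have := h.equation.self_of_nhds
  simpa [zero_pow (show ν ≠ 0 by have := h.two_le; omega)] using this

lemma deriv_equation (h : IsBranch a b ν x p₀ U v) :
    ν * v 0 ^ (ν - 1) * deriv v 0 * U.eval p₀ + v 0 ^ ν * ((derivative U).eval p₀ * v 0) +
      slopeDeriv b 1 (x, 0) p₀ * v 0 = 0 := by
  have h1 := ((h.differentiable.hasDerivAt.pow ν).mul (h.hasDerivAt_eval U)).add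
    (hasDerivAt_slopeDeriv_branch h.two_le (p₀ := p₀) h.coeff' h.differentiable 0)
  simp only [slopeDeriv_zero] at h1
  have h2 := h1.unique ((hasDerivAt_const (0 : ℂ) (0 : ℂ)).congr_of_eventuallyEq h.equation)
  simpa using h2

lemma slopeDeriv_eq (h : IsBranch a b ν x p₀ U v) (m : ℕ) : ∀ᶠ t in 𝓝 (0 : ℂ), ∀ p,
    slopeDeriv a m (x, t ^ ν) p =
      (derivative^[m] ((X - C p₀) ^ ν * U)).eval p + t ^ ν * slopeDeriv b m (x, t ^ ν) p := by
  have hc : Tendsto (fun t : ℂ => t ^ ν) (𝓝 0) (𝓝 0) := by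
    have : Continuous fun t : ℂ => t ^ ν := by fun_prop
    simpa [zero_pow (show ν ≠ 0 by have := h.two_le; omega)] using this.tendsto 0
  filter_upwards [hc.eventually h.expansion] with t ht p
  rw [slopeDeriv, ht, iterate_map_add, iterate_derivative_C_mul, eval_add, eval_mul, eval_C]
  rfl

/-- `(t v)^m ∂ₚᵐF = (t v)^ν N` along the branch, with `N` differentiable at `t = 0`. -/
lemma exists_scaled_derivs (h : IsBranch a b ν x p₀ U v) :
    ∃ N₁ N₂ N₃ : ℂ → ℂ,
      HasDerivAt N₁ (v 0 * ((ν + 1) * (derivative U).eval p₀ +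
        (v 0 ^ ν)⁻¹ * slopeDeriv b 1 (x, 0) p₀)) 0 ∧ N₁ 0 = ν * U.eval p₀ ∧
      ContinuousAt N₂ 0 ∧ N₂ 0 = ν * (ν - 1) * U.eval p₀ ∧
      HasDerivAt N₃ (v 0 * (ν * (ν - 1) * (ν + 1) * (derivative U).eval p₀)) 0 ∧
      N₃ 0 = ν * (ν - 1) * (ν - 2) * U.eval p₀ ∧
      ∀ᶠ t in 𝓝 (0 : ℂ),
        (t * v t) * slopeDeriv a 1 (x, t ^ ν) (p₀ + t * v t) = (t * v t) ^ ν * N₁ t ∧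
        (t * v t) ^ 2 * slopeDeriv a 2 (x, t ^ ν) (p₀ + t * v t) = (t * v t) ^ ν * N₂ t ∧
        (t * v t) ^ 3 * slopeDeriv a 3 (x, t ^ ν) (p₀ + t * v t) = (t * v t) ^ ν * N₃ t := by
  have hs : HasDerivAt (fun t => t * v t) (v 0) 0 := by
    simpa using (hasDerivAt_id' (0 : ℂ)).fun_mul h.differentiable.hasDerivAt
  have hκ : DifferentiableAt ℂ (fun t => (v t ^ ν)⁻¹) 0 :=
    (h.differentiable.pow ν).inv (pow_ne_zero _ h.ne_zero)
  have hE : ∀ m, HasDerivAt (fun t => slopeDeriv b m (x, t ^ ν) (p₀ + t * v t)) _ 0 := fun m =>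
    hasDerivAt_slopeDeriv_branch h.two_le (p₀ := p₀) h.coeff' h.differentiable m
  have hκE := fun m => hκ.hasDerivAt.mul (hE m)
  have hU := h.hasDerivAt_eval U
  have hU1 := h.hasDerivAt_eval (derivative U)
  have hU2 := h.hasDerivAt_eval (derivative (derivative U))
  have hU3 := h.hasDerivAt_eval (derivative (derivative (derivative U)))
  have hν0 : ν ≠ 0 := by have := h.two_le; omega
  -- With `s = t v`, `y = t ^ ν = s ^ ν (v ^ ν)⁻¹` along the branch, so the term `y G` has the
  -- common factor `s ^ ν` as well. This accounts for the summands containing `(v ^ ν)⁻¹`.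
  refine ⟨fun t => ν * U.eval (p₀ + t * v t) + (t * v t) * ((derivative U).eval (p₀ + t * v t) +
      (v t ^ ν)⁻¹ * slopeDeriv b 1 (x, t ^ ν) (p₀ + t * v t)),
    fun t => ν * (ν - 1) * U.eval (p₀ + t * v t) + (t * v t) * (2 * ν *
      (derivative U).eval (p₀ + t * v t) + (t * v t) * ((derivative (derivative U)).eval
      (p₀ + t * v t) + (v t ^ ν)⁻¹ * slopeDeriv b 2 (x, t ^ ν) (p₀ + t * v t))),
    fun t => ν * (ν - 1) * (ν - 2) * U.eval (p₀ + t * v t) + (t * v t) * (3 * ν * (ν - 1) *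
      (derivative U).eval (p₀ + t * v t) + (t * v t) * (3 * ν * (derivative (derivative U)).eval
      (p₀ + t * v t) + (t * v t) * ((derivative (derivative (derivative U))).eval (p₀ + t * v t) +
      (v t ^ ν)⁻¹ * slopeDeriv b 3 (x, t ^ ν) (p₀ + t * v t)))),
    ?_, by simp, ?_, by simp, ?_, by simp, ?_⟩
  · refine ((hU.const_mul (ν : ℂ)).add (hs.mul (hU1.add (hκE 1)))).congr_deriv ?_
    simp [hν0]
    ring
  · exact ((hU.const_mul ((ν : ℂ) * (ν - 1))).add (hs.mul ((hU1.const_mul (2 * (ν : ℂ))).add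
      (hs.mul (hU2.add (hκE 2)))))).continuousAt
  · refine ((hU.const_mul ((ν : ℂ) * (ν - 1) * (ν - 2))).add (hs.mul
      ((hU1.const_mul (3 * (ν : ℂ) * (ν - 1))).add (hs.mul ((hU2.const_mul (3 * (ν : ℂ))).add
      (hs.mul (hU3.add (hκE 3)))))))).congr_deriv ?_
    simp
    ring
  · have hvne : ∀ᶠ t in 𝓝 (0 : ℂ), v t ≠ 0 :=
      h.differentiable.continuousAt.eventually_ne h.ne_zero
    filter_upwards [hvne, h.slopeDeriv_eq 1, h.slopeDeriv_eq 2, h.slopeDeriv_eq 3]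
      with t h0 h1 h2 h3
    obtain ⟨e1, e2, e3⟩ := pow_mul_iterate_derivative ν p₀ (t * v t) U
    have hk : v t ^ ν * (v t ^ ν)⁻¹ = 1 := mul_inv_cancel₀ (pow_ne_zero _ h0)
    have hsp : (t * v t) ^ ν = t ^ ν * v t ^ ν := mul_pow _ _ _
    refine ⟨?_, ?_, ?_⟩
    · rw [h1, mul_add, e1, hsp]
      linear_combination (-(t * v t) * t ^ ν * slopeDeriv b 1 (x, t ^ ν) (p₀ + t * v t)) * hk
    · rw [h2, mul_add, e2, hsp]
      linear_combination (-(t * v t) ^ 2 * t ^ ν * slopeDeriv b 2 (x, t ^ ν) (p₀ + t * v t)) * hk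
    · rw [h3, mul_add, e3, hsp]
      linear_combination (-(t * v t) ^ 3 * t ^ ν * slopeDeriv b 3 (x, t ^ ν) (p₀ + t * v t)) * hk

end IsBranch

end PlanarWeb

end

/-! ### Residues of the terms coming from a ramified branch -/

noncomputable section

namespace PlanarWeb

open Filter Metric Set Polynomial

variable {d : ℕ}

lemma hasDerivAt_id_mul_of_continuousAt {G : ℂ → ℂ} (hG : ContinuousAt G 0) :
    HasDerivAt (fun t => t * G t) (G 0) 0 := by
  rw [hasDerivAt_iff_tendsto_slope]
  refine (hG.tendsto.mono_left nhdsWithin_le_nhds).congr' ?_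
  filter_upwards [self_mem_nhdsWithin] with t ht
  have ht0 : t ≠ 0 := ht
  rw [slope_def_field]
  field_simp
  simp

/-- The limit of `y B` on `{y = 0}`, where the fundamental form is `A dx + B dy`, in terms of
`p₀ = φ₀`, `ε = ∂ₚ∂_yF / ∂_yF` and `w = ∑ (φ₀ - φ_α)⁻¹ - ε`. -/
def residueB (ν : ℕ) (p₀ w ε : ℂ) : ℂ :=
  -(((ν : ℂ) - 1) / 6) * (ν - 2 + p₀ * (2 * (ν + 1) * w / ν + 3 * ε))

/-- The limit of `y A` on `{y = 0}`. -/
def residueA (d ν : ℕ) (p₀ w ε : ℂ) : ℂ :=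
  -p₀ * residueB ν p₀ w ε + p₀ * ((ν : ℂ) - 1) * (ν - 2 - 3 * (d - 2)) / 6

namespace IsBranch

variable {a b : Fin (d + 1) → ℂ × ℂ → ℂ} {ν : ℕ} {x p₀ : ℂ} {U : ℂ[X]} {v : ℂ → ℂ}

/-- To first order at `t = 0`, the branch is determined by `v 0` and `deriv v 0`, and both come from
the branch equation. Only the derivatives of `mA` and `mB` at `0` matter, by
`tendsto_sum_rootsOfUnity`; the powers of `v 0` drop out of them. -/
lemma exists_residues (h : IsBranch a b ν x p₀ U v) :
    ∃ mA mB : ℂ → ℂ, ∃ αA αB : ℂ, HasDerivAt mA αA 0 ∧ HasDerivAt mB αB 0 ∧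
      ν * αA = residueA d ν p₀ ((derivative U).eval p₀ / U.eval p₀ -
        slopeDeriv b 1 (x, 0) p₀ / slopePoly b (x, 0) p₀)
        (slopeDeriv b 1 (x, 0) p₀ / slopePoly b (x, 0) p₀) ∧
      ν * αB = residueB ν p₀ ((derivative U).eval p₀ / U.eval p₀ -
        slopeDeriv b 1 (x, 0) p₀ / slopePoly b (x, 0) p₀)
        (slopeDeriv b 1 (x, 0) p₀ / slopePoly b (x, 0) p₀) ∧
      ∀ᶠ t in 𝓝[≠] (0 : ℂ),
        t ^ ν * rootA a (x, t ^ ν) (p₀ + t * v t) = mA t / t ∧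
        t ^ ν * rootB a (x, t ^ ν) (p₀ + t * v t) = mB t / t := by
  obtain ⟨N₁, N₂, N₃, hN₁, h10, hN₂, h20, hN₃, h30, hev⟩ := h.exists_scaled_derivs
  have hQ := h.hasDerivAt_accelNum
  have hFy := (hasDerivAt_slopeDeriv_branch h.two_le (p₀ := p₀) h.analyticAt_partialY
    h.differentiable 0).continuousAt
  simp only [slopeDeriv_zero] at hFy
  set Q := fun t => accelNum a (x, t ^ ν) (p₀ + t * v t) with hQdef
  have hν2 := h.two_le
  have hν0 : ν ≠ 0 := by omega
  have hνc : (ν : ℂ) ≠ 0 := Nat.cast_ne_zero.2 hν0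
  have hQ0 : Q 0 = p₀ * slopePoly b (x, 0) p₀ := by
    rw [← h.accelNum_zero, hQdef]; simp [hν0]
  have hv0 := h.ne_zero
  have hu0 := h.eval_ne_zero
  have hV0 : v 0 ^ ν ≠ 0 := pow_ne_zero _ hv0
  have heq := h.equation_zero
  have hdeq := h.deriv_equation
  have hpow : v 0 ^ (ν - 1) * v 0 = v 0 ^ ν := by rw [← pow_succ, Nat.sub_add_cancel (by omega)]
  have hκ : HasDerivAt (fun t => (v t ^ ν)⁻¹) (-(ν * deriv v 0) / (v 0 * v 0 ^ ν)) 0 := by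
    refine ((h.differentiable.hasDerivAt.fun_pow ν).fun_inv hV0).congr_deriv ?_
    rw [← hpow]
    have := pow_ne_zero (ν - 1) hv0
    field_simp
  have hN10 : N₁ 0 ≠ 0 := by rw [h10]; exact mul_ne_zero hνc hu0
  have hmB := ((hκ.fun_mul hQ).fun_mul hN₃).fun_div
    ((((hasDerivAt_const 0 (6 : ℂ)).fun_mul (hN₁.fun_pow 2))).fun_mul h.differentiable.hasDerivAt)
    (mul_ne_zero (mul_ne_zero (by norm_num) (pow_ne_zero 2 hN10)) hv0)
  -- Since `∂ₚF = (t v)^(ν-1) N₁` and `∂ₚ³F = (t v)^(ν-3) N₃` (formally), the quotient in `rootB`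
  -- has order `-ν - 1` in `t v`.
  set mB := fun t => (v t ^ ν)⁻¹ * Q t * N₃ t / (6 * N₁ t ^ 2 * v t) with hmBdef
  have he0 : slopePoly b (x, 0) p₀ = -(v 0 ^ ν * U.eval p₀) := by linear_combination heq
  -- The differentiated branch equation, solved for `v'(0)`.
  have hdv : deriv v 0 = -(v 0 ^ 2 * (v 0 ^ ν * (derivative U).eval p₀ + slopeDeriv b 1 (x, 0) p₀)) /
      (ν * v 0 ^ ν * U.eval p₀) := by
    rw [eq_div_iff (mul_ne_zero (mul_ne_zero hνc hV0) hu0), ← hpow]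
    rw [← hpow] at hdeq
    linear_combination v 0 * hdeq
  obtain ⟨αB, hαB, hresB⟩ : ∃ αB, HasDerivAt mB αB 0 ∧
      ν * αB = residueB ν p₀ ((derivative U).eval p₀ / U.eval p₀ -
        slopeDeriv b 1 (x, 0) p₀ / slopePoly b (x, 0) p₀)
        (slopeDeriv b 1 (x, 0) p₀ / slopePoly b (x, 0) p₀) := by
    refine ⟨_, hmB, ?_⟩
    rw [residueB, hdv, h10, h30, hQ0, he0]
    generalize v 0 ^ ν = V at hV0
    generalize v 0 = v₀ at hv0
    generalize U.eval p₀ = u₀ at hu0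
    -- Either `ν = 2`, and the mixed derivative is multiplied by `N₃ 0 = 0`, or the mixed derivative
    -- itself vanishes.
    rcases mul_eq_zero.1 h.slopeDeriv_partialX with h2 | h2
    · have h2' : (ν : ℂ) = 2 := by linear_combination h2
      rw [h2']
      field_simp
      ring
    · rw [h2]
      field_simp
      ring
  -- The part of `t ^ ν * rootA` other than `-p * (t ^ ν * rootB)`. It is bounded, so only its value
  -- at `0` enters the residue.
  set G := fun t => ((d : ℂ) - 2) / 2 * ((v t ^ ν)⁻¹ * Q t * N₂ t / N₁ t ^ 2) -
    ((d : ℂ) - 1) * ((d : ℂ) - 2) / 2 * (t * v t * (v t ^ ν)⁻¹ *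
      slopePoly (fun k => partialY (a k)) (x, t ^ ν) (p₀ + t * v t) / N₁ t) with hGdef
  have hG : ContinuousAt G 0 :=
    (continuousAt_const.mul (((hκ.continuousAt.mul hQ.continuousAt).mul hN₂).div
      (hN₁.continuousAt.pow 2) (pow_ne_zero 2 hN10))).sub (continuousAt_const.mul
      ((((continuousAt_id.mul h.differentiable.continuousAt).mul hκ.continuousAt).mul hFy).div
        hN₁.continuousAt hN10))
  have hG0 : G 0 = ((d : ℂ) - 2) / 2 * ((v 0 ^ ν)⁻¹ * Q 0 * N₂ 0 / N₁ 0 ^ 2) := by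
    simp [hGdef]
  have hmA := (h.hasDerivAt_line.fun_neg.fun_mul hαB).fun_add (hasDerivAt_id_mul_of_continuousAt hG)
  refine ⟨fun t => -(p₀ + t * v t) * mB t + t * G t, mB, _, _, hmA, hαB, ?_, ?_, ?_⟩
  · rw [hG0, residueA, mul_add, ← hresB]
    simp only [hmBdef, hQ0, h10, h20, h30, he0, zero_mul, add_zero]
    field_simp
    ring
  · exact hresB
  · have hN1ne := hN₁.continuousAt.eventually_ne hN10
    have hvne := h.differentiable.continuousAt.eventually_ne hv0
    filter_upwards [nhdsWithin_le_nhds hev, nhdsWithin_le_nhds hN1ne, nhdsWithin_le_nhds hvne,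
      self_mem_nhdsWithin] with t h1 h2 h3 ht
    have ht0 : t ≠ 0 := ht
    obtain ⟨e1, e2, e3⟩ := h1
    have hs : t * v t ≠ 0 := mul_ne_zero ht0 h3
    have hsν : (t * v t) ^ ν ≠ 0 := pow_ne_zero _ hs
    have f1 : slopeDeriv a 1 (x, t ^ ν) (p₀ + t * v t) = (t * v t) ^ ν * N₁ t / (t * v t) := by
      rw [eq_div_iff hs, mul_comm]; exact e1
    have f2 : slopeDeriv a 2 (x, t ^ ν) (p₀ + t * v t) = (t * v t) ^ ν * N₂ t / (t * v t) ^ 2 := by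
      rw [eq_div_iff (pow_ne_zero 2 hs), mul_comm]; exact e2
    have f3 : slopeDeriv a 3 (x, t ^ ν) (p₀ + t * v t) = (t * v t) ^ ν * N₃ t / (t * v t) ^ 3 := by
      rw [eq_div_iff (pow_ne_zero 3 hs), mul_comm]; exact e3
    have htn := pow_ne_zero ν ht0
    have hvn := pow_ne_zero ν h3
    constructor
    · simp only [rootA, f1, f2, f3, hmBdef, hGdef, hQdef, mul_pow]
      field_simp
      ring
    · simp only [rootB, f1, f3, hmBdef, hQdef, mul_pow]
      field_simp

end IsBranch

end PlanarWeb

end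

noncomputable section

namespace PlanarWeb

open Filter Metric Set Polynomial

/-! ### A multiple slope along `{y = 0}` -/

lemma hasDerivAt_slopeDeriv_curve {d : ℕ} {a : Fin (d + 1) → ℂ × ℂ → ℂ} {x₀ : ℂ} {φ₀ : ℂ → ℂ}
    (ha : ∀ k, AnalyticAt ℂ (a k) (x₀, 0)) (hφ : DifferentiableAt ℂ φ₀ x₀) (m : ℕ) :
    HasDerivAt (fun x => slopeDeriv a m (x, 0) (φ₀ x))
      (slopeDeriv (fun k => partialX (a k)) m (x₀, 0) (φ₀ x₀) +
        deriv φ₀ x₀ * slopeDeriv a (m + 1) (x₀, 0) (φ₀ x₀)) x₀ := by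
  set F := fun u : (ℂ × ℂ) × ℂ => slopeDeriv a m u.1 u.2 with hF
  have hd : DifferentiableAt ℂ F ((x₀, 0), φ₀ x₀) :=
    (analyticAt_slopeDeriv m (u := ((x₀, 0), φ₀ x₀)) ha).differentiableAt
  have h1 : HasDerivAt (fun p => F ((x₀, 0), p)) (fderiv ℂ F ((x₀, 0), φ₀ x₀) ((0, 0), 1)) (φ₀ x₀) :=
    hd.hasFDerivAt.comp_hasDerivAt (f := fun p : ℂ => (((x₀, 0), p) : (ℂ × ℂ) × ℂ)) (φ₀ x₀)
      ((hasDerivAt_const _ ((x₀, 0) : ℂ × ℂ)).prodMk (hasDerivAt_id _))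
  have h2 := h1.unique (hasDerivAt_slopeDeriv a m (x₀, 0) (φ₀ x₀))
  have hx : HasDerivAt (fun x : ℂ => ((x, 0) : ℂ × ℂ)) (1, 0) x₀ :=
    (hasDerivAt_id x₀).prodMk (hasDerivAt_const x₀ (0 : ℂ))
  have h3 : HasDerivAt (fun x => F ((x, 0), φ₀ x₀))
      (fderiv ℂ F ((x₀, 0), φ₀ x₀) ((1, 0), 0)) x₀ :=
    hd.hasFDerivAt.comp_hasDerivAt (f := fun x : ℂ => (((x, 0), φ₀ x₀) : (ℂ × ℂ) × ℂ)) x₀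
      (hx.prodMk (hasDerivAt_const _ _))
  have h4 : HasDerivAt (fun x => F ((x, 0), φ₀ x₀))
      (slopeDeriv (fun k => partialX (a k)) m (x₀, 0) (φ₀ x₀)) x₀ := by
    simp only [hF, slopeDeriv_eq_sum]
    refine HasDerivAt.fun_sum fun k _ => HasDerivAt.mul_const ?_ _
    exact (ha k).differentiableAt.hasFDerivAt.comp_hasDerivAt
      (f := fun x : ℂ => ((x, 0) : ℂ × ℂ)) x₀ hx
  have h5 : HasDerivAt (fun x => F ((x, 0), φ₀ x))
      (fderiv ℂ F ((x₀, 0), φ₀ x₀) ((1, 0), deriv φ₀ x₀)) x₀ :=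
    hd.hasFDerivAt.comp_hasDerivAt (f := fun x : ℂ => (((x, 0), φ₀ x) : (ℂ × ℂ) × ℂ)) x₀
      (hx.prodMk hφ.hasDerivAt)
  refine h5.congr_deriv ?_
  have : (((1, 0), deriv φ₀ x₀) : (ℂ × ℂ) × ℂ) =
      ((1, 0), 0) + deriv φ₀ x₀ • (((0, 0), 1) : (ℂ × ℂ) × ℂ) := by ext <;> simp
  rw [this, map_add, map_smul, h2, h3.unique h4, smul_eq_mul]

/-- Near `x₀`, `F(x, 0, p)` has the root `φ₀` of multiplicity `ν` and the simple roots `φ α`. -/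
structure IsFactored {ν n : ℕ} (a : Fin (ν + n + 1) → ℂ × ℂ → ℂ) (φ₀ : ℂ → ℂ) (φ : Fin n → ℂ → ℂ)
    (x₀ : ℂ) : Prop where
  two_le : 2 ≤ ν
  coeff : ∀ k, AnalyticAt ℂ (a k) (x₀, 0)
  lead : a 0 (x₀, 0) ≠ 0
  analyticAt₀ : AnalyticAt ℂ φ₀ x₀
  analyticAt : ∀ α, AnalyticAt ℂ (φ α) x₀
  ne₀ : ∀ α, φ α x₀ ≠ φ₀ x₀
  injective : Function.Injective fun α => φ α x₀
  factor : ∀ᶠ x in 𝓝 x₀, ∀ p, slopePoly a (x, 0) p = a 0 (x, 0) * (p - φ₀ x) ^ ν * ∏ α, (p - φ α x)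

namespace IsFactored

variable {ν n : ℕ} {a : Fin (ν + n + 1) → ℂ × ℂ → ℂ} {φ₀ : ℂ → ℂ} {φ : Fin n → ℂ → ℂ} {x₀ : ℂ}

lemma continuousAt_axis (x₀ : ℂ) : ContinuousAt (fun x : ℂ => ((x, 0) : ℂ × ℂ)) x₀ := by fun_prop

lemma eventually (h : IsFactored a φ₀ φ x₀) : ∀ᶠ x in 𝓝 x₀, IsFactored a φ₀ φ x := by
  have h1 : ∀ᶠ x in 𝓝 x₀, ∀ k, AnalyticAt ℂ (a k) (x, 0) :=
    eventually_all.2 fun k => (continuousAt_axis x₀).eventually (h.coeff k).eventually_analyticAt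
  have h2 : ∀ᶠ x in 𝓝 x₀, a 0 (x, 0) ≠ 0 :=
    (continuousAt_axis x₀).eventually ((h.coeff 0).continuousAt.eventually_ne h.lead)
  have h3 : ∀ᶠ x in 𝓝 x₀, ∀ α, φ α x - φ₀ x ≠ 0 := eventually_all.2 fun α =>
    ((h.analyticAt α).sub h.analyticAt₀).continuousAt.eventually_ne (sub_ne_zero.2 (h.ne₀ α))
  have h4 : ∀ᶠ x in 𝓝 x₀, ∀ α β, α ≠ β → φ α x - φ β x ≠ 0 := by
    refine eventually_all.2 fun α => eventually_all.2 fun β => ?_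
    by_cases hαβ : α = β
    · simp [hαβ]
    · filter_upwards [((h.analyticAt α).sub (h.analyticAt β)).continuousAt.eventually_ne
        (sub_ne_zero.2 (h.injective.ne hαβ))] with x hx _
      exact hx
  filter_upwards [h1, h2, h3, h4, h.analyticAt₀.eventually_analyticAt,
    eventually_all.2 fun α => (h.analyticAt α).eventually_analyticAt,
    h.factor.eventually_nhds] with x g1 g2 g3 g4 g5 g6 g7
  refine ⟨h.two_le, g1, g2, g5, g6, fun α => sub_ne_zero.1 (g3 α), fun α β hαβ => ?_, g7⟩
  by_contra hne
  exact g4 α β hne (sub_eq_zero.2 hαβ)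

/-- The cofactor of `(p - φ₀)^ν` in `F(x, 0, p)`. -/
def cofactor (a : Fin (ν + n + 1) → ℂ × ℂ → ℂ) (φ : Fin n → ℂ → ℂ) (x : ℂ) : ℂ[X] :=
  C (a 0 (x, 0)) * ∏ α, (X - C (φ α x))

lemma eval_cofactor (x p : ℂ) : (cofactor a φ x).eval p = a 0 (x, 0) * ∏ α, (p - φ α x) := by
  simp [cofactor, eval_prod]

lemma slopePolynomial_eq (h : IsFactored a φ₀ φ x₀) :
    slopePolynomial a (x₀, 0) = (X - C (φ₀ x₀)) ^ ν * cofactor a φ x₀ := by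
  refine Polynomial.funext fun p => ?_
  rw [eval_slopePolynomial, h.factor.self_of_nhds p, eval_mul, eval_cofactor]
  simp only [eval_pow, eval_sub, eval_X, eval_C]
  ring

lemma eval_cofactor_ne_zero (h : IsFactored a φ₀ φ x₀) : (cofactor a φ x₀).eval (φ₀ x₀) ≠ 0 := by
  rw [eval_cofactor]
  exact mul_ne_zero h.lead (Finset.prod_ne_zero_iff.2 fun α _ => sub_ne_zero.2 (h.ne₀ α).symm)

lemma logDeriv_cofactor (h : IsFactored a φ₀ φ x₀) :
    (derivative (cofactor a φ x₀)).eval (φ₀ x₀) / (cofactor a φ x₀).eval (φ₀ x₀) =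
      ∑ α, (φ₀ x₀ - φ α x₀)⁻¹ := by
  have hne : ∀ α, φ₀ x₀ - φ α x₀ ≠ 0 := fun α => sub_ne_zero.2 (h.ne₀ α).symm
  have hp : ∏ α, (φ₀ x₀ - φ α x₀) ≠ 0 := Finset.prod_ne_zero_iff.2 fun α _ => hne α
  rw [eval_cofactor, cofactor, derivative_C_mul, eval_mul, eval_C, mul_div_mul_left _ _ h.lead,
    derivative_prod_finset, eval_finsetSum, Finset.sum_div]
  refine Finset.sum_congr rfl fun α _ => ?_
  simp only [derivative_sub, derivative_X, derivative_C, sub_zero, mul_one, eval_prod, eval_sub,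
    eval_X, eval_C]
  rw [div_eq_iff hp, ← Finset.mul_prod_erase _ _ (Finset.mem_univ α), inv_mul_cancel_left₀ (hne α)]

lemma slopeDeriv_eq_zero (h : IsFactored a φ₀ φ x₀) {m : ℕ} (hm : m < ν) :
    slopeDeriv a m (x₀, 0) (φ₀ x₀) = 0 := by
  have h1 : (X - C (φ₀ x₀)) ^ (ν - m) ∣ derivative^[m] (slopePolynomial a (x₀, 0)) :=
    pow_sub_dvd_iterate_derivative_of_pow_dvd m ⟨_, h.slopePolynomial_eq⟩
  have h2 := (dvd_pow_self (X - C (φ₀ x₀)) (by omega : ν - m ≠ 0)).trans h1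
  exact dvd_iff_isRoot.1 h2

/-- Differentiate in `x` the identity `∂ₚᵐF(x, 0, φ₀(x)) = 0`; the term in `φ₀'` carries
`∂ₚ^(m+1)F`, which also vanishes. -/
lemma slopeDeriv_partialX_eq_zero (h : IsFactored a φ₀ φ x₀) {m : ℕ} (hm : m + 1 < ν) :
    slopeDeriv (fun k => partialX (a k)) m (x₀, 0) (φ₀ x₀) = 0 := by
  have h1 := hasDerivAt_slopeDeriv_curve h.coeff h.analyticAt₀.differentiableAt m
  have h2 : ∀ᶠ x in 𝓝 x₀, slopeDeriv a m (x, 0) (φ₀ x) = 0 := by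
    filter_upwards [h.eventually] with x hx using hx.slopeDeriv_eq_zero (by omega)
  have h3 := h1.unique ((hasDerivAt_const x₀ (0 : ℂ)).congr_of_eventuallyEq h2)
  rwa [h.slopeDeriv_eq_zero hm, mul_zero, add_zero] at h3

/-- Because `ν ≥ 2`, both `∂ₓF` and `∂ₚF` vanish at `(x₀, 0, φ₀ x₀)`, so `∂_yF` is the only possible
non-zero component of the differential. -/
lemma slopePoly_partialY_ne_zero (h : IsFactored a φ₀ φ x₀)
    (hF : fderiv ℂ (fun u : (ℂ × ℂ) × ℂ => slopePoly a u.1 u.2) ((x₀, 0), φ₀ x₀) ≠ 0) :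
    slopePoly (fun k => partialY (a k)) (x₀, 0) (φ₀ x₀) ≠ 0 := by
  intro h0
  refine hF (ContinuousLinearMap.ext fun v => ?_)
  have hν := h.two_le
  rw [fderiv_slopePoly_apply (u := ((x₀, 0), φ₀ x₀)) h.coeff, h0,
    ← slopeDeriv_zero (fun k => partialX (a k)), h.slopeDeriv_partialX_eq_zero (by omega),
    h.slopeDeriv_eq_zero (by omega)]
  simp

lemma slopeDeriv_ne_zero (h : IsFactored a φ₀ φ x₀) (α : Fin n) :
    slopePoly a (x₀, 0) (φ α x₀) = 0 ∧ slopeDeriv a 1 (x₀, 0) (φ α x₀) ≠ 0 := by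
  set R : ℂ[X] := (X - C (φ₀ x₀)) ^ ν * (C (a 0 (x₀, 0)) *
    ∏ β ∈ Finset.univ.erase α, (X - C (φ β x₀))) with hR
  have h1 : slopePolynomial a (x₀, 0) = (X - C (φ α x₀)) * R := by
    rw [h.slopePolynomial_eq, cofactor, ← Finset.mul_prod_erase _ _ (Finset.mem_univ α), hR]
    ring
  constructor
  · rw [← eval_slopePolynomial, h1]; simp
  · have : slopeDeriv a 1 (x₀, 0) (φ α x₀) = R.eval (φ α x₀) := by
      rw [slopeDeriv, h1]; simp
    rw [this, hR]
    simp only [eval_mul, eval_pow, eval_sub, eval_X, eval_C, eval_prod]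
    refine mul_ne_zero (pow_ne_zero _ (sub_ne_zero.2 (h.ne₀ α))) (mul_ne_zero h.lead
      (Finset.prod_ne_zero_iff.2 fun β hβ => sub_ne_zero.2 fun h' => ?_))
    exact Finset.ne_of_mem_erase hβ (h.injective h').symm

/-- Simple roots vary analytically. -/
lemma exists_simple_root (h : IsFactored a φ₀ φ x₀) (α : Fin n) :
    ∃ q : ℂ × ℂ → ℂ, AnalyticAt ℂ q (x₀, 0) ∧ q (x₀, 0) = φ α x₀ ∧
      ∀ᶠ z in 𝓝 ((x₀, 0) : ℂ × ℂ), slopePoly a z (q z) = 0 := by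
  obtain ⟨h1, h2⟩ := h.slopeDeriv_ne_zero α
  refine exists_analytic_root (G := fun u : (ℂ × ℂ) × ℂ => slopePoly a u.1 u.2)
    (analyticAt_slopePoly (u := ((x₀, 0), φ α x₀)) h.coeff) h1 ?_
  rw [fderiv_slopePoly_apply (u := ((x₀, 0), φ α x₀)) h.coeff]
  simpa using h2

end IsFactored

end PlanarWeb

end

/-! ### Unfolding the roots by `y = t ^ ν` -/

noncomputable section

namespace PlanarWeb

open Filter Metric Set Polynomial

lemma eventually_of_comp_pow {ν : ℕ} (hν : ν ≠ 0) {P : ℂ × ℂ → Prop} {x₀ : ℂ}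
    (h : ∀ᶠ u in 𝓝 ((x₀, 0) : ℂ × ℂ), P (u.1, u.2 ^ ν)) : ∀ᶠ z in 𝓝 ((x₀, 0) : ℂ × ℂ), P z := by
  obtain ⟨δ, hδ, hsub⟩ := Metric.eventually_nhds_iff_ball.1 h
  have hmem : ((x₀, 0) : ℂ × ℂ) ∈ ball x₀ δ ×ˢ ball (0 : ℂ) (δ ^ ν) :=
    ⟨mem_ball_self hδ, mem_ball_self (by positivity)⟩
  filter_upwards [(isOpen_ball.prod isOpen_ball).mem_nhds hmem] with z hz
  obtain ⟨t, ht⟩ := IsAlgClosed.exists_pow_nat_eq z.2 (Nat.pos_of_ne_zero hν)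
  have h2 := hz.2
  rw [mem_ball_zero_iff, ← ht, norm_pow] at h2
  have := hsub (z.1, t) (by
    rw [← ball_prod_same]
    exact ⟨hz.1, mem_ball_zero_iff.2 (lt_of_pow_lt_pow_left₀ ν hδ.le h2)⟩)
  rwa [ht] at this

/-- The unfolding `y = t ^ ν`. -/
lemma tendsto_unfold {ν : ℕ} (hν : ν ≠ 0) (x₀ : ℂ) :
    Tendsto (fun u : ℂ × ℂ => (u.1, u.2 ^ ν)) (𝓝 (x₀, 0)) (𝓝 (x₀, 0)) := by
  have : Continuous fun u : ℂ × ℂ => (u.1, u.2 ^ ν) := by fun_prop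
  simpa [hν] using this.tendsto (x₀, 0)

namespace IsFactored

variable {ν n : ℕ} {a : Fin (ν + n + 1) → ℂ × ℂ → ℂ} {φ₀ : ℂ → ℂ} {φ : Fin n → ℂ → ℂ} {x₀ : ℂ}

/-- A ramified root `p = φ₀(x) + t v(x, t)`, `y = t ^ ν`. -/
lemma exists_ramified_root (h : IsFactored a φ₀ φ x₀)
    (hy : slopePoly (fun k => partialY (a k)) (x₀, 0) (φ₀ x₀) ≠ 0) :
    ∃ (b : Fin (ν + n + 1) → ℂ × ℂ → ℂ) (v : ℂ × ℂ → ℂ), (∀ k, AnalyticAt ℂ (b k) (x₀, 0)) ∧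
      (∀ k, partialY (a k) (x₀, 0) = b k (x₀, 0)) ∧
      (∀ᶠ z in 𝓝 ((x₀, 0) : ℂ × ℂ), ∀ k, a k z = a k (z.1, 0) + z.2 * b k z) ∧
      AnalyticAt ℂ v (x₀, 0) ∧ v (x₀, 0) ≠ 0 ∧
      ∀ᶠ u in 𝓝 ((x₀, 0) : ℂ × ℂ), v u ^ ν * (cofactor a φ u.1).eval (φ₀ u.1 + u.2 * v u) +
        slopePoly b (u.1, u.2 ^ ν) (φ₀ u.1 + u.2 * v u) = 0 := by
  have hν := h.two_le
  have hν0 : ν ≠ 0 := by omega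
  choose b hb hyb hab using fun k => exists_divided_difference (h.coeff k)
  have hy' : slopePoly b (x₀, 0) (φ₀ x₀) ≠ 0 := by
    simpa only [slopePoly, hyb] using hy
  have hu := h.eval_cofactor_ne_zero
  -- The value of `v` forced by the branch equation at `t = 0`; it is non-zero because `∂_yF` is.
  obtain ⟨v₀, hv₀⟩ := IsAlgClosed.exists_pow_nat_eq
    (-slopePoly b (x₀, 0) (φ₀ x₀) / (cofactor a φ x₀).eval (φ₀ x₀)) (Nat.pos_of_ne_zero hν0)
  have hv₀0 : v₀ ≠ 0 := by
    rintro rfl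
    rw [zero_pow hν0] at hv₀
    exact div_ne_zero (neg_ne_zero.2 hy') hu hv₀.symm
  set P : (ℂ × ℂ) × ℂ → ℂ := fun w => φ₀ w.1.1 + w.1.2 * w.2 with hP
  -- `F` after substituting `p = φ₀ + t v`, `y = t ^ ν` and dividing by `t ^ ν`. Its derivative in
  -- `v` at `t = 0` is `ν v₀ ^ (ν - 1)` times the non-zero cofactor, so the implicit function
  -- theorem applies.
  set G : (ℂ × ℂ) × ℂ → ℂ := fun w => w.2 ^ ν * (a 0 (w.1.1, 0) * ∏ α, (P w - φ α w.1.1)) +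
    slopePoly b (w.1.1, w.1.2 ^ ν) (P w) with hG
  have e1 : AnalyticAt ℂ (fun w : (ℂ × ℂ) × ℂ => w.1.1) ((x₀, 0), v₀) :=
    AnalyticAt.fun_comp (g := Prod.fst) analyticAt_fst analyticAt_fst
  have e2 : AnalyticAt ℂ (fun w : (ℂ × ℂ) × ℂ => w.1.2) ((x₀, 0), v₀) :=
    AnalyticAt.fun_comp (g := Prod.snd) analyticAt_snd analyticAt_fst
  have e3 : AnalyticAt ℂ (fun w : (ℂ × ℂ) × ℂ => w.2) ((x₀, 0), v₀) := analyticAt_snd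
  have hPa : AnalyticAt ℂ P ((x₀, 0), v₀) :=
    (AnalyticAt.fun_comp (g := φ₀) h.analyticAt₀ e1).add (e2.mul e3)
  have hP0 : P ((x₀, 0), v₀) = φ₀ x₀ := by simp [hP]
  have hcurve : AnalyticAt ℂ (fun w => ((w.1.1, w.1.2 ^ ν), P w) : (ℂ × ℂ) × ℂ → (ℂ × ℂ) × ℂ)
      ((x₀, 0), v₀) := (e1.prod (e2.pow ν)).prod hPa
  have hpt : ((((x₀, 0), v₀) : (ℂ × ℂ) × ℂ).1.1, (((x₀, 0), v₀) : (ℂ × ℂ) × ℂ).1.2 ^ ν) =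
      ((x₀, 0) : ℂ × ℂ) := by simp [hν0]
  have hGa : AnalyticAt ℂ G ((x₀, 0), v₀) := by
    refine AnalyticAt.add ((e3.pow ν).mul (AnalyticAt.mul ?_ ?_)) ?_
    · exact AnalyticAt.fun_comp (g := a 0) (f := fun w : (ℂ × ℂ) × ℂ => (w.1.1, (0 : ℂ)))
        (h.coeff 0) (e1.prod analyticAt_const)
    · exact Finset.analyticAt_fun_prod _ fun α _ =>
        hPa.sub (AnalyticAt.fun_comp (g := φ α) (h.analyticAt α) e1)
    · refine AnalyticAt.fun_comp (g := fun u : (ℂ × ℂ) × ℂ => slopePoly b u.1 u.2)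
        (analyticAt_slopePoly fun k => ?_) hcurve
      simp only [hpt]
      exact hb k
  have hGw : ∀ w, G ((x₀, 0), w) =
      w ^ ν * (cofactor a φ x₀).eval (φ₀ x₀) + slopePoly b (x₀, 0) (φ₀ x₀) := fun w => by
    simp [hG, hP, hν0, eval_cofactor]
  have hG0 : G ((x₀, 0), v₀) = 0 := by
    rw [hGw, hv₀]
    field_simp
    ring
  have hGd : fderiv ℂ G ((x₀, 0), v₀) (0, 1) ≠ 0 := by
    have h1 : HasDerivAt (fun w => G ((x₀, 0), w)) (fderiv ℂ G ((x₀, 0), v₀) (0, 1)) v₀ :=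
      hGa.differentiableAt.hasFDerivAt.comp_hasDerivAt
        (f := fun w : ℂ => (((x₀, 0), w) : (ℂ × ℂ) × ℂ)) v₀
        ((hasDerivAt_const v₀ ((x₀, 0) : ℂ × ℂ)).prodMk (hasDerivAt_id v₀))
    simp only [hGw] at h1
    rw [h1.unique (((hasDerivAt_pow ν v₀).mul_const _).add_const _)]
    exact mul_ne_zero (mul_ne_zero (Nat.cast_ne_zero.2 hν0) (pow_ne_zero _ hv₀0)) hu
  obtain ⟨v, hva, hv0, hv⟩ := exists_analytic_root hGa hG0 hGd
  refine ⟨b, v, hb, hyb, eventually_all.2 hab, hva, by rwa [hv0], ?_⟩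
  filter_upwards [hv] with u hu
  rw [eval_cofactor]
  exact hu

/-- Data describing all the roots of `F(x, t ^ ν, ·)` for `(x, t)` near `(x₀, 0)`. -/
structure IsUnfolding (a b : Fin (ν + n + 1) → ℂ × ℂ → ℂ) (φ₀ : ℂ → ℂ) (φ : Fin n → ℂ → ℂ)
    (x₀ ζ : ℂ) (v : ℂ × ℂ → ℂ) (q : Fin n → ℂ × ℂ → ℂ) : Prop where
  primitive : IsPrimitiveRoot ζ ν
  isBranch : IsBranch a b ν x₀ (φ₀ x₀) (cofactor a φ x₀) fun t => v (x₀, t)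
  analytic_q : ∀ α, AnalyticAt ℂ (q α) (x₀, 0)
  q_zero : ∀ α, q α (x₀, 0) = φ α x₀
  roots : ∀ᶠ u in 𝓝 ((x₀, 0) : ℂ × ℂ), u.2 ≠ 0 → ∃ p : Fin ν ⊕ Fin n → ℂ,
    Function.Injective p ∧ (∀ i, slopePoly a (u.1, u.2 ^ ν) (p i) = 0) ∧
    (∀ j : Fin ν, p (Sum.inl j) =
      φ₀ u.1 + ζ ^ (j : ℕ) * u.2 * v (u.1, ζ ^ (j : ℕ) * u.2)) ∧
    ∀ α, p (Sum.inr α) = q α (u.1, u.2 ^ ν)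

lemma isBranch {b : Fin (ν + n + 1) → ℂ × ℂ → ℂ} {v : ℂ × ℂ → ℂ} (h : IsFactored a φ₀ φ x₀)
    (hb : ∀ k, AnalyticAt ℂ (b k) (x₀, 0)) (hyb : ∀ k, partialY (a k) (x₀, 0) = b k (x₀, 0))
    (hab : ∀ᶠ z in 𝓝 ((x₀, 0) : ℂ × ℂ), ∀ k, a k z = a k (z.1, 0) + z.2 * b k z)
    (hv : AnalyticAt ℂ v (x₀, 0)) (hv0 : v (x₀, 0) ≠ 0)
    (heq : ∀ᶠ u in 𝓝 ((x₀, 0) : ℂ × ℂ),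
      v u ^ ν * (cofactor a φ u.1).eval (φ₀ u.1 + u.2 * v u) +
        slopePoly b (u.1, u.2 ^ ν) (φ₀ u.1 + u.2 * v u) = 0) :
    IsBranch a b ν x₀ (φ₀ x₀) (cofactor a φ x₀) fun t => v (x₀, t) := by
  have hν := h.two_le
  refine ⟨hν, h.coeff, hb, hyb, ?_, ?_, h.eval_cofactor_ne_zero, ?_,
    (hasDerivAt_slice hv).differentiableAt, hv0, heq.curry_nhds.self_of_nhds⟩
  · rw [← slopeDeriv_zero (fun k => partialX (a k)), h.slopeDeriv_partialX_eq_zero (by omega)]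
  · rcases hν.eq_or_lt with h2 | h2
    · rw [sub_eq_zero.2 (show (ν : ℂ) = 2 by exact_mod_cast h2.symm), zero_mul]
    · rw [h.slopeDeriv_partialX_eq_zero (by omega), mul_zero]
  · filter_upwards [hab.curry_nhds.self_of_nhds] with y hy
    rw [← h.slopePolynomial_eq]
    simp only [slopePolynomial, Finset.mul_sum, ← Finset.sum_add_distrib]
    refine Finset.sum_congr rfl fun k _ => ?_
    rw [hy k]
    simp only [map_add, map_mul]
    ring

end IsFactored

end PlanarWeb

end

noncomputable section

namespace PlanarWeb

open Filter Metric Set Polynomial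

namespace IsFactored

variable {ν n : ℕ} {a : Fin (ν + n + 1) → ℂ × ℂ → ℂ} {φ₀ : ℂ → ℂ} {φ : Fin n → ℂ → ℂ} {x₀ : ℂ}

/-- The substitution `t ↦ ζ ^ j t` leaves `y = t ^ ν` unchanged, so the single function `v` yields
all `ν` colliding roots; with the `n` simple ones this exhausts the degree. For `t ≠ 0` the
colliding roots differ because `(ζ ^ j - ζ ^ k) v(x₀, 0) ≠ 0`. -/
lemma exists_isUnfolding (h : IsFactored a φ₀ φ x₀)
    (hy : slopePoly (fun k => partialY (a k)) (x₀, 0) (φ₀ x₀) ≠ 0) :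
    ∃ b ζ v q, IsUnfolding a b φ₀ φ x₀ ζ v q := by
  obtain ⟨b, v, hb, hyb, hab, hv, hv0, heq⟩ := h.exists_ramified_root hy
  choose q hq hq0 hqr using h.exists_simple_root
  have hν := h.two_le
  have hν0 : ν ≠ 0 := by omega
  have hζ := Complex.isPrimitiveRoot_exp ν hν0
  set ζ := Complex.exp (2 * Real.pi * Complex.I / ν) with hζdef
  refine ⟨b, ζ, v, q, hζ, h.isBranch hb hyb hab hv hv0 heq, hq, hq0, ?_⟩
  have hζν : ∀ j : ℕ, (ζ ^ j) ^ ν = 1 := fun j => by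
    rw [← pow_mul, mul_comm, pow_mul, hζ.pow_eq_one, one_pow]
  have hrot : ∀ j : ℕ, Tendsto (fun u : ℂ × ℂ => (u.1, ζ ^ j * u.2)) (𝓝 (x₀, 0)) (𝓝 (x₀, 0)) :=
    fun j => by
      have : Continuous fun u : ℂ × ℂ => (u.1, ζ ^ j * u.2) := by fun_prop
      simpa using this.tendsto (x₀, 0)
  have hunf := tendsto_unfold hν0 x₀
  set w : ℕ → ℂ × ℂ → ℂ := fun j u => v (u.1, ζ ^ j * u.2) with hw
  set P : ℕ → ℂ × ℂ → ℂ := fun j u => φ₀ u.1 + ζ ^ j * u.2 * w j u with hP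
  have hwt : ∀ j, Tendsto (w j) (𝓝 (x₀, 0)) (𝓝 (v (x₀, 0))) := fun j =>
    hv.continuousAt.tendsto.comp (hrot j)
  have hfst : Tendsto (fun u : ℂ × ℂ => u.1) (𝓝 (x₀, 0)) (𝓝 x₀) := continuous_fst.tendsto _
  have hsnd : Tendsto (fun u : ℂ × ℂ => u.2) (𝓝 (x₀, 0)) (𝓝 0) := continuous_snd.tendsto _
  have hPt : ∀ j, Tendsto (P j) (𝓝 (x₀, 0)) (𝓝 (φ₀ x₀)) := fun j => by
    have := (h.analyticAt₀.continuousAt.tendsto.comp hfst).add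
      (((hsnd.const_mul (ζ ^ j)).mul (hwt j)))
    simpa using this
  have hqt : ∀ α, Tendsto (fun u : ℂ × ℂ => q α (u.1, u.2 ^ ν)) (𝓝 (x₀, 0)) (𝓝 (φ α x₀)) :=
    fun α => by
      rw [← hq0 α]
      exact (hq α).continuousAt.tendsto.comp hunf
  -- the roots are roots
  have r1 : ∀ᶠ u in 𝓝 ((x₀, 0) : ℂ × ℂ), ∀ j : Fin ν, slopePoly a (u.1, u.2 ^ ν) (P j u) = 0 := by
    refine eventually_all.2 fun j => ?_
    filter_upwards [(hrot j).eventually heq, hunf.eventually hab,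
      hfst.eventually h.factor] with u h1 h2 h3
    simp only [mul_pow, hζν, one_mul] at h1
    have h4 : slopePoly a (u.1, u.2 ^ ν) (P j u) = slopePoly a (u.1, 0) (P j u) +
        u.2 ^ ν * slopePoly b (u.1, u.2 ^ ν) (P j u) := by
      simp only [slopePoly, Finset.mul_sum, ← Finset.sum_add_distrib]
      refine Finset.sum_congr rfl fun k _ => ?_
      rw [h2 k]
      ring
    rw [h4, h3]
    rw [eval_cofactor] at h1
    have h5 : (P j u - φ₀ u.1) ^ ν = u.2 ^ ν * w j u ^ ν := by
      simp only [hP, add_sub_cancel_left, mul_pow, hζν, one_mul]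
    rw [h5]
    linear_combination u.2 ^ ν * h1
  have r2 : ∀ᶠ u in 𝓝 ((x₀, 0) : ℂ × ℂ), ∀ α, slopePoly a (u.1, u.2 ^ ν)
      (q α (u.1, u.2 ^ ν)) = 0 := eventually_all.2 fun α => hunf.eventually (hqr α)
  -- the roots are distinct
  have d1 : ∀ᶠ u in 𝓝 ((x₀, 0) : ℂ × ℂ), ∀ j k : Fin ν, j ≠ k →
      ζ ^ (j : ℕ) * w j u - ζ ^ (k : ℕ) * w k u ≠ 0 := by
    refine eventually_all.2 fun j => eventually_all.2 fun k => ?_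
    by_cases hjk : j = k
    · simp [hjk]
    · have ht := (((hwt j).const_mul (ζ ^ (j : ℕ))).sub ((hwt k).const_mul (ζ ^ (k : ℕ))))
      have hne : ζ ^ (j : ℕ) * v (x₀, 0) - ζ ^ (k : ℕ) * v (x₀, 0) ≠ 0 := by
        rw [← sub_mul]
        refine mul_ne_zero (sub_ne_zero.2 fun h' => hjk (Fin.ext ?_)) hv0
        exact hζ.pow_inj j.2 k.2 h'
      filter_upwards [ht.eventually_ne hne] with u hu _ using hu
  have d2 : ∀ᶠ u in 𝓝 ((x₀, 0) : ℂ × ℂ), ∀ (j : Fin ν) α, P j u ≠ q α (u.1, u.2 ^ ν) := by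
    refine eventually_all.2 fun j => eventually_all.2 fun α => ?_
    filter_upwards [((hPt j).sub (hqt α)).eventually_ne (sub_ne_zero.2 (h.ne₀ α).symm)] with u hu
    exact sub_ne_zero.1 hu
  have d3 : ∀ᶠ u in 𝓝 ((x₀, 0) : ℂ × ℂ), ∀ α β, α ≠ β →
      q α (u.1, u.2 ^ ν) ≠ q β (u.1, u.2 ^ ν) := by
    refine eventually_all.2 fun α => eventually_all.2 fun β => ?_
    by_cases hαβ : α = β
    · simp [hαβ]
    · filter_upwards [((hqt α).sub (hqt β)).eventually_ne (sub_ne_zero.2 (h.injective.ne hαβ))]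
        with u hu _ using sub_ne_zero.1 hu
  filter_upwards [r1, r2, d1, d2, d3] with u k1 k2 k3 k4 k5 hu
  refine ⟨Sum.elim (fun j => P j u) fun α => q α (u.1, u.2 ^ ν), ?_, ?_, fun _ => rfl,
    fun _ => rfl⟩
  · refine Function.Injective.sumElim ?_ ?_ k4
    · intro j k hjk
      by_contra hne
      refine k3 j k hne ?_
      have : u.2 * (ζ ^ (j : ℕ) * w j u - ζ ^ (k : ℕ) * w k u) = 0 := by
        simp only [hP] at hjk
        linear_combination hjk
      exact (mul_eq_zero.1 this).resolve_left hu
    · intro α β hαβ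
      by_contra hne
      exact k5 α β hne hαβ
  · rintro (j | α)
    · exact k1 j
    · exact k2 α

/-- Near a generic point of `{y = 0}`, the discriminant is `{y = 0}`. -/
lemma mem_discriminant_iff {M : Type*} [TopologicalSpace M] [ChartedSpace (ℂ × ℂ) M]
    {e : OpenPartialHomeomorph M (ℂ × ℂ)} {W : Web (ν + n) M} (he : e ∈ Coord M)
    (h : IsFactored a φ₀ φ x₀) (ha : IsLocalEquation W e (x₀, 0) a)
    (hy : slopePoly (fun k => partialY (a k)) (x₀, 0) (φ₀ x₀) ≠ 0) :
    ∀ᶠ z in 𝓝 ((x₀, 0) : ℂ × ℂ), e.symm z ∈ discriminant W ↔ z.2 = 0 := by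
  obtain ⟨b, ζ, v, q, hu⟩ := h.exists_isUnfolding hy
  have hν := h.two_le
  have h0 : ∀ᶠ z in 𝓝 ((x₀, 0) : ℂ × ℂ), a 0 z ≠ 0 :=
    (h.coeff 0).continuousAt.eventually_ne h.lead
  have h1 : ∀ᶠ z in 𝓝 ((x₀, 0) : ℂ × ℂ), z.2 ≠ 0 → ∃ p : Fin ν ⊕ Fin n → ℂ,
      Function.Injective p ∧ ∀ i, slopePoly a z (p i) = 0 := by
    refine eventually_of_comp_pow (ν := ν) (by omega) ?_
    filter_upwards [hu.roots] with u hu hu0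
    obtain ⟨p, hp, hr, -⟩ := hu fun h' => hu0 (by rw [h', zero_pow (by omega)])
    exact ⟨p, hp, hr⟩
  have hfst : Tendsto (fun u : ℂ × ℂ => u.1) (𝓝 (x₀, 0)) (𝓝 x₀) := continuous_fst.tendsto _
  filter_upwards [h0, h1, ha.eventually, hfst.eventually h.eventually] with z k0 k1 k2 k3
  constructor
  · intro hz
    by_contra hz0
    obtain ⟨p, hp, hr⟩ := k1 hz0
    exact k2.notMem_discriminant he (by omega) k0 (p := p ∘ finSumFinEquiv.symm)
      (hp.comp finSumFinEquiv.symm.injective) (fun j => hr _) hz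
  -- On `{y = 0}` the slope `φ₀` is at least a double root, whereas off the discriminant all roots
  -- are simple.
  · intro hz0
    have hz : (z.1, (0 : ℂ)) = z := Prod.ext rfl hz0.symm
    by_contra hzd
    obtain ⟨p, hp, hpoly⟩ := k2.slopePolynomial_eq he k0 hzd
    have e0 := k3.slopeDeriv_eq_zero (m := 0) (by omega)
    have e1 := k3.slopeDeriv_eq_zero (m := 1) (by omega)
    rw [hz] at e0 e1
    rw [slopeDeriv_zero, ← eval_slopePolynomial, hpoly] at e0
    simp only [eval_mul, eval_C, eval_prod, eval_sub, eval_X, mul_eq_zero, k0, false_or,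
      Finset.prod_eq_zero_iff, Finset.mem_univ, true_and] at e0
    obtain ⟨j, hj⟩ := e0
    obtain ⟨G, hG, hG1, -⟩ := eval_derivatives_at_root (a 0 z) p hp j hpoly
    have hG2 : slopeDeriv a 1 z (p j) = G := hG1
    rw [sub_eq_zero.1 hj, hG2, hG] at e1
    refine mul_ne_zero k0 (Finset.prod_ne_zero_iff.2 fun i hi => ?_) e1
    exact sub_ne_zero.2 fun h' => (Finset.ne_of_mem_erase hi) (hp h').symm

end IsFactored

end PlanarWeb

end

/-! ### Residues of the fundamental form along `{y = 0}` -/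

noncomputable section

namespace PlanarWeb

open Filter Metric Set Polynomial

lemma continuousAt_rootA_rootB {d : ℕ} {a : Fin (d + 1) → ℂ × ℂ → ℂ} {u : (ℂ × ℂ) × ℂ}
    (ha : ∀ k, AnalyticAt ℂ (a k) u.1) (h : slopeDeriv a 1 u.1 u.2 ≠ 0) :
    ContinuousAt (fun u : (ℂ × ℂ) × ℂ => rootA a u.1 u.2) u ∧
      ContinuousAt (fun u : (ℂ × ℂ) × ℂ => rootB a u.1 u.2) u := by
  have hx := (analyticAt_slopePoly (u := u) fun k => analyticAt_partialX (ha k)).continuousAt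
  have hy := (analyticAt_slopePoly (u := u) fun k => analyticAt_partialY (ha k)).continuousAt
  have hd := fun m => (analyticAt_slopeDeriv m (u := u) ha).continuousAt
  have hp : ContinuousAt (fun u : (ℂ × ℂ) × ℂ => u.2) u := continuousAt_snd
  have hQ : ContinuousAt (fun u : (ℂ × ℂ) × ℂ => accelNum a u.1 u.2) u := hx.add (hp.mul hy)
  constructor
  · exact ((hQ.mul (((continuousAt_const.mul (hd 2)).div_const 2).sub
      ((hp.mul (hd 3)).div_const 6))).div ((hd 1).pow 2) (pow_ne_zero 2 h)).sub
      (continuousAt_const.mul (hy.div (hd 1) h))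
  · exact (hQ.mul (hd 3)).div (continuousAt_const.mul ((hd 1).pow 2))
      (mul_ne_zero (by norm_num) (pow_ne_zero 2 h))

namespace IsFactored

variable {ν n : ℕ} {a : Fin (ν + n + 1) → ℂ × ℂ → ℂ} {φ₀ : ℂ → ℂ} {φ : Fin n → ℂ → ℂ} {x₀ : ℂ}

/-- `ε = ∂ₚ∂_yF / ∂_yF` at `(x, 0, φ₀(x))`. -/
def eps (a : Fin (ν + n + 1) → ℂ × ℂ → ℂ) (φ₀ : ℂ → ℂ) (x : ℂ) : ℂ :=
  slopeDeriv (fun k => partialY (a k)) 1 (x, 0) (φ₀ x) /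
    slopePoly (fun k => partialY (a k)) (x, 0) (φ₀ x)

/-- The residue of the fundamental form along `{y = 0}`. -/
def resA (a : Fin (ν + n + 1) → ℂ × ℂ → ℂ) (φ₀ : ℂ → ℂ) (φ : Fin n → ℂ → ℂ) (x : ℂ) : ℂ :=
  residueA (ν + n) ν (φ₀ x) (∑ α, (φ₀ x - φ α x)⁻¹ - eps a φ₀ x) (eps a φ₀ x)

def resB (a : Fin (ν + n + 1) → ℂ × ℂ → ℂ) (φ₀ : ℂ → ℂ) (φ : Fin n → ℂ → ℂ) (x : ℂ) : ℂ :=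
  residueB ν (φ₀ x) (∑ α, (φ₀ x - φ α x)⁻¹ - eps a φ₀ x) (eps a φ₀ x)

lemma tendsto_sum_simple_roots {R : (ℂ × ℂ) × ℂ → ℂ} {q : Fin n → ℂ × ℂ → ℂ} (hν : ν ≠ 0)
    (hR : ∀ α, ContinuousAt R ((x₀, 0), q α (x₀, 0))) (hq : ∀ α, AnalyticAt ℂ (q α) (x₀, 0)) :
    Tendsto (fun t : ℂ => ∑ α, t ^ ν * R ((x₀, t ^ ν), q α (x₀, t ^ ν))) (𝓝[≠] 0) (𝓝 0) := by
  have h0 : Tendsto (fun t : ℂ => t ^ ν) (𝓝[≠] 0) (𝓝 0) := by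
    have : Continuous fun t : ℂ => t ^ ν := by fun_prop
    simpa [hν] using (this.tendsto 0).mono_left nhdsWithin_le_nhds
  have h1 : Tendsto (fun t : ℂ => ((x₀, t ^ ν) : ℂ × ℂ)) (𝓝[≠] 0) (𝓝 (x₀, 0)) :=
    tendsto_const_nhds.prodMk_nhds h0
  have h2 : ∀ α, Tendsto (fun t : ℂ => t ^ ν * R ((x₀, t ^ ν), q α (x₀, t ^ ν))) (𝓝[≠] 0)
      (𝓝 0) := fun α => by
    have := h0.mul ((hR α).tendsto.comp
      (h1.prodMk_nhds ((hq α).continuousAt.tendsto.comp h1)))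
    simpa using this
  simpa using tendsto_finsetSum Finset.univ fun α _ => h2 α

/-- The fundamental form has a simple pole along `{y = 0}`. -/
lemma tendsto_rootForm (h : IsFactored a φ₀ φ x₀)
    (hy : slopePoly (fun k => partialY (a k)) (x₀, 0) (φ₀ x₀) ≠ 0) :
    Tendsto (fun y => y * (rootForm a (x₀, y)).1) (𝓝[≠] 0) (𝓝 (resA a φ₀ φ x₀)) ∧
    Tendsto (fun y => y * (rootForm a (x₀, y)).2) (𝓝[≠] 0) (𝓝 (resB a φ₀ φ x₀)) := by
  obtain ⟨b, ζ, v, q, hu⟩ := h.exists_isUnfolding hy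
  have hν := h.two_le
  have hν0 : ν ≠ 0 := by omega
  obtain ⟨mA, mB, αA, αB, hmA, hmB, hαA, hαB, hev⟩ := hu.isBranch.exists_residues
  have heps : slopeDeriv b 1 (x₀, 0) (φ₀ x₀) / slopePoly b (x₀, 0) (φ₀ x₀) = eps a φ₀ x₀ := by
    rw [eps, ← slopeDeriv_zero b, ← slopeDeriv_zero (fun k => partialY (a k)),
      hu.isBranch.slopeDeriv_partialY, hu.isBranch.slopeDeriv_partialY]
  rw [heps, h.logDeriv_cofactor] at hαA hαB
  have hζ0 : ζ ≠ 0 := hu.primitive.ne_zero hν0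
  have hζν : ∀ j : ℕ, (ζ ^ j) ^ ν = 1 := fun j => by
    rw [← pow_mul, mul_comm, pow_mul, hu.primitive.pow_eq_one, one_pow]
  have hrot : ∀ j : ℕ, Tendsto (fun t => ζ ^ j * t) (𝓝[≠] 0) (𝓝[≠] 0) := fun j => by
    refine tendsto_nhdsWithin_iff.2 ⟨?_, ?_⟩
    · have : Continuous fun t : ℂ => ζ ^ j * t := by fun_prop
      simpa using (this.tendsto 0).mono_left nhdsWithin_le_nhds
    · filter_upwards [self_mem_nhdsWithin] with t ht
      exact mul_ne_zero (pow_ne_zero _ hζ0) ht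
  have hlead : ∀ᶠ t in 𝓝 (0 : ℂ), a 0 (x₀, t ^ ν) ≠ 0 :=
    ((tendsto_unfold hν0 x₀).eventually
      ((h.coeff 0).continuousAt.eventually_ne h.lead)).curry_nhds.self_of_nhds
  have hsum : ∀ᶠ t in 𝓝[≠] (0 : ℂ),
      t ^ ν * (rootForm a (x₀, t ^ ν)).1 =
        ∑ j : Fin ν, mA (ζ ^ (j : ℕ) * t) / (ζ ^ (j : ℕ) * t) +
          ∑ α, t ^ ν * rootA a (x₀, t ^ ν) (q α (x₀, t ^ ν)) ∧
      t ^ ν * (rootForm a (x₀, t ^ ν)).2 =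
        ∑ j : Fin ν, mB (ζ ^ (j : ℕ) * t) / (ζ ^ (j : ℕ) * t) +
          ∑ α, t ^ ν * rootB a (x₀, t ^ ν) (q α (x₀, t ^ ν)) := by
    filter_upwards [nhdsWithin_le_nhds hlead, nhdsWithin_le_nhds hu.roots.curry_nhds.self_of_nhds,
      eventually_all.2 fun j : Fin ν => (hrot j).eventually hev, self_mem_nhdsWithin]
      with t h1 h2 h3 ht
    obtain ⟨p, hp, hr, hpl, hpr⟩ := h2 ht
    have hinj : Function.Injective (p ∘ finSumFinEquiv.symm) :=
      hp.comp finSumFinEquiv.symm.injective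
    rw [rootForm_eq_sum h1 (slopePolynomial_eq_of_roots _ hinj fun j => hr _),
      ← finSumFinEquiv.sum_comp]
    simp only [Function.comp_apply, Equiv.symm_apply_apply, Fintype.sum_sum_type, Prod.fst_add,
      Prod.snd_add, Prod.fst_sum, Prod.snd_sum, mul_add, Finset.mul_sum, hpr, hpl]
    simp only [mul_pow, hζν, one_mul] at h3
    constructor
    · rw [Finset.sum_congr rfl fun j _ => (h3 j).1]
    · rw [Finset.sum_congr rfl fun j _ => (h3 j).2]
  have hcont := fun α => continuousAt_rootA_rootB (u := ((x₀, 0), q α (x₀, 0))) h.coeff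
    (by simpa only [hu.q_zero α] using (h.slopeDeriv_ne_zero α).2)
  constructor
  -- The conjugate branches together tend to `ν αA`, and the simple roots contribute bounded terms
  -- multiplied by `t ^ ν`.
  · refine tendsto_of_comp_pow hν0 (Tendsto.congr' (hsum.mono fun t ht => ht.1.symm) ?_)
    have := (tendsto_sum_rootsOfUnity hν hu.primitive hmA).add
      (tendsto_sum_simple_roots hν0 (fun α => (hcont α).1) hu.analytic_q)
    rwa [hαA, add_zero] at this
  · refine tendsto_of_comp_pow hν0 (Tendsto.congr' (hsum.mono fun t ht => ht.2.symm) ?_)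
    have := (tendsto_sum_rootsOfUnity hν hu.primitive hmB).add
      (tendsto_sum_simple_roots hν0 (fun α => (hcont α).2) hu.analytic_q)
    rwa [hαB, add_zero] at this

end IsFactored

end PlanarWeb

end

/-! ### Polar part of the curvature -/

noncomputable section

namespace PlanarWeb

open Filter Metric Set

/-- The exterior derivative of `(A dx + B dy) / y`. -/
lemma sq_mul_extD_of_simple_pole {α : ℂ × ℂ → ℂ × ℂ} {A B : ℂ × ℂ → ℂ} {z : ℂ × ℂ}
    (hA : AnalyticAt ℂ A z) (hB : AnalyticAt ℂ B z) (hz : z.2 ≠ 0)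
    (h : ∀ᶠ w in 𝓝 z, A w = w.2 * (α w).1 ∧ B w = w.2 * (α w).2) :
    z.2 ^ 2 * extD α z = z.2 * (partialX B z - partialY A z) + A z := by
  have hne : ∀ᶠ w : ℂ × ℂ in 𝓝 z, w.2 ≠ 0 := continuous_snd.continuousAt.eventually_ne hz
  have h1 : α =ᶠ[𝓝 z] fun w => ((w.2)⁻¹ * A w, (w.2)⁻¹ * B w) := by
    filter_upwards [h, hne] with w hw h0
    rw [hw.1, hw.2, inv_mul_cancel_left₀ h0, inv_mul_cancel_left₀ h0]
  have hs : DifferentiableAt ℂ (fun w : ℂ × ℂ => w.2) z := differentiableAt_snd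
  have hi : DifferentiableAt ℂ (fun w : ℂ × ℂ => (w.2)⁻¹) z := hs.inv hz
  have hx : partialX (fun w : ℂ × ℂ => w.2) z = 0 := by
    simp [partialX, fderiv_snd]
  have hy : partialY (fun w : ℂ × ℂ => w.2) z = 1 := by
    simp [partialY, fderiv_snd]
  rw [extD_congr h1, extD]
  simp only
  rw [partialX_mul hi hB.differentiableAt, partialY_mul hi hA.differentiableAt, partialX_inv hs hz,
    partialY_inv hs hz, hx, hy]
  field_simp
  ring

lemma exists_eq_sq_mul {g : ℂ → ℂ} (hg : AnalyticAt ℂ g 0) (h0 : g 0 = 0) (h1 : deriv g 0 = 0) :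
    ∃ k : ℂ → ℂ, AnalyticAt ℂ k 0 ∧ ∀ᶠ y in 𝓝 0, g y = y ^ 2 * k y := by
  have h : ((2 : ℕ) : ℕ∞) ≤ analyticOrderAt g 0 := by
    rw [natCast_le_analyticOrderAt_iff_iteratedDeriv_eq_zero hg]
    intro i hi
    interval_cases i
    · simpa using h0
    · simpa [iteratedDeriv_one] using h1
  obtain ⟨k, hk, hev⟩ := (natCast_le_analyticOrderAt hg).1 h
  exact ⟨k, hk, by simpa using hev⟩

namespace IsFactored

variable {ν n : ℕ} {a : Fin (ν + n + 1) → ℂ × ℂ → ℂ} {φ₀ : ℂ → ℂ} {φ : Fin n → ℂ → ℂ} {x₀ : ℂ}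
  {M : Type*} [TopologicalSpace M] [ChartedSpace (ℂ × ℂ) M]
  {e : OpenPartialHomeomorph M (ℂ × ℂ)} {W : Web (ν + n) M}

lemma continuousAt_slopePoly_partialY (h : IsFactored a φ₀ φ x₀) :
    ContinuousAt (fun x => slopePoly (fun k => partialY (a k)) (x, 0) (φ₀ x)) x₀ :=
  ((analyticAt_slopePoly (u := ((x₀, 0), φ₀ x₀)) fun k =>
    analyticAt_partialY (h.coeff k)).continuousAt).comp (f := fun x : ℂ => ((x, (0 : ℂ)), φ₀ x))
      (x := x₀) ((continuousAt_axis x₀).prodMk h.analyticAt₀.continuousAt)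

/-- By `tendsto_rootForm`, `y * rootForm a` is bounded on each slice near the axis, hence extends
holomorphically with the residues as boundary values. The formula is then the exterior derivative of
`(A dx + B dy) / y`. -/
lemma exists_polar_part (he : e ∈ Coord M) (h : IsFactored a φ₀ φ x₀)
    (ha : IsLocalEquation W e (x₀, 0) a)
    (hy : slopePoly (fun k => partialY (a k)) (x₀, 0) (φ₀ x₀) ≠ 0) :
    ∃ A B : ℂ × ℂ → ℂ, AnalyticAt ℂ A (x₀, 0) ∧ AnalyticAt ℂ B (x₀, 0) ∧
      (∀ᶠ x in 𝓝 x₀, A (x, 0) = resA a φ₀ φ x ∧ B (x, 0) = resB a φ₀ φ x) ∧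
      ∀ᶠ z in 𝓝 ((x₀, 0) : ℂ × ℂ), z.2 ≠ 0 →
        z.2 ^ 2 * curvature W e z = z.2 * (partialX B z - partialY A z) + A z := by
  have hdisc := h.mem_discriminant_iff he ha hy
  have h0 : ∀ᶠ z in 𝓝 ((x₀, 0) : ℂ × ℂ), a 0 z ≠ 0 :=
    (h.coeff 0).continuousAt.eventually_ne h.lead
  have hgood : ∀ᶠ x in 𝓝 x₀, IsFactored a φ₀ φ x ∧
      slopePoly (fun k => partialY (a k)) (x, 0) (φ₀ x) ≠ 0 :=
    h.eventually.and (h.continuousAt_slopePoly_partialY.eventually_ne hy)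
  have hall : ∀ᶠ z in 𝓝 ((x₀, 0) : ℂ × ℂ), (e.symm z ∈ discriminant W ↔ z.2 = 0) ∧ a 0 z ≠ 0 ∧
      IsLocalEquation W e z a ∧ IsFactored a φ₀ φ z.1 ∧
      slopePoly (fun k => partialY (a k)) (z.1, 0) (φ₀ z.1) ≠ 0 := by
    have hfst : Tendsto (fun u : ℂ × ℂ => u.1) (𝓝 (x₀, 0)) (𝓝 x₀) := continuous_fst.tendsto _
    exact hdisc.and (h0.and (ha.eventually.and (hfst.eventually hgood)))
  obtain ⟨r, hr, hball⟩ := Metric.nhds_basis_closedBall.eventually_iff.1 hall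
  have hP := fun z (h1 : z.1 ∈ closedBall x₀ r) (h2 : z.2 ∈ closedBall (0 : ℂ) r) =>
    hball (x := z) (by rw [← closedBall_prod_same]; exact ⟨h1, h2⟩)
  have hroot : ∀ z : ℂ × ℂ, z.1 ∈ closedBall x₀ r → z.2 ∈ closedBall (0 : ℂ) r → z.2 ≠ 0 →
      AnalyticAt ℂ (rootForm a) z := fun z h1 h2 h3 => by
    obtain ⟨k1, k2, k3, -⟩ := hP z h1 h2
    obtain ⟨V, p, hzV, hV, -⟩ := k3.exists_isRootSystem he k2 fun h' => h3 (k1.1 h')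
    exact hV.analyticAt_rootForm hzV
  have hfac : ∀ x ∈ ball x₀ r, IsFactored a φ₀ φ x ∧
      slopePoly (fun k => partialY (a k)) (x, 0) (φ₀ x) ≠ 0 := fun x hx =>
    (hP (x, 0) (ball_subset_closedBall hx) (mem_closedBall_self hr.le)).2.2.2
  have hbdd : ∀ {f : ℂ → ℂ} {c : ℂ}, Tendsto f (𝓝[≠] 0) (𝓝 c) →
      ∃ B : ℝ, ∀ᶠ y in 𝓝[≠] (0 : ℂ), ‖f y‖ ≤ B := fun hf => hf.norm.isBoundedUnder_le
  obtain ⟨A, hA, hAe⟩ := exists_analytic_extension (K := fun z => z.2 * (rootForm a z).1) hr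
    (fun z h1 h2 h3 => analyticAt_snd.mul (analyticAt_fst.fun_comp (hroot z h1 h2 h3)))
    (mem_ball_self hr) (by
      refine Eventually.frequently ?_
      filter_upwards [nhdsWithin_le_nhds (ball_mem_nhds x₀ hr)] with x hx
      exact hbdd ((hfac x hx).1.tendsto_rootForm (hfac x hx).2).1)
  obtain ⟨B, hB, hBe⟩ := exists_analytic_extension (K := fun z => z.2 * (rootForm a z).2) hr
    (fun z h1 h2 h3 => analyticAt_snd.mul (analyticAt_snd.fun_comp (hroot z h1 h2 h3)))
    (mem_ball_self hr) (by
      refine Eventually.frequently ?_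
      filter_upwards [nhdsWithin_le_nhds (ball_mem_nhds x₀ hr)] with x hx
      exact hbdd ((hfac x hx).1.tendsto_rootForm (hfac x hx).2).2)
  have hmem : ∀ x ∈ ball x₀ r, ((x, (0 : ℂ)) : ℂ × ℂ) ∈ ball x₀ r ×ˢ ball (0 : ℂ) r :=
    fun x hx => ⟨hx, mem_ball_self hr⟩
  have hslice : ∀ {f K : ℂ × ℂ → ℂ}, AnalyticOnNhd ℂ f (ball x₀ r ×ˢ ball 0 r) →
      (∀ z ∈ ball x₀ r ×ˢ ball (0 : ℂ) r, z.2 ≠ 0 → f z = K z) → ∀ x ∈ ball x₀ r, ∀ c,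
      Tendsto (fun y => K (x, y)) (𝓝[≠] 0) (𝓝 c) → f (x, 0) = c := by
    intro f K hf hfK x hx c hc
    have h1 : Tendsto (fun y => f (x, y)) (𝓝[≠] 0) (𝓝 (f (x, 0))) :=
      ((hasDerivAt_slice (hf _ (hmem x hx))).continuousAt.tendsto).mono_left nhdsWithin_le_nhds
    refine tendsto_nhds_unique (h1.congr' ?_) hc
    filter_upwards [nhdsWithin_le_nhds (ball_mem_nhds 0 hr), self_mem_nhdsWithin] with y hy hy0
    exact hfK (x, y) ⟨hx, hy⟩ hy0
  refine ⟨A, B, hA _ (hmem x₀ (mem_ball_self hr)), hB _ (hmem x₀ (mem_ball_self hr)), ?_, ?_⟩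
  · filter_upwards [ball_mem_nhds x₀ hr] with x hx
    have ht := (hfac x hx).1.tendsto_rootForm (hfac x hx).2
    exact ⟨hslice hA hAe x hx _ ht.1, hslice hB hBe x hx _ ht.2⟩
  · filter_upwards [(isOpen_ball.prod isOpen_ball).mem_nhds (hmem x₀ (mem_ball_self hr))]
      with z hz hz0
    obtain ⟨k1, k2, k3, -⟩ := hP z (ball_subset_closedBall hz.1) (ball_subset_closedBall hz.2)
    rw [k3.curvature_eq he k2 fun h' => hz0 (k1.1 h')]
    refine sq_mul_extD_of_simple_pole (hA z hz) (hB z hz) hz0 ?_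
    filter_upwards [(isOpen_ball.prod isOpen_ball).mem_nhds hz,
      continuous_snd.continuousAt.eventually_ne hz0] with w hw hw0
    exact ⟨hAe w hw hw0, hBe w hw hw0⟩

end IsFactored

end PlanarWeb

end

noncomputable section

namespace PlanarWeb

open Filter Metric Set

/-! ### The function `ψ` and the residue -/

section psi

variable {d : ℕ} {a : Fin (d + 1) → ℂ × ℂ → ℂ} {z : ℂ × ℂ}

lemma partialY_slopePoly (ha : ∀ k, AnalyticAt ℂ (a k) z) (p : ℂ) :
    partialY (fun w => slopePoly a w p) z = slopePoly (fun k => partialY (a k)) z p := by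
  have h : HasFDerivAt (fun w => slopePoly a w p)
      (∑ k : Fin (d + 1), p ^ (d - (k : ℕ)) • fderiv ℂ (a k) z) z := by
    simp only [slopePoly]
    exact HasFDerivAt.fun_sum fun k _ => (ha k).differentiableAt.hasFDerivAt.mul_const _
  rw [partialY, h.fderiv]
  simp [slopePoly, partialY, mul_comm]

lemma deriv_partialY_slopePoly (ha : ∀ k, AnalyticAt ℂ (a k) z) (p : ℂ) :
    deriv (fun p => partialY (fun w => slopePoly a w p) z) p =
      slopeDeriv (fun k => partialY (a k)) 1 z p := by
  have : (fun p => partialY (fun w => slopePoly a w p) z) =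
      slopeDeriv (fun k => partialY (a k)) 0 z :=
    funext fun p => by rw [partialY_slopePoly ha, slopeDeriv_zero]
  rw [this]
  exact (hasDerivAt_slopeDeriv _ 0 z p).deriv

lemma psi_eq {n ν : ℕ} {φ₀ : ℂ → ℂ} {φ : Fin n → ℂ → ℂ} {x : ℂ}
    (ha : ∀ k, AnalyticAt ℂ (a k) (x, 0)) :
    psi ν a φ₀ φ x = ((ν : ℂ) - 2) * ((d : ℂ) - φ₀ x *
      (slopeDeriv (fun k => partialY (a k)) 1 (x, 0) (φ₀ x) /
        slopePoly (fun k => partialY (a k)) (x, 0) (φ₀ x))) -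
      2 * ((ν : ℂ) + 1) * ∑ α, φ α x / (φ₀ x - φ α x) := by
  rw [psi, deriv_partialY_slopePoly ha, partialY_slopePoly ha]

end psi

namespace IsFactored

variable {ν n : ℕ} {a : Fin (ν + n + 1) → ℂ × ℂ → ℂ} {φ₀ : ℂ → ℂ} {φ : Fin n → ℂ → ℂ} {x₀ : ℂ}

/-- `φ_α / (φ₀ - φ_α) = φ₀ / (φ₀ - φ_α) - 1`, so the sum in `psi` costs `n`, and `d = ν + n` makes
the constants match. -/
lemma resA_eq (h : IsFactored a φ₀ φ x₀) :
    6 * ν * resA a φ₀ φ x₀ = -(((ν : ℂ) - 1) * (φ₀ x₀ * psi ν a φ₀ φ x₀)) := by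
  have hν : (ν : ℂ) ≠ 0 := Nat.cast_ne_zero.2 (by have := h.two_le; omega)
  have hsum : ∑ α, φ α x₀ / (φ₀ x₀ - φ α x₀) = φ₀ x₀ * ∑ α, (φ₀ x₀ - φ α x₀)⁻¹ - n := by
    have : ∀ α, φ α x₀ / (φ₀ x₀ - φ α x₀) = φ₀ x₀ * (φ₀ x₀ - φ α x₀)⁻¹ - 1 := fun α => by
      have := sub_ne_zero.2 (h.ne₀ α).symm
      field_simp
      ring
    rw [Finset.sum_congr rfl fun α _ => this α, Finset.sum_sub_distrib, ← Finset.mul_sum]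
    simp
  rw [psi_eq h.coeff, hsum, resA, residueA, residueB, eps]
  generalize slopeDeriv (fun k => partialY (a k)) 1 (x₀, 0) (φ₀ x₀) /
    slopePoly (fun k => partialY (a k)) (x₀, 0) (φ₀ x₀) = ε
  push_cast
  field_simp
  ring

lemma resA_eq_zero_iff (h : IsFactored a φ₀ φ x₀) :
    resA a φ₀ φ x₀ = 0 ↔ φ₀ x₀ * psi ν a φ₀ φ x₀ = 0 := by
  have h1 := h.resA_eq
  have hν : (6 * ν : ℂ) ≠ 0 :=
    mul_ne_zero (by norm_num) (Nat.cast_ne_zero.2 (by have := h.two_le; omega))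
  have hν1 : (ν : ℂ) - 1 ≠ 0 := sub_ne_zero.2 (by
    have := h.two_le
    exact_mod_cast (by omega : ν ≠ 1))
  constructor
  · intro h0
    rw [h0, mul_zero, zero_eq_neg] at h1
    exact (mul_eq_zero.1 h1).resolve_left hν1
  · intro h0
    rw [h0, mul_zero, neg_zero] at h1
    exact (mul_eq_zero.1 h1).resolve_left hν

/-- Where the residue vanishes, it is closed. -/
lemma resB_eventually_const (h : IsFactored a φ₀ φ x₀)
    (h0 : ∀ᶠ x in 𝓝[≠] x₀, resA a φ₀ φ x = 0) :
    ∃ c, ∀ᶠ x in 𝓝[≠] x₀, resB a φ₀ φ x = c := by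
  -- If `φ₀ ≡ 0`, `residueB` has no variable part. Otherwise `resA = 0` can be divided by `φ₀`,
  -- which leaves the constant in `residueA`.
  rcases h.analyticAt₀.eventually_eq_zero_or_eventually_ne_zero with h1 | h1
  · refine ⟨-(((ν : ℂ) - 1) / 6) * (ν - 2), ?_⟩
    filter_upwards [nhdsWithin_le_nhds h1] with x hx
    rw [resB, residueB, hx, zero_mul, add_zero]
  · refine ⟨((ν : ℂ) - 1) * (ν - 2 - 3 * ((ν + n : ℕ) - 2)) / 6, ?_⟩
    filter_upwards [h1, h0] with x hx hx0
    rw [resA, residueA] at hx0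
    rw [resB]
    refine mul_left_cancel₀ hx ?_
    linear_combination -hx0

/-! ### The residue and the extension of the curvature -/

section web

variable {M : Type*} [TopologicalSpace M] [ChartedSpace (ℂ × ℂ) M]
  {e : OpenPartialHomeomorph M (ℂ × ℂ)} {W : Web (ν + n) M}

/-- If `K` extends, then `y² K → 0` on every slice near `x₀`, whereas the polar formula has the
limit `A(x, 0) = resA`. -/
lemma eventually_resA_eq_zero (he : e ∈ Coord M) (h : IsFactored a φ₀ φ x₀)
    (ha : IsLocalEquation W e (x₀, 0) a)
    (hy : slopePoly (fun k => partialY (a k)) (x₀, 0) (φ₀ x₀) ≠ 0)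
    (hK : ExtendsAt W e (e.symm (x₀, 0))) : ∀ᶠ x in 𝓝 x₀, resA a φ₀ φ x = 0 := by
  obtain ⟨A, B, hA, hB, hAB, hpol⟩ := h.exists_polar_part he ha hy
  obtain ⟨f, hf, hfe⟩ := hK
  rw [e.right_inv ha.mem_target] at hf hfe
  have hdisc := h.mem_discriminant_iff he ha hy
  have hax := continuousAt_axis x₀
  filter_upwards [hAB, hax.eventually hA.eventually_analyticAt,
    hax.eventually hB.eventually_analyticAt, hax.eventually hf.eventually_analyticAt,
    (hpol.and (hfe.and hdisc)).curry_nhds] with x k1 k2 k3 k4 k5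
  have hs : ContinuousAt (fun y : ℂ => ((x, y) : ℂ × ℂ)) 0 := by fun_prop
  have c1 : ContinuousAt (fun y => y ^ 2 * f (x, y)) 0 :=
    (continuousAt_id.pow 2).mul (k4.continuousAt.comp (f := fun y : ℂ => (x, y)) hs)
  have c2 : ContinuousAt (fun y => y * (partialX B (x, y) - partialY A (x, y)) + A (x, y)) 0 :=
    (continuousAt_id.mul ((((analyticAt_partialX k3).sub (analyticAt_partialY k2)).continuousAt).comp
      (f := fun y : ℂ => (x, y)) hs)).add (k2.continuousAt.comp (f := fun y : ℂ => (x, y)) hs)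
  have h1 := tendsto_nhds_unique ((c1.tendsto.mono_left nhdsWithin_le_nhds).congr' ?_)
    (c2.tendsto.mono_left (nhdsWithin_le_nhds (s := {0}ᶜ)))
  · rw [← k1.1]
    simpa using h1.symm
  · filter_upwards [nhdsWithin_le_nhds k5, self_mem_nhdsWithin] with y hy hy0
    rw [← hy.1 hy0, hy.2.1 fun h' => hy0 (hy.2.2.1 h')]

/-- On generic slices the numerator of `K` vanishes to order two at `y = 0`, so `K` is bounded
there. Only punctured slices in `x` are needed, because `exists_analytic_extension` asks for
frequently many. -/
lemma extendsAt_of_eventually_resA_eq_zero [IsManifold I₂ ω M] (he : e ∈ Coord M)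
    (h : IsFactored a φ₀ φ x₀) (ha : IsLocalEquation W e (x₀, 0) a)
    (hy : slopePoly (fun k => partialY (a k)) (x₀, 0) (φ₀ x₀) ≠ 0)
    (h0 : ∀ᶠ x in 𝓝[≠] x₀, resA a φ₀ φ x = 0) : ExtendsAt W e (e.symm (x₀, 0)) := by
  obtain ⟨A, B, hA, hB, hAB, hpol⟩ := h.exists_polar_part he ha hy
  obtain ⟨c, hc⟩ := h.resB_eventually_const h0
  have hν := h.two_le
  have hall : ∀ᶠ z in 𝓝 ((x₀, 0) : ℂ × ℂ), (e.symm z ∈ discriminant W ↔ z.2 = 0) ∧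
      z ∈ e.target :=
    (h.mem_discriminant_iff he ha hy).and (e.open_target.mem_nhds ha.mem_target)
  obtain ⟨r, hr, hball⟩ := Metric.nhds_basis_closedBall.eventually_iff.1 hall
  have hP := fun z (h1 : z.1 ∈ closedBall x₀ r) (h2 : z.2 ∈ closedBall (0 : ℂ) r) =>
    hball (x := z) (by rw [← closedBall_prod_same]; exact ⟨h1, h2⟩)
  have hax := continuousAt_axis x₀
  have hbd : ∀ᶠ x in 𝓝[≠] x₀, ∃ b : ℝ, ∀ᶠ y in 𝓝[≠] (0 : ℂ), ‖curvature W e (x, y)‖ ≤ b := by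
    have hc' : ∀ᶠ x in 𝓝[≠] x₀, ∀ᶠ x' in 𝓝 x, resB a φ₀ φ x' = c ∧ B (x', 0) = resB a φ₀ φ x' := by
      have h1 := hc.and (nhdsWithin_le_nhds (hAB.mono fun x hx => hx.2))
      filter_upwards [eventually_eventually_nhdsWithin.2 h1, self_mem_nhdsWithin] with x hx hx0
      rwa [isOpen_compl_singleton.nhdsWithin_eq hx0] at hx
    filter_upwards [nhdsWithin_le_nhds hAB, h0, hc',
      nhdsWithin_le_nhds (hax.eventually hA.eventually_analyticAt),
      nhdsWithin_le_nhds (hax.eventually hB.eventually_analyticAt),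
      nhdsWithin_le_nhds hpol.curry_nhds] with x k1 k2 k3 k4 k5 k6
    have hBx : partialX B (x, 0) = 0 := by
      have hx : HasDerivAt (fun x : ℂ => ((x, 0) : ℂ × ℂ)) (1, 0) x :=
        (hasDerivAt_id x).prodMk (hasDerivAt_const x (0 : ℂ))
      have d1 : HasDerivAt (fun x => B (x, 0)) (partialX B (x, 0)) x :=
        k5.differentiableAt.hasFDerivAt.comp_hasDerivAt (f := fun x : ℂ => ((x, 0) : ℂ × ℂ)) x hx
      exact d1.unique ((hasDerivAt_const x c).congr_of_eventuallyEq
        (k3.mono fun x' hx' => hx'.2.trans hx'.1))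
    have hsl : AnalyticAt ℂ (fun y : ℂ => ((x, y) : ℂ × ℂ)) 0 := analyticAt_const.prod analyticAt_id
    have hCa : AnalyticAt ℂ (fun y => partialX B (x, y) - partialY A (x, y)) 0 :=
      AnalyticAt.fun_comp (g := fun z => partialX B z - partialY A z) (f := fun y : ℂ => (x, y))
        ((analyticAt_partialX k5).sub (analyticAt_partialY k4)) hsl
    have hAa : AnalyticAt ℂ (fun y => A (x, y)) 0 :=
      AnalyticAt.fun_comp (g := A) (f := fun y : ℂ => (x, y)) k4 hsl
    have hd := ((hasDerivAt_id' (0 : ℂ)).fun_mul hCa.differentiableAt.hasDerivAt).fun_add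
      (hasDerivAt_slice k4)
    -- The numerator `y (∂ₓB - ∂_yA) + A` has the value `A(x, 0) = 0`, and its `y`-derivative is
    -- `∂ₓB - ∂_yA + ∂_yA = ∂ₓB(x, 0) = 0`.
    obtain ⟨k, hk, hev⟩ := exists_eq_sq_mul ((analyticAt_id.fun_mul hCa).fun_add hAa)
      (by simp [k1.1, k2]) (by
        refine hd.deriv.trans ?_
        simp [hBx])
    refine ⟨‖k 0‖ + 1, ?_⟩
    filter_upwards [nhdsWithin_le_nhds k6, nhdsWithin_le_nhds hev, self_mem_nhdsWithin,
      nhdsWithin_le_nhds (hk.continuousAt.norm.eventually_lt continuousAt_const (lt_add_one _))]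
      with y j1 j2 j3 j4
    have hy2 : y ^ 2 ≠ 0 := pow_ne_zero 2 j3
    have : curvature W e (x, y) = k y := mul_left_cancel₀ hy2 ((j1 j3).trans j2)
    rw [this]
    exact j4.le
  obtain ⟨f, hf, hfe⟩ := exists_analytic_extension (K := curvature W e) hr (fun z h1 h2 h3 =>
    analyticAt_curvature (by omega) he (hP z h1 h2).2 fun h' => h3 ((hP z h1 h2).1.1 h'))
    (mem_ball_self hr) hbd.frequently
  have hmem : ((x₀, 0) : ℂ × ℂ) ∈ ball x₀ r ×ˢ ball (0 : ℂ) r :=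
    ⟨mem_ball_self hr, mem_ball_self hr⟩
  rw [ExtendsAt, e.right_inv ha.mem_target]
  refine ⟨f, hf _ hmem, ?_⟩
  filter_upwards [(isOpen_ball.prod isOpen_ball).mem_nhds hmem] with z hz hzd
  refine (hfe z hz fun hz0 => hzd ?_).symm
  exact (hP z (ball_subset_closedBall hz.1) (ball_subset_closedBall hz.2)).1.2 hz0

end web

end IsFactored

end PlanarWeb

end

noncomputable section

namespace PlanarWeb

open Filter Metric Set

/-! ### Generic points of `{y = 0}` -/

variable {M : Type*} [TopologicalSpace M] {e : OpenPartialHomeomorph M (ℂ × ℂ)}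

lemma isOpen_axis (e : OpenPartialHomeomorph M (ℂ × ℂ)) : IsOpen (axis e) :=
  e.open_target.preimage (by fun_prop : Continuous fun x : ℂ => ((x, 0) : ℂ × ℂ))

lemma eventually_eventually_nhdsNE_nhds {P : ℂ → Prop} {x₁ : ℂ} (h : ∀ᶠ x in 𝓝[≠] x₁, P x) :
    ∀ᶠ x in 𝓝[≠] x₁, ∀ᶠ y in 𝓝 x, P y := by
  filter_upwards [eventually_eventually_nhdsWithin.2 h, self_mem_nhdsWithin] with x hx hx0
  rwa [isOpen_compl_singleton.nhdsWithin_eq hx0] at hx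

/-- In the coordinate `x`, a relatively open dense subset of `D` becomes an open dense subset of the
axis. It therefore accumulates at every point and meets any condition valid off a discrete set. -/
lemma frequently_of_forGeneric {D : Set M} {P : M → Prop} (h : ForGeneric D P)
    (hDe : D ∩ e.source = {m ∈ e.source | (e m).2 = 0}) {x₁ : ℂ} (hx : x₁ ∈ axis e) :
    ∃ᶠ x in 𝓝[≠] x₁, x ∈ axis e ∧ P (e.symm (x, 0)) := by
  obtain ⟨O, hO, hDO, hP⟩ := h
  have hD : ∀ x ∈ axis e, e.symm (x, 0) ∈ D := fun x hx => by
    have : e.symm (x, 0) ∈ D ∩ e.source := by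
      rw [hDe]
      exact ⟨e.map_target hx, by rw [e.right_inv hx]⟩
    exact this.1
  set T : Set ℂ := {x | x ∈ axis e ∧ e.symm (x, 0) ∈ O} with hT
  have hTo : IsOpen T := by
    have := (e.isOpen_inter_preimage_symm hO).preimage
      (by fun_prop : Continuous fun x : ℂ => ((x, 0) : ℂ × ℂ))
    exact this
  have hm : e.symm (x₁, 0) ∈ e.source := e.map_target hx
  have hcl : ∃ᶠ x in 𝓝 x₁, x ∈ T := by
    have h1 := mem_closure_iff_frequently.1 (hDO (hD x₁ hx))
    have h2 : Tendsto (fun m => (e m).1) (𝓝 (e.symm (x₁, 0))) (𝓝 x₁) := by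
      have := continuous_fst.continuousAt.tendsto.comp (e.continuousAt hm).tendsto
      rwa [e.right_inv hx] at this
    refine h2.frequently ((h1.and_eventually (e.open_source.mem_nhds hm)).mono ?_)
    rintro m ⟨⟨hmD, hmO⟩, hms⟩
    have h0 : (e m).2 = 0 := by
      have : m ∈ D ∩ e.source := ⟨hmD, hms⟩
      rw [hDe] at this
      exact this.2
    have hpt : ((e m).1, (0 : ℂ)) = e m := Prod.ext rfl h0.symm
    refine ⟨?_, ?_⟩
    · show ((e m).1, (0 : ℂ)) ∈ e.target
      rw [hpt]
      exact e.map_source hms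
    · rw [hpt, e.left_inv hms]
      exact hmO
  have hne : ∃ᶠ x in 𝓝[≠] x₁, x ∈ T := by
    by_cases h1 : x₁ ∈ T
    · exact (Filter.Eventually.filter_mono nhdsWithin_le_nhds (hTo.mem_nhds h1)).frequently
    · rw [frequently_nhdsWithin_iff]
      exact hcl.mono fun x hx => ⟨hx, fun h' => h1 (h' ▸ hx)⟩
  exact hne.mono fun x hx => ⟨hx.1, hP _ ⟨hD x hx.1, hx.2⟩⟩

lemma meromorphicOn_slopePoly {d : ℕ} {c : Fin (d + 1) → ℂ × ℂ → ℂ} {φ₀ : ℂ → ℂ} {U : Set ℂ}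
    (hc : ∀ k, ∀ x ∈ U, AnalyticAt ℂ (c k) (x, 0)) (hφ : MeromorphicOn φ₀ U) (m : ℕ) :
    MeromorphicOn (fun x => slopeDeriv c m (x, 0) (φ₀ x)) U := by
  intro x hx
  simp only [slopeDeriv_eq_sum]
  refine MeromorphicAt.fun_sum fun k _ => ?_
  have h1 : AnalyticAt ℂ (fun x => c k (x, 0)) x :=
    AnalyticAt.fun_comp (f := fun x : ℂ => ((x, 0) : ℂ × ℂ)) (hc k x hx)
      (analyticAt_id.prod analyticAt_const)
  exact h1.meromorphicAt.fun_mul ((MeromorphicAt.const _ x).fun_mul ((hφ x hx).fun_pow _))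

lemma meromorphicOn_psi {d n ν : ℕ} {a : Fin (d + 1) → ℂ × ℂ → ℂ} {φ₀ : ℂ → ℂ} {φ : Fin n → ℂ → ℂ}
    (ha : ∀ k, AnalyticOnNhd ℂ (a k) e.target) (hφ₀ : MeromorphicOn φ₀ (axis e))
    (hφ : ∀ α, MeromorphicOn (φ α) (axis e)) : MeromorphicOn (psi ν a φ₀ φ) (axis e) := by
  have hE := fun m => meromorphicOn_slopePoly (U := axis e)
    (fun k x hx => analyticAt_partialY (ha k (x, 0) hx)) hφ₀ m
  intro x hx
  have h1 : psi ν a φ₀ φ =ᶠ[𝓝[≠] x] fun x => ((ν : ℂ) - 2) * ((d : ℂ) - φ₀ x *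
      (slopeDeriv (fun k => partialY (a k)) 1 (x, 0) (φ₀ x) /
        slopeDeriv (fun k => partialY (a k)) 0 (x, 0) (φ₀ x))) -
      2 * ((ν : ℂ) + 1) * ∑ α, φ α x / (φ₀ x - φ α x) := by
    filter_upwards [nhdsWithin_le_nhds ((isOpen_axis e).mem_nhds hx)] with x' hx'
    rw [psi_eq fun k => ha k _ hx', slopeDeriv_zero]
  refine MeromorphicAt.congr ?_ h1.symm
  refine MeromorphicAt.fun_sub ?_ ?_
  · exact (MeromorphicAt.const _ x).fun_mul ((MeromorphicAt.const _ x).fun_sub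
      ((hφ₀ x hx).fun_mul ((hE 1 x hx).fun_div (hE 0 x hx))))
  · exact (MeromorphicAt.const _ x).fun_mul (MeromorphicAt.fun_sum fun α _ =>
      (hφ α x hx).fun_div ((hφ₀ x hx).fun_sub (hφ α x hx)))

variable [ChartedSpace (ℂ × ℂ) M]

/-- Otherwise `a 0` vanishes identically on the axis near `x₁`, the hypothesis makes all of `F(x, 0,
·)` vanish there, and the forms defining the web have non-isolated zeros. -/
lemma eventually_lead_ne_zero {d : ℕ} {W : Web d M} {a : Fin (d + 1) → ℂ × ℂ → ℂ}
    (he : e ∈ Coord M) (ha : IsImplicitEquation W e a) {x₁ : ℂ} (hx : x₁ ∈ axis e)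
    (h : ∀ᶠ x in 𝓝[≠] x₁, a 0 (x, 0) = 0 → ∀ p, slopePoly a (x, 0) p = 0) :
    ∀ᶠ x in 𝓝[≠] x₁, a 0 (x, 0) ≠ 0 := by
  have hsl : AnalyticAt ℂ (fun x : ℂ => ((x, 0) : ℂ × ℂ)) x₁ := analyticAt_id.prod analyticAt_const
  have h0 : AnalyticAt ℂ (fun x => a 0 (x, 0)) x₁ :=
    AnalyticAt.fun_comp (f := fun x : ℂ => ((x, 0) : ℂ × ℂ)) (ha.1 0 _ hx) hsl
  rcases h0.eventually_eq_zero_or_eventually_ne_zero with h1 | h1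
  swap
  · exact h1
  exfalso
  have hm : e.symm (x₁, 0) ∈ e.source := e.map_target hx
  obtain ⟨i, hi⟩ := IsLocalEquation.exists_index W (e.symm (x₁, 0))
  have hct : ContinuousAt (fun x : ℂ => e.symm (x, 0)) x₁ :=
    (e.continuousAt_symm hx).comp (f := fun x : ℂ => ((x, 0) : ℂ × ℂ)) hsl.continuousAt
  have haxis : ∀ᶠ x in 𝓝[≠] x₁, x ∈ axis e := nhdsWithin_le_nhds ((isOpen_axis e).mem_nhds hx)
  have ht : Tendsto (fun x : ℂ => e.symm (x, 0)) (𝓝[≠] x₁) (𝓝[≠] (e.symm (x₁, 0))) := by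
    refine tendsto_nhdsWithin_iff.2 ⟨hct.tendsto.mono_left nhdsWithin_le_nhds, ?_⟩
    filter_upwards [haxis, self_mem_nhdsWithin] with x hxa hx0 heq
    have := e.symm.injOn hxa hx heq
    exact hx0 (congrArg Prod.fst this)
  have hU : ∀ᶠ x in 𝓝[≠] x₁, e.symm (x, 0) ∈ W.U i :=
    nhdsWithin_le_nhds (hct.eventually ((W.isOpen_U i).mem_nhds hi))
  obtain ⟨x, k1, k2, k3, k4, ⟨u, hu⟩⟩ := (haxis.and (h.and ((h1.filter_mono
    nhdsWithin_le_nhds).and (hU.and (ht.eventually (W.isolated_zeros i _ hi)))))).exists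
  have hpoly : slopePolynomial a (x, 0) = 0 :=
    Polynomial.funext fun p => by rw [eval_slopePolynomial, k2 k3]; simp
  have hcoeff : ∀ k, a k (x, 0) = 0 := fun k => by
    have h2 : (slopePolynomial a (x, 0)).coeff (d - (k : ℕ)) = a k (x, 0) := by
      rw [slopePolynomial, Polynomial.finsetSum_coeff, Finset.sum_eq_single k]
      · simp
      · intro j _ hjk
        rw [Polynomial.coeff_C_mul, Polynomial.coeff_X_pow, if_neg, mul_zero]
        intro h'
        exact hjk (Fin.ext (by have := j.2; have := k.2; omega))
      · simp
    rw [← h2, hpoly, Polynomial.coeff_zero]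
  obtain ⟨v, hv⟩ := (mdifferentiable_coord he).symm.mfderiv_surjective (x := (x, 0))
    (show ((x, 0) : ℂ × ℂ) ∈ e.symm.source from k1) u
  obtain ⟨g, -, hg⟩ := ha.2 i
  have := (hg (x, 0) ⟨k1, k4⟩).2 v
  simp only [inCoord, symForm, hcoeff, zero_mul, Finset.sum_const_zero, mul_zero] at this
  rw [← hv] at hu
  exact hu this

/-- The zeros of `a 0`, the poles of the slopes and the coincidences between slopes are all
isolated: by the identity theorem a difference of two slopes that is not identically zero vanishes
only on a discrete set. -/
lemma eventually_isFactored {ν n : ℕ} {W : Web (ν + n) M} {a : Fin (ν + n + 1) → ℂ × ℂ → ℂ}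
    {φ₀ : ℂ → ℂ} {φ : Fin n → ℂ → ℂ} (he : e ∈ Coord M) (hconn : IsConnected (axis e))
    (ha : IsImplicitEquation W e a) (hν : 2 ≤ ν) (hφ₀ : MeromorphicOn φ₀ (axis e))
    (hφ : ∀ α, MeromorphicOn (φ α) (axis e))
    (hfactor : ∀ᶠ x in codiscreteWithin (axis e), ∀ p : ℂ,
      slopePoly a (x, 0) p = a 0 (x, 0) * (p - φ₀ x) ^ ν * ∏ α, (p - φ α x))
    (hne₀ : ∀ α, ¬ ∀ᶠ x in codiscreteWithin (axis e), φ α x = φ₀ x)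
    (hne : ∀ α β, α ≠ β → ¬ ∀ᶠ x in codiscreteWithin (axis e), φ α x = φ β x)
    {x₁ : ℂ} (hx : x₁ ∈ axis e) : ∀ᶠ x in 𝓝[≠] x₁, IsFactored a φ₀ φ x := by
  have hopen := isOpen_axis e
  have hdich : ∀ f g : ℂ → ℂ, MeromorphicOn f (axis e) → MeromorphicOn g (axis e) →
      (¬ ∀ᶠ x in codiscreteWithin (axis e), f x = g x) → ∀ᶠ x in 𝓝[≠] x₁, f x ≠ g x := by
    intro f g hf hg hfg
    rcases eventually_codiscreteWithin_eq_or_ne hconn.isPreconnected (hf.fun_sub hg) with h1 | h1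
    · exact absurd (h1.mono fun x hx => sub_eq_zero.1 hx) hfg
    · exact (eventually_nhdsNE_of_codiscreteWithin hopen h1 hx).mono fun x hx => sub_ne_zero.1 hx
  have h1 := eventually_nhdsNE_of_codiscreteWithin hopen hfactor hx
  have h2 := eventually_lead_ne_zero he ha hx (h1.mono fun x hx h0 p => by
    rw [hx p, h0, zero_mul, zero_mul])
  have h3 : ∀ᶠ x in 𝓝[≠] x₁, ∀ α β, α ≠ β → φ α x ≠ φ β x := by
    refine eventually_all.2 fun α => eventually_all.2 fun β => ?_
    by_cases hαβ : α = β
    · simp [hαβ]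
    · exact (hdich _ _ (hφ α) (hφ β) (hne α β hαβ)).mono fun x hx _ => hx
  filter_upwards [h2, h3, eventually_all.2 fun α => hdich _ _ (hφ α) hφ₀ (hne₀ α),
    nhdsWithin_le_nhds (hopen.mem_nhds hx), (hφ₀ x₁ hx).eventually_analyticAt,
    eventually_all.2 fun α => (hφ α x₁ hx).eventually_analyticAt,
    eventually_eventually_nhdsNE_nhds h1] with x k2 k3 k4 k5 k6 k7 k8
  refine ⟨hν, fun k => ha.1 k _ k5, k2, k6, k7, k4, fun α β hαβ => ?_, k8⟩
  by_contra h'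
  exact k3 α β h' hαβ

/-- The criterion for the curvature to be holomorphic along a component of the discriminant. -/
theorem curvatureHolomorphicOn_iff [IsManifold I₂ ω M] {ν n : ℕ} (W : Web (ν + n) M)
    (D : Set M) (hD : IsIrreducibleComponent (discriminant W) D) (hsmooth : SmoothAlong W D)
    (he : e ∈ Coord M) (hDe : D ∩ e.source = {m ∈ e.source | (e m).2 = 0})
    (hconn : IsConnected (axis e)) (a : Fin (ν + n + 1) → ℂ × ℂ → ℂ)
    (ha : IsImplicitEquation W e a) (hν : 2 ≤ ν) (φ₀ : ℂ → ℂ) (φ : Fin n → ℂ → ℂ)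
    (hφ₀ : MeromorphicOn φ₀ (axis e)) (hφ : ∀ α, MeromorphicOn (φ α) (axis e))
    (hfactor : ∀ᶠ x in codiscreteWithin (axis e), ∀ p : ℂ,
      slopePoly a (x, 0) p = a 0 (x, 0) * (p - φ₀ x) ^ ν * ∏ α, (p - φ α x))
    (hne₀ : ∀ α, ¬ ∀ᶠ x in codiscreteWithin (axis e), φ α x = φ₀ x)
    (hne : ∀ α β, α ≠ β → ¬ ∀ᶠ x in codiscreteWithin (axis e), φ α x = φ β x) :
    CurvatureHolomorphicOn W D ↔ (∀ᶠ x in codiscreteWithin (axis e), φ₀ x = 0) ∨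
      (∀ᶠ x in codiscreteWithin (axis e), psi ν a φ₀ φ x = 0) := by
  have hopen := isOpen_axis e
  obtain ⟨x₁, hx₁⟩ := hconn.nonempty
  have hfac := eventually_isFactored he hconn ha hν hφ₀ hφ hfactor hne₀ hne hx₁
  have haxis : ∀ᶠ x in 𝓝[≠] x₁, x ∈ axis e := nhdsWithin_le_nhds (hopen.mem_nhds hx₁)
  -- the derivative in `y` does not vanish at generic points
  have hE := meromorphicOn_slopePoly (U := axis e)
    (fun k x hx => analyticAt_partialY (ha.1 k (x, 0) hx)) hφ₀ 0
  simp only [slopeDeriv_zero] at hE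
  have hEne : ∀ᶠ x in 𝓝[≠] x₁, slopePoly (fun k => partialY (a k)) (x, 0) (φ₀ x) ≠ 0 := by
    -- Smoothness is used at a single generic point; since `∂_yF(x, 0, φ₀(x))` is meromorphic on the
    -- connected axis, its non-vanishing spreads.
    obtain ⟨x, ⟨hx, hs⟩, hxf⟩ :=
      ((frequently_of_forGeneric hsmooth hDe hx₁).and_eventually hfac).exists
    have hs' := hs e he (e.map_target hx) (φ₀ x)
    rw [e.right_inv hx] at hs'
    have h0 : slopePoly a (x, 0) (φ₀ x) = 0 := by
      rw [← slopeDeriv_zero]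
      exact hxf.slopeDeriv_eq_zero (by omega)
    have hd0 : ν + n ≠ 0 := by omega
    have hne := hxf.slopePoly_partialY_ne_zero (fderiv_slopePoly_ne_zero hd0 he ha
      (s := ((x, 0), φ₀ x)) hx hxf.lead h0
      (hs' ((mem_charSurface_iff hd0 he ha (s := ((x, 0), φ₀ x)) hx hxf.lead).2 h0)))
    rcases eventually_codiscreteWithin_eq_or_ne hconn.isPreconnected hE with h1 | h1
    · have h2 := eventually_nhdsNE_of_codiscreteWithin hopen h1 hx
      have h3 := hxf.continuousAt_slopePoly_partialY.eventually_ne hne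
      obtain ⟨y, hy1, hy2⟩ := (h2.and (nhdsWithin_le_nhds h3)).exists
      exact absurd hy1 hy2
    · exact eventually_nhdsNE_of_codiscreteWithin hopen h1 hx₁
  have hψ : MeromorphicOn (psi ν a φ₀ φ) (axis e) := meromorphicOn_psi ha.1 hφ₀ hφ
  -- The local conclusion is `φ₀ ψ = 0` near one point; this dichotomy makes it global on the axis,
  -- where one of the factors must vanish identically.
  have hprod := eventually_codiscreteWithin_eq_or_ne hconn.isPreconnected (hφ₀.fun_mul hψ)
  constructor
  · intro hK
    obtain ⟨x, ⟨hx, hxK⟩, hxf, hxE⟩ :=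
      ((frequently_of_forGeneric hK hDe hx₁).and_eventually (hfac.and hEne)).exists
    have hres := hxf.eventually_resA_eq_zero he (ha.isLocalEquation hx) hxE
      (hxK e he (e.map_target hx))
    have hzero : ∀ᶠ y in 𝓝 x, φ₀ y * psi ν a φ₀ φ y = 0 := by
      filter_upwards [hres, hxf.eventually] with y h1 h2
      exact h2.resA_eq_zero_iff.1 h1
    rcases hprod with h1 | h1
    · rcases eventually_codiscreteWithin_eq_or_ne hconn.isPreconnected hφ₀ with h2 | h2
      · exact Or.inl h2
      · right
        filter_upwards [h1, h2] with y k1 k2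
        exact (mul_eq_zero.1 k1).resolve_left k2
    · have h2 := eventually_nhdsNE_of_codiscreteWithin hopen h1 hx
      obtain ⟨y, hy1, hy2⟩ := (h2.and (nhdsWithin_le_nhds hzero)).exists
      exact absurd hy2 hy1
  · intro h
    have h0 : ∀ᶠ x in codiscreteWithin (axis e), φ₀ x * psi ν a φ₀ φ x = 0 := by
      rcases h with h | h
      · exact h.mono fun x hx => by rw [hx, zero_mul]
      · exact h.mono fun x hx => by rw [hx, mul_zero]
    obtain ⟨x, hx, hxf, hxE⟩ := (haxis.and (hfac.and hEne)).exists
    have h1 : ∀ᶠ y in 𝓝[≠] x, IsFactored.resA a φ₀ φ y = 0 := by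
      filter_upwards [eventually_nhdsNE_of_codiscreteWithin hopen h0 hx,
        nhdsWithin_le_nhds hxf.eventually] with y k1 k2
      exact k2.resA_eq_zero_iff.2 k1
    have hm : e.symm (x, 0) ∈ D ∩ e.source := by
      rw [hDe]
      exact ⟨e.map_target hx, by rw [e.right_inv hx]⟩
    -- Extension at the single point `x` suffices for the whole component, including the part of `D`
    -- outside the coordinate domain.
    exact curvatureHolomorphicOn_of_extendsAt (by omega) hD hm.1 he hm.2
      (hxf.extendsAt_of_eventually_resA_eq_zero he (ha.isLocalEquation hx) hxE h1)

end PlanarWeb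

end

theorem corollary2p5 {M : Type*} [TopologicalSpace M] [T2Space M] [ChartedSpace (ℂ × ℂ) M]
    [IsManifold PlanarWeb.I₂ ω M] {d : ℕ} (W : PlanarWeb.Web d M) (D : Set M)
    (hD : PlanarWeb.IsIrreducibleComponent (PlanarWeb.discriminant W) D)
    (hsmooth : PlanarWeb.SmoothAlong W D)
    (e : OpenPartialHomeomorph M (ℂ × ℂ)) (he : e ∈ PlanarWeb.Coord M)
    (hDe : D ∩ e.source = {m ∈ e.source | (e m).2 = 0})
    (hconn : IsConnected (PlanarWeb.axis e))
    (a : Fin (d + 1) → ℂ × ℂ → ℂ) (ha : PlanarWeb.IsImplicitEquation W e a)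
    (ν n : ℕ) (hν : 2 ≤ ν) (hd : d = ν + n) (φ₀ : ℂ → ℂ) (φ : Fin n → ℂ → ℂ)
    (hφ₀ : MeromorphicOn φ₀ (PlanarWeb.axis e))
    (hφ : ∀ α, MeromorphicOn (φ α) (PlanarWeb.axis e))
    (hfactor : ∀ᶠ x in Filter.codiscreteWithin (PlanarWeb.axis e), ∀ p : ℂ,
      PlanarWeb.slopePoly a (x, 0) p =
        a 0 (x, 0) * (p - φ₀ x) ^ ν * ∏ α, (p - φ α x))
    (hne₀ : ∀ α, ¬ ∀ᶠ x in Filter.codiscreteWithin (PlanarWeb.axis e), φ α x = φ₀ x)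
    (hne : ∀ α β, α ≠ β →
      ¬ ∀ᶠ x in Filter.codiscreteWithin (PlanarWeb.axis e), φ α x = φ β x) :
    PlanarWeb.CurvatureHolomorphicOn W D ↔
      (∀ᶠ x in Filter.codiscreteWithin (PlanarWeb.axis e), φ₀ x = 0) ∨
      (∀ᶠ x in Filter.codiscreteWithin (PlanarWeb.axis e),
        PlanarWeb.psi ν a φ₀ φ x = 0) := by
  subst hd
  exact PlanarWeb.curvatureHolomorphicOn_iff W D hD hsmooth he hDe hconn a ha hν φ₀ φ hφ₀ hφ
    hfactor hne₀ hne
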